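/- **Theorem (Existence).** All functions are real-valued. For $u\in L^2(\mathbb{R}^2)$ define $\partial_x^{-1}u_{yy}$ through its Fourier transform $\frac{(i\eta)^2}{i\xi}\,\widehat u(\xi,\eta)$. For an integer $N\ge 0$ let $$Y^N(\mathbb{R}^2)=\{u:\ u,\ u_{xxx},\ u_{yy},\ \partial_x^{-1}u_{yy}\in H^N(\mathbb{R}^2)\},$$ $$\|u\|_{Y^N}^2=\int_{\mathbb{R}^2}\Big(u^2+\sum_{|j|\le N}\big[(\partial^j u_{xxx})^2+(\partial_x^{-1}\partial^j u_{yy})^2+(\partial^j u_{yy})^2\big]\Big)\,dx\,dy,$$ where $j=(\alpha_1,\alpha_2)\in\mathbb{Z}_{\ge0}^2$, $|j|=\alpha_1+\alpha_2$ and $\partial^j=\partial_x^{\alpha_1}\partial_y^{\alpha_2}$. For every $k_0>0$ there is a time $0<T<\infty$, depending only on $k_0$ (in particular not on $N$), such that for every integer $N\ge 0$ and every $\varphi\in Y^N(\mathbb{R}^2)$ with $\|\varphi\|_{Y^0}\le k_0$ there exists $u\in L^\infty([0,T];Y^N(\mathbb{R}^2))$, i.e. $u$ is measurable in time and $\sup_{0\le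 t\le T}\|u(t)\|_{Y^N}<\infty$, with $u_t\in L^\infty([0,T];L^2(\mathbb{R}^2))$ (so that $u$ is Lipschitz from $[0,T]$ to $L^2(\mathbb{R}^2)$), which solves the KP-I equation $$u_t+u_{xxx}+u_x+u\,u_x-\partial_x^{-1}u_{yy}=0$$ in $L^2(\mathbb{R}^2)$ for almost every $t\in(0,T)$, and satisfies $u(0)=\varphi$. -/

import Mathlib

open MeasureTheory
open scoped ENNReal NNReal FourierTransform

namespace KPI

/-- The plane `ℝ²` with coordinates `(x, y)`; also the frequency plane `(ξ, η)`. -/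
abbrev Plane := EuclideanSpace ℝ (Fin 2)

/-- Real-valued square integrable functions on the plane (modulo a.e. equality). -/
noncomputable abbrev L2 := Lp ℝ 2 (volume : Measure Plane)

/-- The (Plancherel) Fourier transform of a real-valued `L²` function, in the normalization
`û(ζ) = ∫ e^{-2πi z·ζ} u(z) dz`. -/
noncomputable def fourierL2 (u : L2) : Lp ℂ 2 (volume : Measure Plane) :=
  𝓕 (Complex.ofRealCLM.compLp u)

/-- The symbol of `∂_x`: in the above normalization it is `2πi ξ`. -/
noncomputable def symX (ζ : Plane) : ℂ := 2 * Real.pi * Complex.I * (ζ 0 : ℝ)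

/-- The symbol of `∂_y`: in the above normalization it is `2πi η`. -/
noncomputable def symY (ζ : Plane) : ℂ := 2 * Real.pi * Complex.I * (ζ 1 : ℝ)

/-- The symbol of `∂_x⁻¹ ∂_y²` (off the null set `ξ = 0`). -/
noncomputable def symInvXYY (ζ : Plane) : ℂ := symY ζ ^ 2 / symX ζ

/-- `v = m(D) u` for a Fourier symbol `m`, i.e. `v̂ = m û` almost everywhere. In particular this
says `v = ∂_x^a ∂_y^b u` when `m = symX ^ a * symY ^ b`, and `v = ∂_x⁻¹ u_yy` when
`m = symInvXYY`. -/
def IsMultiplier (m : Plane → ℂ) (u v : L2) : Prop :=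
  ∀ᵐ ζ : Plane, fourierL2 v ζ = m ζ * fourierL2 u ζ

/-- `∫ |m(D) u|² dx dy = ∫ |m û|² dξ dη`, with value `∞` if `m(D) u` is not in `L²`. -/
noncomputable def sqNorm (m : Plane → ℂ) (u : L2) : ℝ≥0∞ :=
  ∫⁻ ζ : Plane, ‖m ζ * fourierL2 u ζ‖ₑ ^ 2

/-- `m(D) u ∈ H^N(ℝ²)`: all derivatives of order at most `N` of `m(D) u` are in `L²`. -/
def InSobolev (N : ℕ) (m : Plane → ℂ) (u : L2) : Prop :=
  ∀ a b : ℕ, a + b ≤ N → sqNorm (fun ζ => symX ζ ^ a * symY ζ ^ b * m ζ) u < ∞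

/-- The space `Y^N(ℝ²)`: `u`, `u_xxx`, `u_yy` and `∂_x⁻¹ u_yy` belong to `H^N(ℝ²)`. -/
def MemY (N : ℕ) (u : L2) : Prop :=
  InSobolev N (fun _ => 1) u ∧
  InSobolev N (fun ζ => symX ζ ^ 3) u ∧
  InSobolev N (fun ζ => symY ζ ^ 2) u ∧
  InSobolev N symInvXYY u

/-- The norm of `Y^N(ℝ²)` (with value `∞` off the space):
`‖u‖² = ∫ (u² + ∑_{|j| ≤ N} [(∂^j u_xxx)² + (∂_x⁻¹ ∂^j u_yy)² + (∂^j u_yy)²])`. -/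
noncomputable def normY (N : ℕ) (u : L2) : ℝ≥0∞ :=
  (sqNorm (fun _ => 1) u +
    ∑ k ∈ Finset.range (N + 1), ∑ j ∈ Finset.HasAntidiagonal.antidiagonal k,
      (sqNorm (fun ζ => symX ζ ^ j.1 * symY ζ ^ j.2 * symX ζ ^ 3) u +
       sqNorm (fun ζ => symX ζ ^ j.1 * symY ζ ^ j.2 * symInvXYY ζ) u +
       sqNorm (fun ζ => symX ζ ^ j.1 * symY ζ ^ j.2 * symY ζ ^ 2) u)) ^ (1 / 2 : ℝ)

/-- `u ∈ L^∞([0,T] : Y^N(ℝ²))`: `u` is (strongly) measurable in time, `u(t) ∈ Y^N` for all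
`t ∈ [0,T]`, and `sup_{t ∈ [0,T]} ‖u(t)‖_{Y^N} < ∞`. -/
def MemLinftyY (N : ℕ) (T : ℝ) (u : ℝ → L2) : Prop :=
  AEStronglyMeasurable u (volume.restrict (Set.Icc 0 T)) ∧
  (∀ t ∈ Set.Icc 0 T, MemY N (u t)) ∧
  (⨆ t ∈ Set.Icc 0 T, normY N (u t)) < ∞

/-- `u` solves `u_t + u_xxx + u_x + u u_x - ∂_x⁻¹ u_yy = 0` on `ℝ² × [0,T]`:
`u` is Lipschitz in time with values in `L²` (that is, `u_t ∈ L^∞([0,T] : L²)`), and for almost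
every `t` all linear terms are in `L²` and the equation holds almost everywhere in the plane. -/
structure IsSolution (T : ℝ) (u : ℝ → L2) : Prop where
  lipschitz : ∃ K : ℝ≥0, LipschitzOnWith K u (Set.Icc 0 T)
  equation : ∀ᵐ t : ℝ, t ∈ Set.Ioo 0 T →
    ∃ ut ux uxxx w : L2,
      HasDerivAt u ut t ∧
      IsMultiplier symX (u t) ux ∧
      IsMultiplier (fun ζ => symX ζ ^ 3) (u t) uxxx ∧
      IsMultiplier symInvXYY (u t) w ∧
      ∀ᵐ z : Plane, ut z + uxxx z + ux z + u t z * ux z - w z = 0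

end KPI

namespace KPI

open scoped ComplexConjugate

/-! ### The symbol estimate -/

/-! Everything is done on the Fourier side. Put `wt`² = 1 + ξ⁶ + η⁴ + (η²/ξ)² and `br`² = 1 + ξ² +
η². Membership in Y^N amounts to square integrability of `br`^N `wt` û. There the equation reads f'
= λ f + σ (f * f), where λ is purely imaginary and σ = -πiξ comes from u u_x = (u²)_x / 2.

The heart is an energy estimate without loss of derivatives. For real u the energy production of the
nonlinearity is an integral over triples of frequencies with sum zero, and symmetrising it replaces
the symbol by the sum of `wtN`² ξ over the triple. In `symbol_estimate` this sum is bounded by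
products of two full weights and one weaker weight `br`^(max N 1). The decisive cancellations are
the factorisation of the sum of seventh powers (`abs_sum_seventh_le`) and an identity for η⁴/ξ
(`sum_quartic_div`): each leaves a factor of the lowest frequency. The weakly weighted factor is
taken in L¹, which is affordable because `br`/`wt` is square integrable on the plane
(`ratioConst_lt_top`). With E_N the weighted norm, `energy_estimate` bounds the growth of E_N² by a
constant times E_{N-1} E_N², and by E_0³ when N = 0. Hence E_0 stays bounded on a time depending on
k₀ only, and on that same interval every higher norm grows at most exponentially, by induction on N.

Solutions come from restricting to frequencies with |ξ| ≥ 1/(n+1) and `br` ≤ n+1. All symbols are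
then bounded, the equation is an ordinary differential equation in L² that conserves the L² norm,
and its solutions are global (`exists_conservative_solution`). The estimates above are uniform in n.
In L² the difference of two truncated solutions satisfies a Gronwall inequality in which the
derivative falls on the sum of the solutions, with a truncation error O(1/(n+1))
(`inner_field_sub_le`). So the truncated solutions converge in L² at each time, and the weighted
bounds survive by Fatou.

The equation passes to the limit in integrated form, first on a fixed frequency region and then on
all frequencies. Lebesgue differentiation gives the time derivative almost everywhere. Hermitian
symmetry makes the inverse transform real, and integrability of f and ξ f turns the convolution into
the pointwise product u u_x. -/

/-- The square of the Japanese bracket of `(x, y)`. -/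
def brSq (x y : ℝ) : ℝ := 1 + x ^ 2 + y ^ 2

/-- The square of the base weight. -/
noncomputable def wtSq (x y : ℝ) : ℝ := 1 + x ^ 6 + y ^ 4 + (y ^ 2 / x) ^ 2

noncomputable def br (x y : ℝ) : ℝ := √(brSq x y)

noncomputable def wt (x y : ℝ) : ℝ := √(wtSq x y)

lemma one_le_brSq (x y : ℝ) : 1 ≤ brSq x y := by unfold brSq; nlinarith [sq_nonneg x, sq_nonneg y]

lemma br_sq (x y : ℝ) : br x y ^ 2 = brSq x y := Real.sq_sqrt (by linarith [one_le_brSq x y])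

lemma wtSq_nonneg (x y : ℝ) : 0 ≤ wtSq x y := by unfold wtSq; positivity

lemma wt_sq (x y : ℝ) : wt x y ^ 2 = wtSq x y := Real.sq_sqrt (wtSq_nonneg x y)

lemma one_le_br (x y : ℝ) : 1 ≤ br x y := Real.one_le_sqrt.2 (one_le_brSq x y)

lemma br_pos (x y : ℝ) : 0 < br x y := zero_lt_one.trans_le (one_le_br x y)

lemma abs_le_br_left (x y : ℝ) : |x| ≤ br x y :=
  Real.abs_le_sqrt (by unfold brSq; nlinarith [sq_nonneg y])

lemma abs_le_br_right (x y : ℝ) : |y| ≤ br x y :=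
  Real.abs_le_sqrt (by unfold brSq; nlinarith [sq_nonneg x])

lemma one_le_wt (x y : ℝ) : 1 ≤ wt x y :=
  Real.one_le_sqrt.2 (by
    have h1 : 0 ≤ x ^ 6 := by positivity
    have h2 : 0 ≤ y ^ 4 := by positivity
    unfold wtSq; nlinarith [sq_nonneg (y ^ 2 / x)])

lemma wt_pos (x y : ℝ) : 0 < wt x y := zero_lt_one.trans_le (one_le_wt x y)

lemma abs_cube_le_wt (x y : ℝ) : |x| ^ 3 ≤ wt x y := by
  rw [← abs_pow]
  exact Real.abs_le_sqrt (by
    have h2 : 0 ≤ y ^ 4 := by positivity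
    unfold wtSq; nlinarith [sq_nonneg (y ^ 2 / x)])

lemma sq_le_wt (x y : ℝ) : y ^ 2 ≤ wt x y := by
  rw [← abs_of_nonneg (sq_nonneg y)]
  exact Real.abs_le_sqrt (by
    have h2 : 0 ≤ x ^ 6 := by positivity
    unfold wtSq; nlinarith [sq_nonneg (y ^ 2 / x)])

lemma abs_div_le_wt (x y : ℝ) : |y ^ 2 / x| ≤ wt x y :=
  Real.abs_le_sqrt (by
    have h1 : 0 ≤ x ^ 6 := by positivity
    have h2 : 0 ≤ y ^ 4 := by positivity
    unfold wtSq; nlinarith)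

lemma brSq_le_wt (x y : ℝ) : brSq x y ≤ 4 * wt x y := by
  have h1 := one_le_wt x y
  have h2 := abs_cube_le_wt x y
  have h3 := sq_le_wt x y
  have h4 : x ^ 2 ≤ 1 + |x| ^ 3 := by
    rw [← sq_abs]
    have := abs_nonneg x
    nlinarith [mul_nonneg this (sq_nonneg (|x| - 1)), sq_nonneg (|x| - 1)]
  unfold brSq
  linarith

lemma br_le_wt (x y : ℝ) : br x y ≤ 4 * wt x y := by
  have h1 := brSq_le_wt x y
  rw [← br_sq] at h1
  nlinarith [one_le_br x y]

/-- Convexity of the cube. It lets |x|³ at one frequency be charged to the weights of the other two.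
-/
lemma abs_add_cube_le {a b c : ℝ} (h : a + b + c = 0) : |a| ^ 3 ≤ 4 * (|b| ^ 3 + |c| ^ 3) := by
  have h1 : |a| ≤ |b| + |c| := by
    rw [show a = -(b + c) by linarith, abs_neg]; exact abs_add_le b c
  have hb := abs_nonneg b
  have hc := abs_nonneg c
  calc |a| ^ 3 ≤ (|b| + |c|) ^ 3 := pow_le_pow_left₀ (abs_nonneg a) h1 3
    _ ≤ _ := by nlinarith [mul_nonneg (add_nonneg hb hc) (sq_nonneg (|b| - |c|))]

lemma add_add_cube_le {p q r : ℝ} (hp : 0 ≤ p) (hq : 0 ≤ q) (hr : 0 ≤ r) :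
    (p + q + r) ^ 3 ≤ 9 * (p ^ 3 + q ^ 3 + r ^ 3) := by
  nlinarith [mul_nonneg (add_nonneg hp hq) (sq_nonneg (p - q)),
    mul_nonneg (add_nonneg hq hr) (sq_nonneg (q - r)),
    mul_nonneg (add_nonneg hp hr) (sq_nonneg (p - r)),
    mul_nonneg hp (sq_nonneg (q - r)), mul_nonneg hq (sq_nonneg (p - r)),
    mul_nonneg hr (sq_nonneg (p - q))]

/-- The cancellation in the sum of seventh powers. -/
lemma abs_sum_seventh_le {a b c : ℝ} (h : a + b + c = 0) :
    |a ^ 7 + b ^ 7 + c ^ 7| ≤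
      63 * |a| * (|a| ^ 3 * |b| ^ 3 + |b| ^ 3 * |c| ^ 3 + |a| ^ 3 * |c| ^ 3) := by
  -- On a + b + c = 0 the power sum factors through abc. The factor a is kept aside as the
  -- low-frequency one, and bc joins the square to form a cube of pairwise products.
  have e : a ^ 7 + b ^ 7 + c ^ 7 = 7 * a * (b * c) * (a * b + b * c + a * c) ^ 2 := by
    obtain rfl : c = -(a + b) := by linarith
    ring
  rw [e, abs_mul, abs_mul, abs_mul, abs_of_nonneg (by norm_num : (0 : ℝ) ≤ 7), abs_pow]
  have h0 := abs_nonneg (a * b)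
  have h1 := abs_nonneg (b * c)
  have h2 := abs_nonneg (a * c)
  have hs : |a * b + b * c + a * c| ≤ |a * b| + |b * c| + |a * c| := abs_add_three _ _ _
  have h3 : |b * c| * |a * b + b * c + a * c| ^ 2 ≤
      9 * (|a * b| ^ 3 + |b * c| ^ 3 + |a * c| ^ 3) :=
    calc |b * c| * |a * b + b * c + a * c| ^ 2
        ≤ (|a * b| + |b * c| + |a * c|) * (|a * b| + |b * c| + |a * c|) ^ 2 := by
          gcongr; linarith
      _ = (|a * b| + |b * c| + |a * c|) ^ 3 := by ring
      _ ≤ _ := add_add_cube_le h0 h1 h2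
  simp only [abs_mul, mul_pow] at h3 ⊢
  calc _ = 7 * |a| * (|b| * |c| * |a * b + b * c + a * c| ^ 2) := by ring
    _ ≤ 7 * |a| * _ := mul_le_mul_of_nonneg_left h3 (by positivity)
    _ = _ := by ring

/-- The sum of the pairwise products. -/
def pairSum (a b c : ℝ) : ℝ := a * b + b * c + a * c

/-! ### The symbol estimate when the first frequency has the smallest bracket. -/

section LowFrequency

variable {x₁ x₂ x₃ y₁ y₂ y₃ : ℝ}

/-- The triangle inequality: the two larger frequencies of a triple with sum zero are comparable. -/
lemma br_le_two_mul (hx : x₁ + x₂ + x₃ = 0) (hy : y₁ + y₂ + y₃ = 0)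
    (h : br x₁ y₁ ≤ br x₃ y₃) : br x₂ y₂ ≤ 2 * br x₃ y₃ := by
  refine abs_le_of_sq_le_sq' ?_ (by linarith [br_pos x₃ y₃]) |>.2
  have h' : brSq x₁ y₁ ≤ brSq x₃ y₃ := by
    rw [← br_sq, ← br_sq]; exact pow_le_pow_left₀ (br_pos _ _).le h 2
  rw [mul_pow, br_sq, br_sq]
  obtain rfl : x₂ = -(x₁ + x₃) := by linarith
  obtain rfl : y₂ = -(y₁ + y₃) := by linarith
  unfold brSq at *
  nlinarith [sq_nonneg (x₁ - x₃), sq_nonneg (y₁ - y₃)]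

/-- Mean value estimate: frequencies 2 and 3 differ, up to sign, by the first one, so the difference
of their Sobolev weights gains `br x₁ y₁` over `br x₂ y₂`. The extra factor `br x₂ y₂` on the left
is the derivative that this gain pays for. -/
lemma abs_brSq_pow_sub_le (N : ℕ) (hx : x₁ + x₂ + x₃ = 0) (hy : y₁ + y₂ + y₃ = 0)
    (h₂ : br x₂ y₂ ≤ 2 * br x₃ y₃) (h₃ : br x₃ y₃ ≤ 2 * br x₂ y₂) :
    |brSq x₂ y₂ ^ N - brSq x₃ y₃ ^ N| * br x₂ y₂ ≤
      6 * N * 2 ^ N * br x₁ y₁ * (br x₂ y₂ ^ N * br x₃ y₃ ^ N) := by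
  obtain _ | n := N
  · simp
  have p1 := br_pos x₁ y₁
  have p2 := br_pos x₂ y₂
  have p3 := br_pos x₃ y₃
  have hd : |brSq x₂ y₂ - brSq x₃ y₃| ≤ 6 * br x₁ y₁ * br x₃ y₃ := by
    have e : brSq x₂ y₂ - brSq x₃ y₃ = -(x₁ * (x₂ - x₃) + y₁ * (y₂ - y₃)) := by
      obtain rfl : x₁ = -(x₂ + x₃) := by linarith
      obtain rfl : y₁ = -(y₂ + y₃) := by linarith
      unfold brSq; ring
    rw [e, abs_neg]
    have hx' : |x₂ - x₃| ≤ 3 * br x₃ y₃ := by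
      have := abs_sub x₂ x₃
      linarith [abs_le_br_left x₂ y₂, abs_le_br_left x₃ y₃]
    have hy' : |y₂ - y₃| ≤ 3 * br x₃ y₃ := by
      have := abs_sub y₂ y₃
      linarith [abs_le_br_right x₂ y₂, abs_le_br_right x₃ y₃]
    calc _ ≤ |x₁ * (x₂ - x₃)| + |y₁ * (y₂ - y₃)| := abs_add_le _ _
      _ = |x₁| * |x₂ - x₃| + |y₁| * |y₂ - y₃| := by rw [abs_mul, abs_mul]
      _ ≤ br x₁ y₁ * (3 * br x₃ y₃) + br x₁ y₁ * (3 * br x₃ y₃) := by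
        gcongr
        · exact abs_le_br_left _ _
        · exact abs_le_br_right _ _
      _ = _ := by ring
  have hm : max |brSq x₂ y₂| |brSq x₃ y₃| ≤ 2 * (br x₂ y₂ * br x₃ y₃) := by
    rw [← br_sq, ← br_sq, abs_of_nonneg (sq_nonneg _), abs_of_nonneg (sq_nonneg _)]
    exact max_le (by nlinarith) (by nlinarith)
  calc _ ≤ (|brSq x₂ y₂ - brSq x₃ y₃| * (n + 1 : ℕ) *
          max |brSq x₂ y₂| |brSq x₃ y₃| ^ (n + 1 - 1)) * br x₂ y₂ := by
        gcongr; exact abs_pow_sub_pow_le _ _ _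
    _ ≤ (6 * br x₁ y₁ * br x₃ y₃ * (n + 1 : ℕ) * (2 * (br x₂ y₂ * br x₃ y₃)) ^ n) * br x₂ y₂ := by
        rw [Nat.add_sub_cancel]; gcongr
    _ = 6 * (n + 1 : ℕ) * 2 ^ n * br x₁ y₁ * (br x₂ y₂ ^ (n + 1) * br x₃ y₃ ^ (n + 1)) := by ring
    _ ≤ _ := by
        gcongr
        · norm_num
        · omega

variable (hx : x₁ + x₂ + x₃ = 0) (hy : y₁ + y₂ + y₃ = 0)
  (h12 : br x₁ y₁ ≤ br x₂ y₂) (h13 : br x₁ y₁ ≤ br x₃ y₃)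

/-- The factor |x| cancels one of the two denominators of (y²/x)², leaving a single y²/x, which the
weight controls, times y². -/
lemma wtSq_mul_abs (x y : ℝ) (h : x ≠ 0) :
    wtSq x y * |x| = |x| + |x| * (|x| ^ 3 * |x| ^ 3) + |x| * y ^ 4 + |y ^ 2 / x| * y ^ 2 := by
  have e : |y ^ 2 / x| = y ^ 2 / |x| := by rw [abs_div, abs_of_nonneg (sq_nonneg y)]
  have e2 : (y ^ 2 / x) ^ 2 = (y ^ 2 / |x|) ^ 2 := by rw [← sq_abs, e]
  have : |x| ≠ 0 := abs_ne_zero.2 h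
  have e3 : x ^ 6 = |x| ^ 6 := by rw [show x ^ 6 = (x ^ 2) ^ 3 by ring, ← sq_abs]; ring
  rw [wtSq, e, e2, e3]
  field_simp

-- In each term one factor is bounded by `br x₁ y₁`, and what remains is split between the weights:
-- |x₁|³ moves to frequencies 2 and 3 by convexity, and y₁² moves to frequency 2 because `br x₁ y₁`
-- is the smaller bracket.
include hx h12 in
lemma wtSq_mul_abs_low_le (h₁ : x₁ ≠ 0) :
    wtSq x₁ y₁ * |x₁| ≤
      13 * br x₁ y₁ * pairSum (wt x₁ y₁) (wt x₂ y₂) (wt x₃ y₃) := by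
  have w1 := one_le_wt x₁ y₁
  have w2 := one_le_wt x₂ y₂
  have w3 := one_le_wt x₃ y₃
  have p1 := br_pos x₁ y₁
  have p2 := br_pos x₂ y₂
  have c := (abs_add_cube_le hx).trans (mul_le_mul_of_nonneg_left
    (add_le_add (abs_cube_le_wt x₂ y₂) (abs_cube_le_wt x₃ y₃)) (by norm_num))
  have hl := abs_le_br_left x₁ y₁
  have hy1 : y₁ ^ 2 ≤ br x₁ y₁ * br x₂ y₂ := by
    rw [← sq_abs]; nlinarith [abs_le_br_right x₁ y₁, abs_nonneg y₁]
  have hy1' : y₁ ^ 2 ≤ 4 * wt x₂ y₂ := by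
    have := brSq_le_wt x₂ y₂
    rw [← br_sq] at this
    nlinarith
  rw [wtSq_mul_abs _ _ h₁]
  have t1 : |x₁| ≤ br x₁ y₁ * (wt x₂ y₂ * wt x₃ y₃) := by nlinarith [one_le_mul_of_one_le_of_one_le w2 w3]
  have t2 : |x₁| * (|x₁| ^ 3 * |x₁| ^ 3) ≤
      br x₁ y₁ * (wt x₁ y₁ * (4 * (wt x₂ y₂ + wt x₃ y₃))) := by
    gcongr; exact abs_cube_le_wt _ _
  have t3 : |x₁| * y₁ ^ 4 ≤ br x₁ y₁ * (wt x₁ y₁ * (4 * wt x₂ y₂)) := by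
    rw [show y₁ ^ 4 = y₁ ^ 2 * y₁ ^ 2 by ring]
    gcongr; exact sq_le_wt _ _
  have t4 : |y₁ ^ 2 / x₁| * y₁ ^ 2 ≤ wt x₁ y₁ * (br x₁ y₁ * (4 * wt x₂ y₂)) := by
    gcongr
    · exact abs_div_le_wt _ _
    · exact hy1.trans (by gcongr; exact br_le_wt _ _)
  have q1 : 0 ≤ br x₁ y₁ * (wt x₂ y₂ * wt x₃ y₃) := by positivity
  have q2 : 0 ≤ br x₁ y₁ * (wt x₁ y₁ * wt x₃ y₃) := by positivity
  unfold pairSum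
  nlinarith

-- The same splitting at a high frequency costs `br x₂ y₂` instead of `br x₁ y₁`. It is only used
-- against a difference of Sobolev weights, where `abs_brSq_pow_sub_le` exchanges the two.
include hx hy h12 h13 in
lemma wtSq_mul_abs_high_le (h₂ : x₂ ≠ 0) :
    wtSq x₂ y₂ * |x₂| ≤
      29 * br x₂ y₂ * pairSum (wt x₁ y₁) (wt x₂ y₂) (wt x₃ y₃) := by
  have w1 := one_le_wt x₁ y₁
  have w2 := one_le_wt x₂ y₂
  have w3 := one_le_wt x₃ y₃
  have p1 := br_pos x₁ y₁
  have p2 := br_pos x₂ y₂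
  have p3 := br_pos x₃ y₃
  have h23 := br_le_two_mul hx hy h13
  have c := (abs_add_cube_le (show x₂ + x₁ + x₃ = 0 by linarith)).trans
    (mul_le_mul_of_nonneg_left
    (add_le_add (abs_cube_le_wt x₁ y₁) (abs_cube_le_wt x₃ y₃)) (by norm_num))
  have hl := abs_le_br_left x₂ y₂
  have hy1 : y₂ ^ 2 ≤ br x₂ y₂ * (2 * br x₃ y₃) := by
    rw [← sq_abs]; nlinarith [abs_le_br_right x₂ y₂, abs_nonneg y₂]
  have hy1' : y₂ ^ 2 ≤ 16 * wt x₃ y₃ := by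
    have := brSq_le_wt x₃ y₃
    rw [← br_sq] at this
    nlinarith
  rw [wtSq_mul_abs _ _ h₂]
  have t1 : |x₂| ≤ br x₂ y₂ * (wt x₂ y₂ * wt x₃ y₃) := by nlinarith [one_le_mul_of_one_le_of_one_le w2 w3]
  have t2 : |x₂| * (|x₂| ^ 3 * |x₂| ^ 3) ≤
      br x₂ y₂ * (wt x₂ y₂ * (4 * (wt x₁ y₁ + wt x₃ y₃))) := by
    gcongr; exact abs_cube_le_wt _ _
  have t3 : |x₂| * y₂ ^ 4 ≤ br x₂ y₂ * (wt x₂ y₂ * (16 * wt x₃ y₃)) := by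
    rw [show y₂ ^ 4 = y₂ ^ 2 * y₂ ^ 2 by ring]
    gcongr; exact sq_le_wt _ _
  have t4 : |y₂ ^ 2 / x₂| * y₂ ^ 2 ≤ wt x₂ y₂ * (br x₂ y₂ * (2 * (4 * wt x₃ y₃))) := by
    gcongr
    · exact abs_div_le_wt _ _
    · exact hy1.trans (by gcongr; exact br_le_wt _ _)
  have q1 : 0 ≤ br x₂ y₂ * (wt x₁ y₁ * wt x₂ y₂) := by positivity
  have q2 : 0 ≤ br x₂ y₂ * (wt x₁ y₁ * wt x₃ y₃) := by positivity
  unfold pairSum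
  nlinarith

/-- The cancellation specific to the antiderivative term: on the right every summand contains x₁ or
y₁, so the derivative lands on the low frequency, and each quotient y²/x is controlled by its own
weight. -/
lemma sum_quartic_div (h₁ : x₁ ≠ 0) (h₂ : x₂ ≠ 0) (h₃ : x₃ ≠ 0)
    (hx : x₁ + x₂ + x₃ = 0) (hy : y₁ + y₂ + y₃ = 0) :
    (y₁ ^ 2 / x₁) ^ 2 * x₁ + (y₂ ^ 2 / x₂) ^ 2 * x₂ + (y₃ ^ 2 / x₃) ^ 2 * x₃ =
      y₁ ^ 2 / x₁ * y₁ ^ 2 - x₁ * (y₂ ^ 2 / x₂ * (y₃ ^ 2 / x₃)) -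
        y₁ * (y₂ ^ 2 / x₂ - y₃ ^ 2 / x₃) * (y₂ - y₃) := by
  obtain rfl : x₁ = -(x₂ + x₃) := by linarith
  obtain rfl : y₁ = -(y₂ + y₃) := by linarith
  have h : x₂ + x₃ ≠ 0 := fun h => h₁ (by rw [h, neg_zero])
  field_simp
  ring

include hx hy h12 h13 in
lemma abs_sum_wtSq_mul_le (h₁ : x₁ ≠ 0) (h₂ : x₂ ≠ 0) (h₃ : x₃ ≠ 0) :
    |wtSq x₁ y₁ * x₁ + wtSq x₂ y₂ * x₂ + wtSq x₃ y₃ * x₃| ≤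
      400 * br x₁ y₁ * pairSum (wt x₁ y₁) (wt x₂ y₂) (wt x₃ y₃) := by
  have w1 := one_le_wt x₁ y₁
  have w2 := one_le_wt x₂ y₂
  have w3 := one_le_wt x₃ y₃
  have p1 := br_pos x₁ y₁
  have p2 := br_pos x₂ y₂
  have p3 := br_pos x₃ y₃
  have h23 := br_le_two_mul hx hy h13
  have h32 := br_le_two_mul (x₁ := x₁) (y₁ := y₁) (x₂ := x₃) (y₂ := y₃) (x₃ := x₂) (y₃ := y₂)
    (by linarith) (by linarith) h12
  have b1 := brSq_le_wt x₁ y₁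
  have b2 := brSq_le_wt x₂ y₂
  have b3 := brSq_le_wt x₃ y₃
  rw [← br_sq] at b1 b2 b3
  have l2 := br_le_wt x₂ y₂
  have l3 := br_le_wt x₃ y₃
  have ay1 := abs_le_br_right x₁ y₁
  have ay2 := abs_le_br_right x₂ y₂
  have ay3 := abs_le_br_right x₃ y₃
  have ax1 := abs_le_br_left x₁ y₁
  have ax2 := abs_le_br_left x₂ y₂
  have hyd : |y₂ - y₃| ≤ br x₂ y₂ + br x₃ y₃ := (abs_sub _ _).trans (add_le_add ay2 ay3)
  have sy1 : y₁ ^ 2 ≤ br x₁ y₁ * br x₂ y₂ := by rw [← sq_abs]; nlinarith [abs_nonneg y₁]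
  have sy2 : y₂ ^ 2 ≤ br x₂ y₂ ^ 2 := by rw [← sq_abs]; gcongr
  have sy3 : y₃ ^ 2 ≤ br x₃ y₃ ^ 2 := by rw [← sq_abs]; gcongr
  have s32 : br x₃ y₃ ^ 2 ≤ 4 * br x₂ y₂ ^ 2 := by nlinarith
  have s23 : br x₂ y₂ ^ 2 ≤ 4 * br x₃ y₃ ^ 2 := by nlinarith
  have s12 : br x₁ y₁ ^ 2 ≤ br x₂ y₂ ^ 2 := by gcongr
  have sy1' : y₁ ^ 2 ≤ br x₁ y₁ ^ 2 := by rw [← sq_abs]; gcongr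
  -- The constant part of the weight contributes x₁ + x₂ + x₃ = 0. In the quartic part x₃ is
  -- eliminated, and y₂⁴ - y₃⁴ is factored through y₂ + y₃ = -y₁. Every summand now has a
  -- low-frequency factor.
  have e : wtSq x₁ y₁ * x₁ + wtSq x₂ y₂ * x₂ + wtSq x₃ y₃ * x₃ =
      (x₁ ^ 7 + x₂ ^ 7 + x₃ ^ 7) + x₁ * y₁ ^ 4 + (-(x₁ * y₃ ^ 4)) +
      (-(y₁ * (x₂ * ((y₂ - y₃) * (y₂ ^ 2 + y₃ ^ 2))))) + y₁ ^ 2 / x₁ * y₁ ^ 2 +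
      (-(x₁ * (y₂ ^ 2 / x₂ * (y₃ ^ 2 / x₃)))) +
        (-(y₁ * (y₂ ^ 2 / x₂ - y₃ ^ 2 / x₃) * (y₂ - y₃))) := by
    have := sum_quartic_div h₁ h₂ h₃ hx hy
    have hy' : y₁ * (x₂ * ((y₂ - y₃) * (y₂ ^ 2 + y₃ ^ 2))) = - (x₂ * (y₂ ^ 4 - y₃ ^ 4)) := by
      obtain rfl : y₁ = -(y₂ + y₃) := by linarith
      ring
    have hx3 : x₃ * y₃ ^ 4 = - (x₁ * y₃ ^ 4) - x₂ * y₃ ^ 4 := by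
      obtain rfl : x₃ = -(x₁ + x₂) := by linarith
      ring
    unfold wtSq
    linear_combination this + hx + hx3 + hy'
  have t1 := abs_sum_seventh_le hx
  have t1' : 63 * |x₁| * (|x₁| ^ 3 * |x₂| ^ 3 + |x₂| ^ 3 * |x₃| ^ 3 + |x₁| ^ 3 * |x₃| ^ 3) ≤
      63 * br x₁ y₁ * pairSum (wt x₁ y₁) (wt x₂ y₂) (wt x₃ y₃) := by
    unfold pairSum
    gcongr <;> exact abs_cube_le_wt _ _
  have t2 : |x₁ * y₁ ^ 4| ≤ br x₁ y₁ * (wt x₁ y₁ * (4 * wt x₂ y₂)) := by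
    rw [abs_mul, abs_of_nonneg (by positivity : 0 ≤ y₁ ^ 4),
      show y₁ ^ 4 = y₁ ^ 2 * y₁ ^ 2 by ring]
    gcongr
    · exact sq_le_wt _ _
    · linarith
  have t3 : |(-(x₁ * y₃ ^ 4))| ≤ br x₁ y₁ * (wt x₃ y₃ * (16 * wt x₂ y₂)) := by
    rw [abs_neg, abs_mul, abs_of_nonneg (by positivity : 0 ≤ y₃ ^ 4),
      show y₃ ^ 4 = y₃ ^ 2 * y₃ ^ 2 by ring]
    gcongr
    · exact sq_le_wt _ _
    · linarith
  have t4 : |(-(y₁ * (x₂ * ((y₂ - y₃) * (y₂ ^ 2 + y₃ ^ 2)))))| ≤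
      br x₁ y₁ * (240 * (wt x₂ y₂ * wt x₃ y₃)) := by
    rw [abs_neg, abs_mul, abs_mul, abs_mul, abs_of_nonneg (by positivity : 0 ≤ y₂ ^ 2 + y₃ ^ 2)]
    refine mul_le_mul ay1 ?_ (by positivity) p1.le
    calc |x₂| * (|y₂ - y₃| * (y₂ ^ 2 + y₃ ^ 2))
        ≤ br x₂ y₂ * ((3 * br x₂ y₂) * (5 * br x₃ y₃ ^ 2)) := by
          gcongr
          · linarith
          · linarith
      _ = 15 * (br x₂ y₂ ^ 2 * br x₃ y₃ ^ 2) := by ring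
      _ ≤ 15 * ((4 * wt x₂ y₂) * (4 * wt x₃ y₃)) := by gcongr
      _ = _ := by ring
  have t5 : |y₁ ^ 2 / x₁ * y₁ ^ 2| ≤ wt x₁ y₁ * (br x₁ y₁ * (4 * wt x₂ y₂)) := by
    rw [abs_mul, abs_of_nonneg (sq_nonneg y₁)]
    gcongr
    · exact abs_div_le_wt _ _
    · exact sy1.trans (by gcongr)
  have t6 : |(-(x₁ * (y₂ ^ 2 / x₂ * (y₃ ^ 2 / x₃))))| ≤ br x₁ y₁ * (wt x₂ y₂ * wt x₃ y₃) := by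
    rw [abs_neg, abs_mul, abs_mul]
    gcongr <;> exact abs_div_le_wt _ _
  have t7 : |(-(y₁ * (y₂ ^ 2 / x₂ - y₃ ^ 2 / x₃) * (y₂ - y₃)))| ≤
      br x₁ y₁ * (24 * (wt x₂ y₂ * wt x₃ y₃)) := by
    rw [abs_neg, abs_mul, abs_mul, mul_assoc]
    refine mul_le_mul ay1 ?_ (by positivity) p1.le
    calc |y₂ ^ 2 / x₂ - y₃ ^ 2 / x₃| * |y₂ - y₃| ≤ (wt x₂ y₂ + wt x₃ y₃) * (br x₂ y₂ + br x₃ y₃) := by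
          gcongr
          exact (abs_sub _ _).trans (add_le_add (abs_div_le_wt _ _) (abs_div_le_wt _ _))
      _ = wt x₂ y₂ * (br x₂ y₂ + br x₃ y₃) + wt x₃ y₃ * (br x₂ y₂ + br x₃ y₃) := by ring
      _ ≤ wt x₂ y₂ * (3 * (4 * wt x₃ y₃)) + wt x₃ y₃ * (3 * (4 * wt x₂ y₂)) := by
          refine add_le_add (mul_le_mul_of_nonneg_left ?_ (by linarith))
            (mul_le_mul_of_nonneg_left ?_ (by linarith)) <;> linarith
      _ = _ := by ring
  have q1 : 0 ≤ br x₁ y₁ * (wt x₁ y₁ * wt x₂ y₂) := by positivity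
  have q2 : 0 ≤ br x₁ y₁ * (wt x₁ y₁ * wt x₃ y₃) := by positivity
  have q3 : 0 ≤ br x₁ y₁ * (wt x₂ y₂ * wt x₃ y₃) := by positivity
  rw [e]
  refine (abs_add_le _ _).trans ?_
  refine (add_le_add (abs_add_le _ _) t7).trans ?_
  refine (add_le_add (add_le_add (abs_add_le _ _) t6) le_rfl).trans ?_
  refine (add_le_add (add_le_add (add_le_add (abs_add_le _ _) t5) le_rfl) le_rfl).trans ?_
  refine (add_le_add (add_le_add (add_le_add (add_le_add (abs_add_three _ _ _) t4)
    le_rfl) le_rfl) le_rfl).trans ?_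
  have := t1.trans t1'
  unfold pairSum at *
  linarith

include hx hy h12 h13 in
lemma abs_sum_weight_le (N : ℕ) (h₁ : x₁ ≠ 0) (h₂ : x₂ ≠ 0) (h₃ : x₃ ≠ 0) :
    |brSq x₁ y₁ ^ N * wtSq x₁ y₁ * x₁ + brSq x₂ y₂ ^ N * wtSq x₂ y₂ * x₂ +
      brSq x₃ y₃ ^ N * wtSq x₃ y₃ * x₃| ≤
      (413 + 174 * N) * 2 ^ N * (br x₂ y₂ ^ N * br x₃ y₃ ^ N * br x₁ y₁ *
        pairSum (wt x₁ y₁) (wt x₂ y₂) (wt x₃ y₃)) := by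
  have w1 := wt_pos x₁ y₁
  have w2 := wt_pos x₂ y₂
  have w3 := wt_pos x₃ y₃
  have p1 := br_pos x₁ y₁
  have p2 := br_pos x₂ y₂
  have p3 := br_pos x₃ y₃
  have h23 := br_le_two_mul hx hy h13
  have h32 := br_le_two_mul (x₁ := x₁) (y₁ := y₁) (x₂ := x₃) (y₂ := y₃) (x₃ := x₂) (y₃ := y₂)
    (by linarith) (by linarith) h12
  have A := abs_sum_wtSq_mul_le hx hy h12 h13 h₁ h₂ h₃
  have B := wtSq_mul_abs_low_le (y₃ := y₃) hx h12 h₁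
  have C := wtSq_mul_abs_high_le hx hy h12 h13 h₂
  have D := abs_brSq_pow_sub_le N hx hy h23 h32
  set S := pairSum (wt x₁ y₁) (wt x₂ y₂) (wt x₃ y₃)
  have hS : 0 ≤ S := by unfold S pairSum; positivity
  have hq3 : brSq x₃ y₃ ^ N ≤ 2 ^ N * (br x₂ y₂ ^ N * br x₃ y₃ ^ N) := by
    rw [← mul_pow, ← mul_pow, ← br_sq]
    gcongr; nlinarith
  have hq13 : |brSq x₁ y₁ ^ N - brSq x₃ y₃ ^ N| ≤ brSq x₃ y₃ ^ N := by
    have h1 : brSq x₁ y₁ ^ N ≤ brSq x₃ y₃ ^ N := by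
      rw [← br_sq, ← br_sq]; gcongr
    have h0 : 0 ≤ brSq x₁ y₁ ^ N := by rw [← br_sq]; positivity
    rw [abs_sub_comm, abs_of_nonneg (by linarith)]; linarith
  have q3 : 0 ≤ brSq x₃ y₃ ^ N := by rw [← br_sq]; positivity
  -- The Sobolev weight of frequency 3 is taken as the common factor: the case N = 0 handles the
  -- main sum, and the two corrections carry differences of Sobolev weights. The constants add up as
  -- 400 + 13 = 413 and 6 · 29 = 174.
  have e : brSq x₁ y₁ ^ N * wtSq x₁ y₁ * x₁ + brSq x₂ y₂ ^ N * wtSq x₂ y₂ * x₂ +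
      brSq x₃ y₃ ^ N * wtSq x₃ y₃ * x₃ =
      brSq x₃ y₃ ^ N * (wtSq x₁ y₁ * x₁ + wtSq x₂ y₂ * x₂ + wtSq x₃ y₃ * x₃) +
      (brSq x₁ y₁ ^ N - brSq x₃ y₃ ^ N) * (wtSq x₁ y₁ * x₁) +
      (brSq x₂ y₂ ^ N - brSq x₃ y₃ ^ N) * (wtSq x₂ y₂ * x₂) := by ring
  rw [e]
  refine (abs_add_three _ _ _).trans ?_
  simp only [abs_mul, abs_of_nonneg q3, abs_of_nonneg (wtSq_nonneg _ _)]
  have T1 := mul_le_mul hq3 A (abs_nonneg _) (by positivity)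
  have T2 := mul_le_mul (hq13.trans hq3) B (mul_nonneg (wtSq_nonneg _ _) (abs_nonneg _))
    (by positivity)
  have T3 : |brSq x₂ y₂ ^ N - brSq x₃ y₃ ^ N| * (wtSq x₂ y₂ * |x₂|) ≤
      6 * N * 2 ^ N * br x₁ y₁ * (br x₂ y₂ ^ N * br x₃ y₃ ^ N) * (29 * S) :=
    calc _ ≤ |brSq x₂ y₂ ^ N - brSq x₃ y₃ ^ N| * (29 * br x₂ y₂ * S) := by gcongr
      _ = |brSq x₂ y₂ ^ N - brSq x₃ y₃ ^ N| * br x₂ y₂ * (29 * S) := by ring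
      _ ≤ _ := by gcongr
  refine (add_le_add (add_le_add T1 T2) T3).trans (le_of_eq ?_)
  ring

end LowFrequency

/-- The weight of the norm of order `N`. -/
noncomputable def wtN (N : ℕ) (x y : ℝ) : ℝ := br x y ^ N * wt x y

/-- The weight of the low-frequency factor in the energy estimate of order `N`. -/
noncomputable def lowN (N : ℕ) (x y : ℝ) : ℝ := br x y ^ max N 1

lemma wtN_pos (N : ℕ) (x y : ℝ) : 0 < wtN N x y := mul_pos (pow_pos (br_pos _ _) _) (wt_pos _ _)

lemma lowN_pos (N : ℕ) (x y : ℝ) : 0 < lowN N x y := pow_pos (br_pos _ _) _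

lemma wtN_sq (N : ℕ) (x y : ℝ) : wtN N x y ^ 2 = brSq x y ^ N * wtSq x y := by
  rw [wtN, mul_pow, wt_sq, ← pow_mul, mul_comm N, pow_mul, br_sq]

/-- For N ≥ 1 the lone factor j₁ is at most j₁^N. For N = 0 it is at most j₂, which is the reason
for the exponent `max N 1`. -/
lemma low_mul_le (N : ℕ) {j₁ j₂ w₁ w₃ : ℝ} (h1 : 1 ≤ j₁) (h : j₁ ≤ j₂) (hw₁ : 0 ≤ w₁)
    (hw₃ : 0 ≤ w₃) :
    j₂ ^ N * j₁ * (w₁ * w₃) ≤ j₂ ^ max N 1 * (j₁ ^ N * w₁) * w₃ := by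
  have h0 : (0 : ℝ) ≤ j₁ := by linarith
  have h2 : (0 : ℝ) ≤ j₂ := by linarith
  obtain _ | n := N
  · simp only [pow_zero, one_mul, zero_le, sup_of_le_right, pow_one]
    nlinarith [mul_nonneg hw₁ hw₃]
  · rw [max_eq_left (by omega)]
    have : j₁ ≤ j₁ ^ (n + 1) := le_self_pow₀ h1 (by omega)
    calc _ = j₂ ^ (n + 1) * (j₁ * w₁) * w₃ := by ring
      _ ≤ _ := by gcongr

/-- The trilinear combination of weights dominating the symbol. -/
noncomputable def triWeight (N : ℕ) (x₁ y₁ x₂ y₂ x₃ y₃ : ℝ) : ℝ :=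
  lowN N x₁ y₁ * wtN N x₂ y₂ * wtN N x₃ y₃ + lowN N x₂ y₂ * wtN N x₁ y₁ * wtN N x₃ y₃ +
    lowN N x₃ y₃ * wtN N x₁ y₁ * wtN N x₂ y₂

/-- **Symbol estimate** behind the energy inequality. -/
theorem symbol_estimate (N : ℕ) {x₁ x₂ x₃ y₁ y₂ y₃ : ℝ} (hx : x₁ + x₂ + x₃ = 0)
    (hy : y₁ + y₂ + y₃ = 0) (h₁ : x₁ ≠ 0) (h₂ : x₂ ≠ 0) (h₃ : x₃ ≠ 0) :
    |wtN N x₁ y₁ ^ 2 * x₁ + wtN N x₂ y₂ ^ 2 * x₂ + wtN N x₃ y₃ ^ 2 * x₃| ≤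
      (413 + 174 * N) * 2 ^ N * triWeight N x₁ y₁ x₂ y₂ x₃ y₃ := by
  have key : ∀ {x₁ x₂ x₃ y₁ y₂ y₃ : ℝ}, x₁ + x₂ + x₃ = 0 → y₁ + y₂ + y₃ = 0 → x₁ ≠ 0 → x₂ ≠ 0 →
      x₃ ≠ 0 → br x₁ y₁ ≤ br x₂ y₂ → br x₁ y₁ ≤ br x₃ y₃ →
      |wtN N x₁ y₁ ^ 2 * x₁ + wtN N x₂ y₂ ^ 2 * x₂ + wtN N x₃ y₃ ^ 2 * x₃| ≤
      (413 + 174 * N) * 2 ^ N * triWeight N x₁ y₁ x₂ y₂ x₃ y₃ := by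
    intro x₁ x₂ x₃ y₁ y₂ y₃ hx hy h₁ h₂ h₃ h12 h13
    simp only [wtN_sq]
    refine (abs_sum_weight_le hx hy h12 h13 N h₁ h₂ h₃).trans ?_
    refine mul_le_mul_of_nonneg_left ?_ (by positivity)
    have w1 := wt_pos x₁ y₁
    have w2 := wt_pos x₂ y₂
    have w3 := wt_pos x₃ y₃
    have p1 := br_pos x₁ y₁
    have p2 := br_pos x₂ y₂
    have p3 := br_pos x₃ y₃
    have a1 : br x₁ y₁ ≤ br x₁ y₁ ^ max N 1 := le_self_pow₀ (one_le_br _ _) (by simp)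
    have T1 : br x₂ y₂ ^ N * br x₃ y₃ ^ N * br x₁ y₁ * (wt x₂ y₂ * wt x₃ y₃) ≤
        lowN N x₁ y₁ * wtN N x₂ y₂ * wtN N x₃ y₃ := by
      unfold lowN wtN
      calc _ = br x₁ y₁ * (br x₂ y₂ ^ N * wt x₂ y₂) * (br x₃ y₃ ^ N * wt x₃ y₃) := by ring
        _ ≤ _ := by gcongr
    have T2 := mul_le_mul_of_nonneg_right (low_mul_le N (one_le_br x₁ y₁) h12 w1.le w3.le)
      (pow_nonneg p3.le N)
    have T3 := mul_le_mul_of_nonneg_right (low_mul_le N (one_le_br x₁ y₁) h13 w1.le w2.le)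
      (pow_nonneg p2.le N)
    unfold triWeight pairSum
    calc _ = br x₂ y₂ ^ N * br x₃ y₃ ^ N * br x₁ y₁ * (wt x₂ y₂ * wt x₃ y₃) +
          br x₂ y₂ ^ N * br x₁ y₁ * (wt x₁ y₁ * wt x₃ y₃) * br x₃ y₃ ^ N +
          br x₃ y₃ ^ N * br x₁ y₁ * (wt x₁ y₁ * wt x₂ y₂) * br x₂ y₂ ^ N := by ring
      _ ≤ _ := add_le_add (add_le_add T1 T2) T3
      _ = _ := by unfold lowN wtN; ring
  -- Both sides are symmetric in the three frequencies, so the one with the smallest bracket may be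
  -- named first.
  rcases le_total (br x₁ y₁) (br x₂ y₂) with h12 | h12
  · rcases le_total (br x₁ y₁) (br x₃ y₃) with h13 | h13
    · exact key hx hy h₁ h₂ h₃ h12 h13
    · have := key (x₁ := x₃) (x₂ := x₁) (x₃ := x₂) (y₁ := y₃) (y₂ := y₁) (y₃ := y₂)
        (by linarith) (by linarith) h₃ h₁ h₂ h13 (h13.trans h12)
      convert this using 2 <;> [ring; (unfold triWeight; ring)]
  · rcases le_total (br x₂ y₂) (br x₃ y₃) with h23 | h23
    · have := key (x₁ := x₂) (x₂ := x₁) (x₃ := x₃) (y₁ := y₂) (y₂ := y₁) (y₃ := y₃)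
        (by linarith) (by linarith) h₂ h₁ h₃ h12 h23
      convert this using 2 <;> [ring; (unfold triWeight; ring)]
    · have := key (x₁ := x₃) (x₂ := x₁) (x₃ := x₂) (y₁ := y₃) (y₂ := y₁) (y₃ := y₂)
        (by linarith) (by linarith) h₃ h₁ h₂ (h23.trans h12) h23
      convert this using 2 <;> [ring; (unfold triWeight; ring)]

/-! ### Trilinear integrals -/

/-- The `L²` norm of a nonnegative function. -/
noncomputable def l2 (a : Plane → ℝ≥0∞) : ℝ≥0∞ := (∫⁻ x, a x ^ (2 : ℝ)) ^ (1 / (2 : ℝ))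

lemma lintegral_mul_le_l2 {a b : Plane → ℝ≥0∞} (ha : AEMeasurable a) (hb : AEMeasurable b) :
    ∫⁻ x, a x * b x ≤ l2 a * l2 b :=
  ENNReal.lintegral_mul_le_Lp_mul_Lq volume Real.HolderConjugate.two_two ha hb

lemma lintegral_neg_add (c : Plane → ℝ≥0∞) (x : Plane) : ∫⁻ y, c (-(x + y)) = ∫⁻ y, c y := by
  rw [lintegral_add_left_eq_self (fun y => c (-y)) x, lintegral_neg_eq_self]

lemma l2_neg_add (c : Plane → ℝ≥0∞) (x : Plane) : l2 (fun y => c (-(x + y))) = l2 c := by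
  unfold l2; rw [lintegral_neg_add (fun y => c y ^ (2 : ℝ))]

lemma l2_mono {a b : Plane → ℝ≥0∞} (h : ∀ᵐ x, a x ≤ b x) : l2 a ≤ l2 b := by
  unfold l2
  gcongr ?_ ^ _
  refine lintegral_mono_ae ?_
  filter_upwards [h] with x hx
  gcongr

lemma l2_congr {a b : Plane → ℝ≥0∞} (h : ∀ᵐ x, a x = b x) : l2 a = l2 b :=
  le_antisymm (l2_mono (h.mono fun _ h => h.le)) (l2_mono (h.mono fun _ h => h.ge))

lemma l2_const_mul (c : ℝ≥0∞) (hc : c ≠ ∞) (a : Plane → ℝ≥0∞) :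
    l2 (fun x => c * a x) = c * l2 a := by
  unfold l2
  simp_rw [ENNReal.mul_rpow_of_nonneg _ _ (zero_le_two (α := ℝ))]
  rw [lintegral_const_mul' _ _ (by finiteness), ENNReal.mul_rpow_of_nonneg _ _ (by norm_num),
    ← ENNReal.rpow_mul]
  norm_num

lemma l2_sq (a : Plane → ℝ≥0∞) : l2 a ^ 2 = ∫⁻ x, a x ^ 2 := by
  unfold l2
  rw [← ENNReal.rpow_natCast, ← ENNReal.rpow_mul]
  norm_num

lemma l2_add_le {a b : Plane → ℝ≥0∞} (ha : AEMeasurable a) (hb : AEMeasurable b) :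
    l2 (fun x => a x + b x) ≤ l2 a + l2 b :=
  ENNReal.lintegral_Lp_add_le ha hb (by norm_num)

/-- The trilinear form `∫∫ a(x) b(y) c(-x-y)`. -/
noncomputable def tri (a b c : Plane → ℝ≥0∞) : ℝ≥0∞ := ∫⁻ x, ∫⁻ y, a x * (b y * c (-(x + y)))

/-- Cauchy–Schwarz in the inner variable. With the two exchange lemmas below, the L¹ norm may be put
on any of the three factors. -/
lemma tri_le {a b c : Plane → ℝ≥0∞} (ha : Measurable a) (hb : Measurable b) (hc : Measurable c) :
    tri a b c ≤ (∫⁻ x, a x) * (l2 b * l2 c) := by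
  unfold tri
  rw [← lintegral_mul_const _ ha]
  refine lintegral_mono fun x => ?_
  rw [lintegral_const_mul _ (by fun_prop)]
  gcongr
  refine (lintegral_mul_le_l2 hb.aemeasurable (by fun_prop)).trans ?_
  rw [l2_neg_add]

lemma tri_swap_right (a b c : Plane → ℝ≥0∞) : tri a b c = tri a c b := by
  unfold tri
  congr! 2 with x
  have := lintegral_neg_add (fun y => a x * (c y * b (-(x + y)))) x
  rw [← this]
  congr! 2 with y
  rw [mul_comm (b y)]
  congr! 3
  abel

lemma tri_swap_left {a b c : Plane → ℝ≥0∞} (ha : Measurable a) (hb : Measurable b)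
    (hc : Measurable c) : tri a b c = tri b a c := by
  unfold tri
  rw [lintegral_lintegral_swap (by unfold Function.uncurry; fun_prop)]
  congr! 4 with x y
  rw [add_comm, mul_left_comm]

/-- **Young's inequality** `L¹ * L² ⊆ L²`. -/
lemma l2_conv_le {a b : Plane → ℝ≥0∞} (ha : Measurable a) (hb : Measurable b) :
    l2 (fun z => ∫⁻ y, a y * b (z - y)) ≤ (∫⁻ x, a x) * l2 b := by
  -- Cauchy–Schwarz for the measure with density a: one square root of a stays with b.
  have key : ∀ z, (∫⁻ y, a y * b (z - y)) ^ (2 : ℝ) ≤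
      (∫⁻ y, a y) * ∫⁻ y, a y * b (z - y) ^ (2 : ℝ) := by
    intro z
    have h := ENNReal.lintegral_mul_le_Lp_mul_Lq (volume : Measure Plane)
      Real.HolderConjugate.two_two (f := fun y => a y ^ (1 / 2 : ℝ))
      (g := fun y => a y ^ (1 / 2 : ℝ) * b (z - y)) (by fun_prop) (by fun_prop)
    have e : ∀ y, a y ^ (1 / 2 : ℝ) * (a y ^ (1 / 2 : ℝ) * b (z - y)) = a y * b (z - y) := by
      intro y
      rw [← mul_assoc, ← ENNReal.rpow_add_of_nonneg _ _ (by norm_num) (by norm_num)]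
      norm_num
    simp only [Pi.mul_apply, e, ENNReal.mul_rpow_of_nonneg _ _ (zero_le_two (α := ℝ)),
      ← ENNReal.rpow_mul] at h
    norm_num at h
    calc _ ≤ _ := ENNReal.rpow_le_rpow h (by norm_num)
      _ = _ := by
        rw [ENNReal.mul_rpow_of_nonneg _ _ (by norm_num), ← ENNReal.rpow_mul, ← ENNReal.rpow_mul]
        norm_num
  have h2 : ∫⁻ z, (∫⁻ y, a y * b (z - y)) ^ (2 : ℝ) ≤
      (∫⁻ y, a y) ^ (2 : ℝ) * ∫⁻ x, b x ^ (2 : ℝ) := by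
    calc _ ≤ ∫⁻ z, (∫⁻ y, a y) * ∫⁻ y, a y * b (z - y) ^ (2 : ℝ) := lintegral_mono key
      _ = (∫⁻ y, a y) * ∫⁻ z, ∫⁻ y, a y * b (z - y) ^ (2 : ℝ) := by
        rw [lintegral_const_mul]
        exact Measurable.lintegral_prod_right' (f := fun p : Plane × Plane => a p.2 * b (p.1 - p.2) ^ (2 : ℝ)) (by fun_prop)
      _ = (∫⁻ y, a y) * ∫⁻ y, ∫⁻ z, a y * b (z - y) ^ (2 : ℝ) := by
        rw [lintegral_lintegral_swap (by unfold Function.uncurry; fun_prop)]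
      _ = (∫⁻ y, a y) * ∫⁻ y, a y * ∫⁻ x, b x ^ (2 : ℝ) := by
        congr! 3 with y
        rw [lintegral_const_mul _ (by fun_prop),
          lintegral_sub_right_eq_self (fun x => b x ^ (2 : ℝ))]
      _ = _ := by
        rw [lintegral_mul_const _ ha, ← mul_assoc, ENNReal.rpow_two, sq]
  unfold l2
  calc _ ≤ _ := ENNReal.rpow_le_rpow h2 (by norm_num)
    _ = _ := by
      rw [ENNReal.mul_rpow_of_nonneg _ _ (by norm_num), ← ENNReal.rpow_mul]
      norm_num

/-! ### Square integrability of the ratio of the weights -/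

/-- Weighted arithmetic-geometric means. The exponent 3/5 exceeds 1/2, so (1 + s²)^(-3/5) is
integrable on the line. The monomial X^(3/5) Y^(8/5) is exactly critical, since 1/5 + 4/5 = 1. -/
lemma rpow_product_le {X Y : ℝ} (hX : 1 ≤ X) (hY : 1 ≤ Y) :
    (X + Y) * (X ^ (3 / 5 : ℝ) * Y ^ (3 / 5 : ℝ)) ≤ 2 * (X ^ 3 + Y ^ 2) := by
  have hX0 : 0 < X := by linarith
  have hY0 : 0 < Y := by linarith
  have hX3 : 0 ≤ X ^ 3 := by positivity
  have hY2 : 0 ≤ Y ^ 2 := by positivity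
  have h1 := Real.geom_mean_le_arith_mean2_weighted (show (0 : ℝ) ≤ 7 / 10 by norm_num)
    (show (0 : ℝ) ≤ 3 / 10 by norm_num) hX3 hY2 (by norm_num)
  have h2 := Real.geom_mean_le_arith_mean2_weighted (show (0 : ℝ) ≤ 1 / 5 by norm_num)
    (show (0 : ℝ) ≤ 4 / 5 by norm_num) hX3 hY2 (by norm_num)
  rw [← Real.rpow_natCast_mul hX0.le, ← Real.rpow_natCast_mul hY0.le] at h1 h2
  norm_num at h1 h2
  have e1 : X * X ^ (3 / 5 : ℝ) = X ^ (8 / 5 : ℝ) := by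
    rw [← Real.rpow_one_add' hX0.le (by norm_num)]; norm_num
  have e2 : Y * Y ^ (3 / 5 : ℝ) = Y ^ (8 / 5 : ℝ) := by
    rw [← Real.rpow_one_add' hY0.le (by norm_num)]; norm_num
  have h3 : X ^ (8 / 5 : ℝ) ≤ X ^ (21 / 10 : ℝ) := Real.rpow_le_rpow_of_exponent_le hX (by norm_num)
  calc _ = (X * X ^ (3 / 5 : ℝ)) * Y ^ (3 / 5 : ℝ) + X ^ (3 / 5 : ℝ) * (Y * Y ^ (3 / 5 : ℝ)) := by
        ring
    _ ≤ X ^ (21 / 10 : ℝ) * Y ^ (3 / 5 : ℝ) + X ^ (3 / 5 : ℝ) * Y ^ (8 / 5 : ℝ) := by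
        rw [e1, e2]; gcongr
    _ ≤ _ := by linarith

/-- Only ξ⁶ and η⁴ in the weight are needed for decay; the quotient term is discarded as
nonnegative. -/
lemma brSq_div_wtSq_le (x y : ℝ) :
    brSq x y / wtSq x y ≤
      12 * ((1 + ‖x‖ ^ 2) ^ (-(6 / 5 : ℝ) / 2) * (1 + ‖y‖ ^ 2) ^ (-(6 / 5 : ℝ) / 2)) := by
  have hX : 1 ≤ 1 + x ^ 2 := by nlinarith
  have hY : 1 ≤ 1 + y ^ 2 := by nlinarith
  have h := rpow_product_le hX hY
  have hw : 0 < wtSq x y := by rw [← wt_sq]; exact pow_pos (wt_pos _ _) 2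
  have e : ∀ s : ℝ, (1 + ‖s‖ ^ 2) ^ (-(6 / 5 : ℝ) / 2) = ((1 + s ^ 2) ^ (3 / 5 : ℝ))⁻¹ := by
    intro s
    rw [Real.norm_eq_abs, sq_abs, ← Real.rpow_neg (by positivity)]
    norm_num
  rw [e, e, ← mul_inv, ← div_eq_mul_inv, div_le_div_iff₀ hw (by positivity)]
  have h1 : brSq x y ≤ (1 + x ^ 2) + (1 + y ^ 2) := by unfold brSq; linarith
  have h2 : (1 + x ^ 2) ^ 3 + (1 + y ^ 2) ^ 2 ≤ 6 * wtSq x y := by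
    have : 0 ≤ (y ^ 2 / x) ^ 2 := by positivity
    unfold wtSq
    nlinarith [sq_nonneg (x ^ 2 - 1), sq_nonneg (y ^ 2 - 1), sq_nonneg x,
      mul_nonneg (add_nonneg zero_le_one (sq_nonneg x)) (sq_nonneg (x ^ 2 - 1)),
      mul_nonneg (sq_nonneg x) (sq_nonneg (x ^ 2 - 1)), pow_nonneg (sq_nonneg x) 3, pow_nonneg (sq_nonneg y) 2]
  calc _ ≤ ((1 + x ^ 2) + (1 + y ^ 2)) * ((1 + x ^ 2) ^ (3 / 5 : ℝ) * (1 + y ^ 2) ^ (3 / 5 : ℝ)) := by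
        gcongr
    _ ≤ _ := h.trans (by linarith)

/-- The `L²` norm of the ratio of the bracket and the base weight. -/
noncomputable def ratioConst : ℝ≥0∞ :=
  l2 fun ζ => ENNReal.ofReal (br (ζ 0) (ζ 1) / wt (ζ 0) (ζ 1))

lemma ratioConst_lt_top : ratioConst < ∞ := by
  have h1 : Integrable (fun s : ℝ => (1 + ‖s‖ ^ 2) ^ (-(6 / 5 : ℝ) / 2)) :=
    integrable_rpow_neg_one_add_norm_sq (by norm_num)
  have h2 : Integrable (fun x : Fin 2 → ℝ => ∏ i, (1 + ‖x i‖ ^ 2) ^ (-(6 / 5 : ℝ) / 2)) :=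
    Integrable.fintype_prod (f := fun _ s => (1 + ‖s‖ ^ 2) ^ (-(6 / 5 : ℝ) / 2)) fun _ => h1
  have h3 := ((PiLp.volume_preserving_ofLp (Fin 2)).integrable_comp_emb
    (MeasurableEquiv.toLp 2 (Fin 2 → ℝ)).symm.measurableEmbedding).2 h2
  have h4 := (h3.const_mul 12).lintegral_lt_top
  refine ENNReal.rpow_lt_top_of_nonneg (by norm_num) (ne_of_lt (lt_of_le_of_lt ?_ h4))
  refine lintegral_mono fun ζ => ?_
  rw [ENNReal.ofReal_rpow_of_nonneg (div_nonneg (br_pos _ _).le (wt_pos _ _).le) zero_le_two]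
  refine ENNReal.ofReal_le_ofReal ?_
  rw [Real.rpow_two, div_pow, br_sq, wt_sq]
  refine (brSq_div_wtSq_le _ _).trans (le_of_eq ?_)
  simp [Fin.prod_univ_two]

/-! ### The weights as measurable functions on the frequency plane. -/

@[fun_prop]
lemma measurable_br : Measurable fun p : ℝ × ℝ => br p.1 p.2 := by unfold br brSq; fun_prop

@[fun_prop]
lemma measurable_wt : Measurable fun p : ℝ × ℝ => wt p.1 p.2 := by unfold wt wtSq; fun_prop

/-- The weights, as functions on the frequency plane. -/
noncomputable def brE (N : ℕ) (ζ : Plane) : ℝ≥0∞ := ENNReal.ofReal (br (ζ 0) (ζ 1) ^ N)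
noncomputable def wtE (N : ℕ) (ζ : Plane) : ℝ≥0∞ := ENNReal.ofReal (wtN N (ζ 0) (ζ 1))

lemma measurable_br_plane : Measurable fun ζ : Plane => br (ζ 0) (ζ 1) :=
  measurable_br.comp (f := fun ζ : Plane => (ζ 0, ζ 1)) (by fun_prop)

lemma measurable_wt_plane : Measurable fun ζ : Plane => wt (ζ 0) (ζ 1) :=
  measurable_wt.comp (f := fun ζ : Plane => (ζ 0, ζ 1)) (by fun_prop)

@[fun_prop]
lemma measurable_brE (N : ℕ) : Measurable (brE N) := (measurable_br_plane.pow_const N).ennreal_ofReal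

lemma measurable_wtN_plane (N : ℕ) : Measurable fun ζ : Plane => wtN N (ζ 0) (ζ 1) :=
  (measurable_br_plane.pow_const N).mul measurable_wt_plane

@[fun_prop]
lemma measurable_wtE (N : ℕ) : Measurable (wtE N) := (measurable_wtN_plane N).ennreal_ofReal

/-- Weighted `L¹` norms are controlled by weighted `L²` norms. -/
lemma lintegral_low_le (N : ℕ) {a : Plane → ℝ≥0∞} (ha : Measurable a) :
    ∫⁻ ζ, brE (max N 1) ζ * a ζ ≤ ratioConst * l2 (fun ζ => wtE (N - 1) ζ * a ζ) := by
  have hm : Measurable fun ζ : Plane => ENNReal.ofReal (br (ζ 0) (ζ 1) / wt (ζ 0) (ζ 1)) :=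
    (measurable_br_plane.div measurable_wt_plane).ennreal_ofReal
  refine le_trans (le_of_eq ?_) (lintegral_mul_le_l2 hm.aemeasurable (by fun_prop))
  congr! 2 with ζ
  rw [← mul_assoc, brE, wtE, ← ENNReal.ofReal_mul (div_nonneg (br_pos _ _).le (wt_pos _ _).le)]
  congr 2
  have := (wt_pos (ζ 0) (ζ 1)).ne'
  unfold wtN
  -- Truncated subtraction matters here: for N = 0 the claim is br = (br/wt) · wt, and for N = n + 1
  -- it is br^(n+1) = (br/wt) · br^n wt.
  obtain _ | n := N
  · simp; field_simp
  · rw [max_eq_left (by omega), Nat.add_sub_cancel]; field_simp; ring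

/-! ### Operators on the frequency side -/

/-- Complex square integrable functions on the frequency plane. -/
noncomputable abbrev Spec := Lp ℂ 2 (volume : Measure Plane)

lemma l2_enorm_eq {f : Plane → ℂ} : l2 (fun x => ‖f x‖ₑ) = eLpNorm f 2 volume := by
  rw [eLpNorm_eq_lintegral_rpow_enorm_toReal (by norm_num) (by norm_num)]
  simp [l2]

lemma l2_spec (f : Spec) : l2 (fun x => ‖f x‖ₑ) = ‖f‖ₑ := by rw [l2_enorm_eq, Lp.enorm_def]

@[fun_prop]
lemma measurable_spec (f : Spec) : Measurable f := (Lp.stronglyMeasurable f).measurable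

/-- Bounded measurable symbols. -/
def BddMeas (m : Plane → ℂ) : Prop := Measurable m ∧ ∃ C : ℝ, ∀ x, ‖m x‖ ≤ C

lemma BddMeas.memLp {m : Plane → ℂ} (h : BddMeas m) (f : Spec) :
    MemLp (fun x => m x * f x) 2 volume := by
  obtain ⟨C, hC⟩ := h.2
  refine (Lp.memLp f).of_le_mul (c := C) (h.1.mul (measurable_spec f)).aestronglyMeasurable
    (Filter.Eventually.of_forall fun x => ?_)
  rw [norm_mul]
  gcongr
  exact hC x

/-- The Fourier multiplier with a bounded symbol. -/
noncomputable def mulOp (m : Plane → ℂ) (h : BddMeas m) : Spec →L[ℂ] Spec :=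
  LinearMap.mkContinuous
    { toFun := fun f => (h.memLp f).toLp
      map_add' := fun f g => by
        rw [← MemLp.toLp_add, MemLp.toLp_eq_toLp_iff]
        filter_upwards [Lp.coeFn_add f g] with x hx
        simp only [hx, Pi.add_apply, mul_add]
      map_smul' := fun c f => by
        rw [RingHom.id_apply, ← MemLp.toLp_const_smul, MemLp.toLp_eq_toLp_iff]
        filter_upwards [Lp.coeFn_smul c f] with x hx
        simp only [hx, Pi.smul_apply, smul_eq_mul, mul_left_comm] }
    (h.2.choose) fun f => by
      refine Lp.norm_le_mul_norm_of_ae_le_mul ?_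
      filter_upwards [(h.memLp f).coeFn_toLp] with x hx
      simp only [LinearMap.coe_mk, AddHom.coe_mk]
      rw [hx, norm_mul]
      gcongr
      exact h.2.choose_spec x

lemma mulOp_coe (m : Plane → ℂ) (h : BddMeas m) (f : Spec) :
    ∀ᵐ x, mulOp m h f x = m x * f x := (h.memLp f).coeFn_toLp

/-- Convolution. -/
noncomputable def conv (f g : Plane → ℂ) (z : Plane) : ℂ := ∫ y, f y * g (z - y)

lemma l2_sub_left (c : Plane → ℝ≥0∞) (z : Plane) : l2 (fun y => c (z - y)) = l2 c := by
  unfold l2; rw [lintegral_sub_left_eq_self (fun y => c y ^ (2 : ℝ))]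

/-- By Cauchy–Schwarz the convolution of two L² functions converges at every point and is bounded.
Multiplying it by a square integrable symbol, such as a truncated one, therefore gives an L²
function. -/
lemma lintegral_conv_le (f g : Spec) (z : Plane) :
    ∫⁻ y, ‖f y‖ₑ * ‖g (z - y)‖ₑ ≤ ‖f‖ₑ * ‖g‖ₑ := by
  refine (lintegral_mul_le_l2 (by fun_prop) (by fun_prop)).trans (le_of_eq ?_)
  rw [l2_sub_left (fun y => ‖g y‖ₑ), l2_spec, l2_spec]

lemma integrable_conv (f g : Spec) (z : Plane) : Integrable fun y => f y * g (z - y) := by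
  refine ⟨by fun_prop, lt_of_le_of_lt ?_ (show ‖f‖ₑ * ‖g‖ₑ < ∞ by finiteness)⟩
  simpa only [enorm_mul] using lintegral_conv_le f g z

lemma enorm_conv_le_lintegral (f g : Plane → ℂ) (z : Plane) :
    ‖conv f g z‖ₑ ≤ ∫⁻ y, ‖f y‖ₑ * ‖g (z - y)‖ₑ := by
  refine (enorm_integral_le_lintegral_enorm _).trans (le_of_eq ?_)
  simp only [enorm_mul]

lemma norm_conv_le (f g : Spec) (z : Plane) : ‖conv f g z‖ ≤ ‖f‖ * ‖g‖ := by
  have h := (enorm_conv_le_lintegral f g z).trans (lintegral_conv_le f g z)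
  simp only [← ofReal_norm] at h
  rw [← ENNReal.ofReal_mul (norm_nonneg _)] at h
  exact (ENNReal.ofReal_le_ofReal_iff (by positivity)).1 h

lemma measurable_conv {f g : Plane → ℂ} (hf : Measurable f) (hg : Measurable g) :
    Measurable (conv f g) := by
  have : StronglyMeasurable fun p : Plane × Plane => f p.2 * g (p.1 - p.2) :=
    Measurable.stronglyMeasurable (by fun_prop)
  exact this.integral_prod_right.measurable

lemma conv_comm (f g : Plane → ℂ) (z : Plane) : conv f g z = conv g f z := by
  unfold conv
  rw [← integral_sub_left_eq_self (fun y => f y * g (z - y)) volume z]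
  simp [mul_comm]

lemma conv_congr {f f' g g' : Plane → ℂ} (hf : f =ᵐ[volume] f') (hg : g =ᵐ[volume] g')
    (z : Plane) : conv f g z = conv f' g' z := by
  refine integral_congr_ae ?_
  have : ∀ᵐ y, g (z - y) = g' (z - y) :=
    (quasiMeasurePreserving_sub_left volume z).ae hg
  filter_upwards [hf, this] with y h1 h2
  rw [h1, h2]

lemma conv_add_left (f f' g : Spec) (z : Plane) :
    conv (f + f' : Spec) g z = conv f g z + conv f' g z := by
  rw [conv_congr (Lp.coeFn_add f f') (Filter.EventuallyEq.refl _ (g : Plane → ℂ))]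
  unfold conv
  rw [← integral_add (integrable_conv f g z) (integrable_conv f' g z)]
  simp [add_mul]

lemma conv_smul_left (c : ℂ) (f g : Spec) (z : Plane) :
    conv (c • f : Spec) g z = c * conv f g z := by
  rw [conv_congr (Lp.coeFn_smul c f) (Filter.EventuallyEq.refl _ (g : Plane → ℂ))]
  unfold conv
  rw [← integral_const_mul]
  simp [mul_assoc]

lemma memLp_mul_conv {σ : Plane → ℂ} (hσ : MemLp σ 2 volume) (f g : Spec) :
    MemLp (fun z => σ z * conv f g z) 2 volume := by
  refine hσ.of_le_mul (c := ‖f‖ * ‖g‖) (hσ.1.mul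
    (measurable_conv (measurable_spec f) (measurable_spec g)).aestronglyMeasurable)
    (Filter.Eventually.of_forall fun x => ?_)
  rw [norm_mul, mul_comm]
  gcongr
  exact norm_conv_le f g x

lemma norm_toLp_mul_conv_le {σ : Plane → ℂ} (hσ : MemLp σ 2 volume) (f g : Spec) :
    ‖(memLp_mul_conv hσ f g).toLp‖ ≤ ‖hσ.toLp‖ * ‖f‖ * ‖g‖ := by
  have h : ‖(memLp_mul_conv hσ f g).toLp‖ ≤ ‖f‖ * ‖g‖ * ‖hσ.toLp‖ := by
    refine Lp.norm_le_mul_norm_of_ae_le_mul ?_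
    filter_upwards [(memLp_mul_conv hσ f g).coeFn_toLp, hσ.coeFn_toLp] with z h1 h2
    rw [h1, h2, norm_mul, mul_comm]
    gcongr
    exact norm_conv_le f g z
  linarith

/-- The bilinear operator `(f, g) ↦ σ · (f * g)` for a square integrable symbol `σ`. -/
noncomputable def convOp (σ : Plane → ℂ) (hσ : MemLp σ 2 volume) : Spec →L[ℂ] Spec →L[ℂ] Spec :=
  LinearMap.mkContinuous₂
    (LinearMap.mk₂ ℂ (fun f g : Spec => (memLp_mul_conv hσ f g).toLp)
      (fun f f' g => by
        rw [← MemLp.toLp_add, MemLp.toLp_eq_toLp_iff]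
        refine Filter.Eventually.of_forall fun z => ?_
        simp only [conv_add_left, Pi.add_apply, mul_add])
      (fun c f g => by
        rw [← MemLp.toLp_const_smul, MemLp.toLp_eq_toLp_iff]
        refine Filter.Eventually.of_forall fun z => ?_
        simp only [conv_smul_left, Pi.smul_apply, smul_eq_mul, mul_left_comm])
      (fun f g g' => by
        rw [← MemLp.toLp_add, MemLp.toLp_eq_toLp_iff]
        refine Filter.Eventually.of_forall fun z => ?_
        simp only [conv_comm f, conv_add_left, Pi.add_apply, mul_add])
      (fun c f g => by
        rw [← MemLp.toLp_const_smul, MemLp.toLp_eq_toLp_iff]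
        refine Filter.Eventually.of_forall fun z => ?_
        simp only [conv_comm f, conv_smul_left, Pi.smul_apply, smul_eq_mul, mul_left_comm]))
    ‖hσ.toLp‖ fun f g => norm_toLp_mul_conv_le hσ f g

lemma convOp_coe {σ : Plane → ℂ} (hσ : MemLp σ 2 volume) (f g : Spec) :
    ∀ᵐ z, convOp σ hσ f g z = σ z * conv f g z := (memLp_mul_conv hσ f g).coeFn_toLp

/-! ### Reflection and Hermitian symmetry -/

/-- The reflection `f ↦ conj f(-·)`, which corresponds to complex conjugation in physical space. -/
noncomputable def refl : Spec →L[ℝ] Spec :=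
  (Complex.conjCLE.toContinuousLinearMap.compLpL 2 volume).comp
    (Lp.compMeasurePreservingₗᵢ ℝ (Neg.neg : Plane → Plane)
      (Measure.measurePreserving_neg volume)).toContinuousLinearMap

lemma refl_coe (f : Spec) : ∀ᵐ x, refl f x = conj (f (-x)) := by
  have h1 := ContinuousLinearMap.coeFn_compLpL (p := 2) (μ := (volume : Measure Plane))
    Complex.conjCLE.toContinuousLinearMap
    (Lp.compMeasurePreserving (Neg.neg : Plane → Plane) (Measure.measurePreserving_neg volume) f)
  have h2 := Lp.coeFn_compMeasurePreserving f
    (Measure.measurePreserving_neg (volume : Measure Plane))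
  filter_upwards [h1, h2] with x hx hx2
  rw [refl]
  refine hx.trans ?_
  rw [hx2]
  simp

/-- Hermitian symmetry, i.e. the Fourier transform of a real-valued function. -/
def Herm (f : Plane → ℂ) : Prop := ∀ᵐ x, f (-x) = conj (f x)

lemma ae_neg {p : Plane → Prop} (h : ∀ᵐ x, p x) : ∀ᵐ x, p (-x) :=
  (Measure.measurePreserving_neg (volume : Measure Plane)).quasiMeasurePreserving.ae h

lemma refl_eq_iff (f : Spec) : refl f = f ↔ Herm f := by
  constructor
  · intro h
    filter_upwards [refl_coe f] with x hx
    rw [h] at hx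
    rw [hx, Complex.conj_conj]
  · intro h
    refine Lp.ext ?_
    filter_upwards [refl_coe f, h] with x hx hx2
    rw [hx, hx2, Complex.conj_conj]

lemma refl_refl (f : Spec) : refl (refl f) = f := by
  refine Lp.ext ?_
  filter_upwards [refl_coe (refl f), ae_neg (refl_coe f)] with x h1 h2
  rw [h1, h2, neg_neg, Complex.conj_conj]

lemma refl_mulOp {m : Plane → ℂ} (h : BddMeas m) (hm : ∀ x, m (-x) = conj (m x)) (f : Spec) :
    refl (mulOp m h f) = mulOp m h (refl f) := by
  refine Lp.ext ?_
  filter_upwards [refl_coe (mulOp m h f), ae_neg (mulOp_coe m h f), mulOp_coe m h (refl f),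
    refl_coe f] with x h1 h2 h3 h4
  rw [h1, h2, h3, h4, hm, map_mul, Complex.conj_conj]

lemma conj_conv_neg {f g f' g' : Plane → ℂ} (hf : ∀ᵐ x, f' x = conj (f (-x)))
    (hg : ∀ᵐ x, g' x = conj (g (-x))) (z : Plane) : conj (conv f g (-z)) = conv f' g' z := by
  rw [conv_congr hf hg]
  unfold conv
  rw [← integral_conj, ← integral_neg_eq_self]
  congr! 2 with y
  rw [map_mul]
  congr! 3
  abel

lemma refl_convOp {σ : Plane → ℂ} (hσ : MemLp σ 2 volume) (h : ∀ x, σ (-x) = conj (σ x))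
    (f g : Spec) : refl (convOp σ hσ f g) = convOp σ hσ (refl f) (refl g) := by
  refine Lp.ext ?_
  filter_upwards [refl_coe (convOp σ hσ f g), ae_neg (convOp_coe hσ f g),
    convOp_coe hσ (refl f) (refl g)] with x h1 h2 h3
  rw [h1, h2, h3, h, map_mul, Complex.conj_conj, conj_conv_neg (refl_coe f) (refl_coe g)]

/-! ### Trilinear pairings -/

lemma real_inner_eq (f g : Spec) : inner ℝ f g = (∫ x, conj (f x) * g x).re := by
  have h := L2.integrable_inner (𝕜 := ℂ) f g
  have h' : Integrable fun x => conj (f x) * g x := by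
    simpa [mul_comm] using h
  rw [L2.inner_def]
  refine Eq.trans ?_ (Complex.reCLM.integral_comp_comm h')
  congr! 2 with x
  simp [Complex.inner, mul_comm]

/-- The change of variables `(x, y) ↦ (x, -x-y)`. -/
noncomputable def shear : Plane × Plane ≃ᵐ Plane × Plane where
  toFun := fun p : Plane × Plane => (p.1, -(p.1 + p.2))
  invFun := fun p : Plane × Plane => (p.1, -(p.1 + p.2))
  left_inv := fun p => by ext1 <;> simp
  right_inv := fun p => by ext1 <;> simp
  measurable_toFun := by simp only [Equiv.coe_fn_mk]; fun_prop
  measurable_invFun := by simp only [Equiv.coe_fn_symm_mk]; fun_prop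

lemma measurePreserving_shear :
    MeasurePreserving shear (volume : Measure (Plane × Plane)) volume := by
  refine MeasurePreserving.skew_product (g := fun x y : Plane => -(x + y))
    (MeasurePreserving.id volume) (by unfold Function.uncurry; fun_prop) ?_
  refine Filter.Eventually.of_forall fun x => ?_
  exact ((Measure.measurePreserving_neg volume).comp (measurePreserving_add_left volume x)).map_eq

lemma integral_shear (Φ : Plane × Plane → ℂ) :
    ∫ p : Plane × Plane, Φ (p.1, -(p.1 + p.2)) = ∫ p, Φ p :=
  measurePreserving_shear.integral_comp' (g := Φ)

lemma integral_swap (Φ : Plane × Plane → ℂ) : ∫ p : Plane × Plane, Φ p.swap = ∫ p, Φ p :=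
  (Measure.measurePreserving_swap (μ := (volume : Measure Plane))
    (ν := volume)).integral_comp (MeasurableEquiv.prodComm.measurableEmbedding) Φ

lemma integrable_shear {Φ : Plane × Plane → ℂ} (h : Integrable Φ) :
    Integrable fun p : Plane × Plane => Φ (p.1, -(p.1 + p.2)) :=
  (measurePreserving_shear.integrable_comp_emb shear.measurableEmbedding).2 h

section Pairing

variable {σ : Plane → ℂ}

/-- The product of σ and d is in L¹ and the other two factors are in L². This justifies Fubini and
the changes of variables below. -/
lemma integrable_triple (hσ : Measurable σ) (hσ2 : MemLp σ 2 volume) (d f g : Spec) :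
    Integrable fun p : Plane × Plane => σ (-p.1) * d p.1 * (f p.2 * g (-(p.1 + p.2))) := by
  refine ⟨by fun_prop, ?_⟩
  have h := tri_le (a := fun x => ‖σ (-x) * d x‖ₑ) (b := fun x => ‖f x‖ₑ) (c := fun x => ‖g x‖ₑ)
    (by fun_prop) (by fun_prop) (by fun_prop)
  have h1 : ∫⁻ x, ‖σ (-x) * d x‖ₑ < ∞ := by
    simp only [enorm_mul]
    refine lt_of_le_of_lt (lintegral_mul_le_l2 (by fun_prop) (by fun_prop)) ?_
    have := l2_neg_add (fun x => ‖σ x‖ₑ) 0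
    simp only [zero_add] at this
    rw [this, l2_spec, l2_enorm_eq]
    exact ENNReal.mul_lt_top hσ2.2 (by finiteness)
  rw [l2_spec, l2_spec] at h
  refine lt_of_le_of_lt (le_trans (le_of_eq ?_) h) (ENNReal.mul_lt_top h1 (by finiteness))
  rw [Measure.volume_eq_prod, lintegral_prod _ (by fun_prop)]
  simp only [enorm_mul, tri]

/-- Hermitian symmetry replaces conj d(z) by d(-z). With x = -z the pairing becomes an integral over
three frequencies x, y, -(x+y) with sum zero. -/
lemma pairing_eq (hσ : Measurable σ) (hσ2 : MemLp σ 2 volume) (d f g : Spec) (hd : Herm d) :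
    ∫ z, conj (d z) * (σ z * conv f g z) =
      ∫ p : Plane × Plane, σ (-p.1) * d p.1 * (f p.2 * g (-(p.1 + p.2))) := by
  rw [Measure.volume_eq_prod, integral_prod _ (integrable_triple hσ hσ2 d f g),
    ← integral_neg_eq_self]
  refine integral_congr_ae ?_
  filter_upwards [hd] with x hx
  rw [hx, Complex.conj_conj, integral_const_mul, conv]
  simp only [neg_add']
  ring

lemma enorm_integral_prod_le {Φ : Plane × Plane → ℂ} (h : Measurable Φ) :
    ‖∫ p, Φ p‖ₑ ≤ ∫⁻ x, ∫⁻ y, ‖Φ (x, y)‖ₑ := by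
  refine (enorm_integral_le_lintegral_enorm _).trans (le_of_eq ?_)
  rw [Measure.volume_eq_prod, lintegral_prod _ (by fun_prop)]

/-- Apart from σ the integrand is symmetric in the three frequencies, so three times the integral is
the integral with σ summed over all three positions. -/
lemma pairing_symm_le (hσ : Measurable σ) (hσ2 : MemLp σ 2 volume) (f : Spec) (hf : Herm f) :
    3 * ‖∫ z, conj (f z) * (σ z * conv f f z)‖ₑ ≤
      ∫⁻ x, ∫⁻ y, ‖(σ (-x) + σ (-y) + σ (x + y)) * (f x * (f y * f (-(x + y))))‖ₑ := by
  rw [pairing_eq hσ hσ2 f f f hf]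
  set Φ : Plane × Plane → ℂ := fun p => σ (-p.1) * f p.1 * (f p.2 * f (-(p.1 + p.2))) with hΦ
  have i1 : Integrable Φ := integrable_triple hσ hσ2 f f f
  have i2 : Integrable fun p : Plane × Plane => Φ p.swap := i1.swap
  have i3 := integrable_shear i2
  have e : 3 * ∫ p, Φ p = ∫ p : Plane × Plane, (σ (-p.1) + σ (-p.2) + σ (p.1 + p.2)) *
      (f p.1 * (f p.2 * f (-(p.1 + p.2)))) := by
    have : 3 * ∫ p, Φ p = (∫ p, Φ p) + (∫ p : Plane × Plane, Φ p.swap) +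
        ∫ p : Plane × Plane, Φ (p.1, -(p.1 + p.2)).swap := by
      rw [integral_shear (fun p => Φ p.swap), integral_swap]; ring
    have i12 : Integrable fun p => Φ p + Φ p.swap := i1.add i2
    rw [this, ← integral_add i1 i2, ← integral_add i12 i3]
    congr! 2 with p
    simp only [hΦ, Prod.fst_swap, Prod.snd_swap, neg_neg]
    rw [add_comm p.2 p.1, show -(-(p.1 + p.2) + p.1) = p.2 by abel]
    ring
  have h3 : 3 * ‖∫ p, Φ p‖ₑ = ‖3 * ∫ p, Φ p‖ₑ := by
    rw [enorm_mul]; congr 1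
    rw [← ofReal_norm]; norm_num
  rw [h3, e]
  exact enorm_integral_prod_le (by fun_prop)

/-- Only the two positions occupied by d can be exchanged. For an odd symbol this leaves a symbol in
the frequency of s: integration by parts in Fourier form. -/
lemma pairing_antisymm_le (hσ : Measurable σ) (hσ2 : MemLp σ 2 volume) (d s : Spec) (hd : Herm d) :
    2 * ‖∫ z, conj (d z) * (σ z * conv s d z)‖ₑ ≤
      ∫⁻ x, ∫⁻ y, ‖(σ (-x) + σ (x + y)) * (d x * (s y * d (-(x + y))))‖ₑ := by
  rw [pairing_eq hσ hσ2 d s d hd]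
  set Φ : Plane × Plane → ℂ := fun p => σ (-p.1) * d p.1 * (s p.2 * d (-(p.1 + p.2))) with hΦ
  have i1 : Integrable Φ := integrable_triple hσ hσ2 d s d
  have i2 : Integrable fun p : Plane × Plane => Φ p.swap := i1.swap
  have i3 : Integrable fun p : Plane × Plane => Φ (p.2, -(p.2 + p.1)).swap :=
    (integrable_shear i2).swap
  have e : 2 * ∫ p, Φ p = ∫ p : Plane × Plane, (σ (-p.1) + σ (p.1 + p.2)) *
      (d p.1 * (s p.2 * d (-(p.1 + p.2)))) := by
    have : 2 * ∫ p, Φ p = (∫ p, Φ p) +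
        ∫ p : Plane × Plane, Φ (p.2, -(p.2 + p.1)).swap := by
      have h := integral_swap (fun p : Plane × Plane => Φ (p.1, -(p.1 + p.2)).swap)
      simp only [Prod.fst_swap, Prod.snd_swap] at h
      rw [h, integral_shear (fun p => Φ p.swap), integral_swap]; ring
    rw [this, ← integral_add i1 i3]
    congr! 2 with p
    simp only [hΦ, Prod.fst_swap, Prod.snd_swap, neg_neg]
    rw [add_comm p.2 p.1, show -(-(p.1 + p.2) + p.2) = p.1 by abel]
    ring
  have h3 : 2 * ‖∫ p, Φ p‖ₑ = ‖2 * ∫ p, Φ p‖ₑ := by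
    rw [enorm_mul]; congr 1
    rw [← ofReal_norm]; norm_num
  rw [h3, e]
  exact enorm_integral_prod_le (by fun_prop)

end Pairing

/-! ### Conservative ordinary differential equations -/

section ODE

variable {E : Type*} [NormedAddCommGroup E]

/-- A piecewise linear cutoff in the norm. -/
noncomputable def cutoff (R : ℝ) (x : E) : ℝ := max 0 (min 1 (2 - ‖x‖ / R))

lemma cutoff_nonneg (R : ℝ) (x : E) : 0 ≤ cutoff R x := le_max_left _ _

lemma cutoff_le_one (R : ℝ) (x : E) : cutoff R x ≤ 1 :=
  max_le zero_le_one (min_le_left _ _)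

lemma cutoff_eq_one {R : ℝ} (hR : 0 < R) {x : E} (hx : ‖x‖ ≤ R) : cutoff R x = 1 := by
  have : ‖x‖ / R ≤ 1 := (div_le_one hR).2 hx
  rw [cutoff, min_eq_left (by linarith), max_eq_right zero_le_one]

lemma cutoff_eq_zero {R : ℝ} (hR : 0 < R) {x : E} (hx : 2 * R ≤ ‖x‖) : cutoff R x = 0 := by
  have : 2 ≤ ‖x‖ / R := (le_div_iff₀ hR).2 hx
  exact max_eq_left ((min_le_right _ _).trans (by linarith))

lemma abs_cutoff_sub_le {R : ℝ} (hR : 0 < R) (x y : E) :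
    |cutoff R x - cutoff R y| ≤ R⁻¹ * ‖x - y‖ := by
  unfold cutoff
  refine (abs_max_sub_max_le_max _ _ _ _).trans (max_le (by simp; positivity) ?_)
  refine (abs_min_sub_min_le_max _ _ _ _).trans (max_le (by simp; positivity) ?_)
  rw [show 2 - ‖x‖ / R - (2 - ‖y‖ / R) = R⁻¹ * (‖y‖ - ‖x‖) by ring, abs_mul,
    abs_of_pos (inv_pos.2 hR), norm_sub_rev x y]
  gcongr
  exact abs_norm_sub_norm_le _ _

variable [InnerProductSpace ℝ E]

/-- The difference of cutoffs is paired with the field at a point of the ball of radius 2R, so the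
field is never estimated outside that ball. -/
lemma norm_cutoff_smul_sub_le {G : E → E} {R B K : ℝ} (hR : 0 < R) (hK : 0 ≤ K)
    (hB : ∀ x, ‖x‖ ≤ 2 * R → ‖G x‖ ≤ B)
    (hG : ∀ x y, ‖x‖ ≤ 2 * R → ‖y‖ ≤ 2 * R → ‖G x - G y‖ ≤ K * ‖x - y‖) (x y : E) :
    ‖cutoff R x • G x - cutoff R y • G y‖ ≤ (R⁻¹ * B + K) * ‖x - y‖ := by
  have hB0 : 0 ≤ B := (norm_nonneg _).trans (hB 0 (by simp; positivity))
  have main : ∀ x y : E, ‖x‖ ≤ 2 * R →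
      ‖cutoff R x • G x - cutoff R y • G y‖ ≤ (R⁻¹ * B + K) * ‖x - y‖ := by
    intro x y hx
    have h1 : |cutoff R x - cutoff R y| * ‖G x‖ ≤ R⁻¹ * ‖x - y‖ * B :=
      mul_le_mul (abs_cutoff_sub_le hR x y) (hB x hx) (norm_nonneg _) (by positivity)
    have h2 : cutoff R y * ‖G x - G y‖ ≤ K * ‖x - y‖ := by
      rcases le_total ‖y‖ (2 * R) with hy | hy
      · exact (mul_le_of_le_one_left (norm_nonneg _) (cutoff_le_one R y)).trans (hG x y hx hy)
      · rw [cutoff_eq_zero hR hy, zero_mul]; positivity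
    have e : cutoff R x • G x - cutoff R y • G y =
        (cutoff R x - cutoff R y) • G x + cutoff R y • (G x - G y) := by module
    rw [e]
    refine (norm_add_le _ _).trans ?_
    rw [norm_smul, norm_smul, Real.norm_eq_abs, Real.norm_eq_abs,
      abs_of_nonneg (cutoff_nonneg R y)]
    linarith
  rcases le_total ‖x‖ (2 * R) with hx | hx
  · exact main x y hx
  · rcases le_total ‖y‖ (2 * R) with hy | hy
    · rw [norm_sub_rev, norm_sub_rev x]; exact main y x hy
    · rw [cutoff_eq_zero hR hx, cutoff_eq_zero hR hy]
      simp only [zero_smul, sub_zero, norm_zero]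
      positivity

lemma eqOn_const_of_hasDerivWithinAt_zero {F : Type*} [NormedAddCommGroup F] [NormedSpace ℝ F]
    {T : ℝ} {g : ℝ → F} (h : ∀ t ∈ Set.Icc 0 T, HasDerivWithinAt g 0 (Set.Icc 0 T) t) :
    ∀ t ∈ Set.Icc 0 T, g t = g 0 := by
  refine constant_of_has_deriv_right_zero (fun t ht => (h t ht).continuousWithinAt) fun t ht => ?_
  exact (h t ⟨ht.1, ht.2.le⟩).mono_of_mem_nhdsWithin (Icc_mem_nhdsGE_of_mem ht)

/-- A vector field which is Lipschitz on bounded sets and orthogonal to the position on the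
invariant subspace `{x | P x = x}` has global solutions starting in this subspace. -/
theorem exists_conservative_solution [CompleteSpace E] {F : E → E} (P : E →L[ℝ] E)
    (hF : ∀ R : ℝ, ∃ K : ℝ, 0 ≤ K ∧
      ∀ x y, ‖x‖ ≤ R → ‖y‖ ≤ R → ‖F x - F y‖ ≤ K * ‖x - y‖)
    (hP : ∀ x, P (F (P x)) = F (P x)) (hE : ∀ x, P x = x → inner ℝ x (F x) = 0)
    {x₀ : E} (hx₀ : P x₀ = x₀) {T : ℝ} (hT : 0 ≤ T) :
    ∃ f : ℝ → E, f 0 = x₀ ∧ ∀ t ∈ Set.Icc 0 T,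
      HasDerivWithinAt f (F (f t)) (Set.Icc 0 T) t ∧ P (f t) = f t := by
  -- The norm will turn out to be conserved, so the solution stays inside radius R and never meets
  -- the region where the cutoff is below 1.
  set R : ℝ := ‖x₀‖ + 1
  have hR : 0 < R := by positivity
  obtain ⟨K, hK, hKF⟩ := hF (‖P‖ * (2 * R))
  have hPR : ∀ x, ‖x‖ ≤ 2 * R → ‖P x‖ ≤ ‖P‖ * (2 * R) := fun x hx => P.le_opNorm_of_le hx
  -- Composing with P makes the field take values fixed by P before the solution is known to lie in
  -- the invariant subspace.
  set G : E → E := fun x => F (P x)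
  have hGL : ∀ x y, ‖x‖ ≤ 2 * R → ‖y‖ ≤ 2 * R → ‖G x - G y‖ ≤ K * ‖P‖ * ‖x - y‖ := by
    intro x y hx hy
    refine (hKF _ _ (hPR x hx) (hPR y hy)).trans ?_
    rw [← map_sub, mul_assoc]
    gcongr
    exact P.le_opNorm _
  set B : ℝ := ‖G 0‖ + K * ‖P‖ * (2 * R)
  have hB0 : 0 ≤ B := by positivity
  have hB : ∀ x, ‖x‖ ≤ 2 * R → ‖G x‖ ≤ B := by
    intro x hx
    have h1 := hGL x 0 hx (by simp; positivity)
    have h2 : ‖G x‖ ≤ ‖G 0‖ + ‖G x - G 0‖ := by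
      simpa using norm_add_le (G 0) (G x - G 0)
    rw [sub_zero] at h1
    have h3 : K * ‖P‖ * ‖x‖ ≤ K * ‖P‖ * (2 * R) := by gcongr
    linarith
  set H : E → E := fun x => cutoff R x • G x
  have hHB : ∀ x, ‖H x‖ ≤ B := by
    intro x
    rcases le_total ‖x‖ (2 * R) with hx | hx
    · rw [norm_smul, Real.norm_eq_abs, abs_of_nonneg (cutoff_nonneg R x)]
      exact (mul_le_of_le_one_left (norm_nonneg _) (cutoff_le_one R x)).trans (hB x hx)
    · simp only [H, cutoff_eq_zero hR hx, zero_smul, norm_zero]; exact hB0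
  have hHL : LipschitzWith (R⁻¹ * B + K * ‖P‖).toNNReal H := by
    refine LipschitzWith.of_dist_le_mul fun x y => ?_
    rw [dist_eq_norm, dist_eq_norm, Real.coe_toNNReal _ (by positivity)]
    exact norm_cutoff_smul_sub_le hR (by positivity) hB hGL x y
  -- The cut-off field is globally bounded by B, so the ball of radius B T cannot be left before
  -- time T.
  have hPL : IsPicardLindelof (fun _ => H) (tmin := 0) (tmax := T) ⟨0, le_rfl, hT⟩ x₀
      (B * T).toNNReal 0 B.toNNReal (R⁻¹ * B + K * ‖P‖).toNNReal :=
    { lipschitzOnWith := fun t _ => hHL.lipschitzOnWith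
      continuousOn := fun x _ => continuousOn_const
      norm_le := fun t _ x _ => by rw [Real.coe_toNNReal _ hB0]; exact hHB x
      mul_max_le := by
        rw [Real.coe_toNNReal _ hB0, Real.coe_toNNReal _ (by positivity)]
        simp [hT] }
  obtain ⟨f, hf0, hf⟩ := hPL.exists_eq_forall_mem_Icc_hasDerivWithinAt
    (x := x₀) (by simp)
  have hfP : ∀ t ∈ Set.Icc 0 T, P (f t) = f t := by
    have h := eqOn_const_of_hasDerivWithinAt_zero (T := T) (g := fun t => P (f t) - f t)
      fun t ht => by
        have := ((P.hasFDerivAt.comp_hasDerivWithinAt t (hf t ht)).sub (hf t ht))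
        have e : P (H (f t)) - H (f t) = 0 := by
          simp only [H, G, map_smul, hP, sub_self]
        rwa [e] at this
    intro t ht
    have := h t ht
    simp only [hf0, hx₀, sub_self] at this
    exact sub_eq_zero.1 this
  have hfN : ∀ t ∈ Set.Icc 0 T, ‖f t‖ ^ 2 = ‖f 0‖ ^ 2 := by
    refine eqOn_const_of_hasDerivWithinAt_zero (T := T) (g := fun t => ‖f t‖ ^ 2) fun t ht => ?_
    have := (hf t ht).norm_sq
    have e : inner ℝ (f t) (H (f t)) = 0 := by
      simp only [H, G, inner_smul_right]
      rw [hfP t ht, hE _ (hfP t ht), mul_zero]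
    rwa [e, mul_zero] at this
  refine ⟨f, hf0, fun t ht => ⟨?_, hfP t ht⟩⟩
  have e : H (f t) = F (f t) := by
    have h1 : ‖f t‖ ≤ R := by
      have h2 : ‖f t‖ = ‖f 0‖ := by
        simpa using (sq_eq_sq₀ (norm_nonneg _) (norm_nonneg _)).1 (hfN t ht)
      rw [h2, hf0]; simp [R]
    simp only [H, G, cutoff_eq_one hR h1, one_smul, hfP t ht]
  rw [← e]
  exact hf t ht

end ODE

/-! ### Frequency truncation -/

/-- The truncated frequency region. -/
def freqSet (n : ℕ) : Set Plane := {ζ | 1 ≤ (n + 1) * |ζ 0| ∧ br (ζ 0) (ζ 1) ≤ n + 1}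

lemma measurableSet_freqSet (n : ℕ) : MeasurableSet (freqSet n) :=
  MeasurableSet.inter (s₁ := {ζ : Plane | 1 ≤ ((n : ℝ) + 1) * |ζ 0|})
    (s₂ := {ζ : Plane | br (ζ 0) (ζ 1) ≤ (n : ℝ) + 1})
    (measurableSet_le (by fun_prop) (by fun_prop)) (measurableSet_le measurable_br_plane (by fun_prop))

lemma br_neg (a b : ℝ) : br (-a) (-b) = br a b := by simp [br, brSq]

lemma neg_mem_freqSet {n : ℕ} {ζ : Plane} : -ζ ∈ freqSet n ↔ ζ ∈ freqSet n := by
  simp [freqSet, br_neg]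

lemma freqSet_mono {m n : ℕ} (h : m ≤ n) : freqSet m ⊆ freqSet n := by
  intro ζ hζ
  have h' : (m : ℝ) ≤ n := by exact_mod_cast h
  refine ⟨hζ.1.trans ?_, hζ.2.trans ?_⟩
  · gcongr
  · gcongr

lemma ne_zero_of_mem_freqSet {n : ℕ} {ζ : Plane} (h : ζ ∈ freqSet n) : ζ 0 ≠ 0 := by
  intro h0
  have := h.1
  simp [h0] at this
  linarith

lemma volume_freqSet_lt_top (n : ℕ) : volume (freqSet n) < ∞ := by
  refine lt_of_le_of_lt (measure_mono (t := Metric.closedBall 0 (n + 1)) fun ζ hζ => ?_)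
    measure_closedBall_lt_top
  rw [mem_closedBall_zero_iff]
  refine le_trans ?_ hζ.2
  rw [EuclideanSpace.norm_eq, br]
  refine Real.sqrt_le_sqrt ?_
  simp [Fin.sum_univ_two, brSq]

/-- The indicator function of the truncated frequency region. -/
noncomputable def chi (n : ℕ) (ζ : Plane) : ℂ := (freqSet n).indicator 1 ζ

lemma chi_of_mem {n : ℕ} {ζ : Plane} (h : ζ ∈ freqSet n) : chi n ζ = 1 := by simp [chi, h]

lemma chi_of_notMem {n : ℕ} {ζ : Plane} (h : ζ ∉ freqSet n) : chi n ζ = 0 := by simp [chi, h]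

lemma chi_neg (n : ℕ) (ζ : Plane) : chi n (-ζ) = chi n ζ := by
  by_cases h : ζ ∈ freqSet n
  · rw [chi_of_mem h, chi_of_mem (neg_mem_freqSet.2 h)]
  · rw [chi_of_notMem h, chi_of_notMem (fun h' => h (neg_mem_freqSet.1 h'))]

lemma conj_chi (n : ℕ) (ζ : Plane) : conj (chi n ζ) = chi n ζ := by
  by_cases h : ζ ∈ freqSet n
  · simp [chi_of_mem h]
  · simp [chi_of_notMem h]

@[fun_prop]
lemma measurable_chi (n : ℕ) : Measurable (chi n) :=
  measurable_one.indicator (measurableSet_freqSet n)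

lemma memLp_chi (n : ℕ) : MemLp (chi n) 2 volume :=
  memLp_indicator_const 2 (measurableSet_freqSet n) 1 (Or.inr (volume_freqSet_lt_top n).ne)

/-! ### Symbols that become bounded and square integrable after truncation. -/

section Symbols

variable {n : ℕ} {m : Plane → ℂ}

/-- Symbols which are bounded on each truncated frequency region. -/
def LocBdd (m : Plane → ℂ) : Prop :=
  Measurable m ∧ ∀ n, ∃ C : ℝ, ∀ ζ ∈ freqSet n, ‖m ζ‖ ≤ C

lemma LocBdd.bddMeas (h : LocBdd m) (n : ℕ) : BddMeas fun ζ => chi n ζ * m ζ := by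
  obtain ⟨C, hC⟩ := h.2 n
  refine ⟨(measurable_chi n).mul h.1, |C|, fun ζ => ?_⟩
  by_cases hζ : ζ ∈ freqSet n
  · simpa only [chi_of_mem hζ, one_mul] using (hC ζ hζ).trans (le_abs_self C)
  · simpa only [chi_of_notMem hζ, zero_mul, norm_zero] using abs_nonneg C

lemma LocBdd.memLp (h : LocBdd m) (n : ℕ) : MemLp (fun ζ => chi n ζ * m ζ) 2 volume := by
  obtain ⟨C, hC⟩ := (h.bddMeas n).2
  refine (memLp_chi n).of_le_mul (c := C) (h.bddMeas n).1.aestronglyMeasurable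
    (Filter.Eventually.of_forall fun ζ => ?_)
  by_cases hζ : ζ ∈ freqSet n
  · simpa [chi_of_mem hζ] using hC ζ
  · simp [chi_of_notMem hζ]

lemma LocBdd.mul {m' : Plane → ℂ} (h : LocBdd m) (h' : LocBdd m') :
    LocBdd fun ζ => m ζ * m' ζ := by
  refine ⟨h.1.mul h'.1, fun n => ?_⟩
  obtain ⟨C, hC⟩ := h.2 n
  obtain ⟨C', hC'⟩ := h'.2 n
  refine ⟨|C| * |C'|, fun ζ hζ => ?_⟩
  rw [norm_mul]
  gcongr
  · exact (hC ζ hζ).trans (le_abs_self C)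
  · exact (hC' ζ hζ).trans (le_abs_self C')

lemma locBdd_one : LocBdd fun _ => 1 := ⟨measurable_const, fun _ => ⟨1, by simp⟩⟩

/-- On the truncated region |ξ| ≥ 1/(n+1), so even η²/ξ is bounded there, by (n+1)³. -/
lemma locBdd_of_le_wt (hm : Measurable m) {C : ℝ} (h : ∀ ζ, ‖m ζ‖ ≤ C * wt (ζ 0) (ζ 1)) :
    LocBdd m := by
  refine ⟨hm, fun n => ⟨|C| * √(1 + (n + 1 : ℝ) ^ 6 + (n + 1 : ℝ) ^ 4 +
    ((n + 1 : ℝ) ^ 2 * (n + 1)) ^ 2), fun ζ hζ => (h ζ).trans ?_⟩⟩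
  have h0 := (abs_le_br_left (ζ 0) (ζ 1)).trans hζ.2
  have h1 := (abs_le_br_right (ζ 0) (ζ 1)).trans hζ.2
  refine mul_le_mul (le_abs_self C) (Real.sqrt_le_sqrt ?_) (wt_pos _ _).le (abs_nonneg C)
  have hx : 0 < |ζ 0| := abs_pos.2 (ne_zero_of_mem_freqSet hζ)
  have hd : ((ζ 1) ^ 2 / ζ 0) ^ 2 ≤ ((n + 1 : ℝ) ^ 2 * (n + 1)) ^ 2 := by
    rw [← sq_abs (_ / _), abs_div, abs_pow]
    have : |ζ 1| ^ 2 / |ζ 0| ≤ (n + 1 : ℝ) ^ 2 * (n + 1) := by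
      rw [div_le_iff₀ hx]
      calc |ζ 1| ^ 2 ≤ (n + 1 : ℝ) ^ 2 * 1 := by rw [mul_one]; gcongr
        _ ≤ (n + 1 : ℝ) ^ 2 * ((n + 1) * |ζ 0|) := by gcongr; exact hζ.1
        _ = _ := by ring
    gcongr
  have h6 : (ζ 0) ^ 6 ≤ (n + 1 : ℝ) ^ 6 := by
    rw [← Even.pow_abs (by decide)]; gcongr
  have h4 : (ζ 1) ^ 4 ≤ (n + 1 : ℝ) ^ 4 := by
    rw [← Even.pow_abs (by decide)]; gcongr
  unfold wtSq
  linarith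

end Symbols

/-- The symbol of the linear part of the equation. -/
noncomputable def lam (ζ : Plane) : ℂ := -symX ζ ^ 3 - symX ζ + symInvXYY ζ

/-- The symbol of the nonlinear part of the equation. -/
noncomputable def sig (ζ : Plane) : ℂ := -(Real.pi * Complex.I * (ζ 0 : ℝ))

/-- The weights as complex symbols. -/
noncomputable def wtC (N : ℕ) (ζ : Plane) : ℂ := (wtN N (ζ 0) (ζ 1) : ℝ)

lemma norm_symX (ζ : Plane) : ‖symX ζ‖ = 2 * Real.pi * |ζ 0| := by
  simp [symX, abs_of_pos Real.pi_pos]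

lemma norm_symY (ζ : Plane) : ‖symY ζ‖ = 2 * Real.pi * |ζ 1| := by
  simp [symY, abs_of_pos Real.pi_pos]

lemma symInvXYY_eq (ζ : Plane) :
    symInvXYY ζ = 2 * Real.pi * Complex.I * ((ζ 1) ^ 2 / ζ 0 : ℝ) := by
  unfold symInvXYY symX symY
  by_cases h : (ζ 0 : ℝ) = 0
  · simp [h]
  · have h' : ((ζ 0 : ℝ) : ℂ) ≠ 0 := by exact_mod_cast h
    have hpi : (Real.pi : ℂ) ≠ 0 := by exact_mod_cast Real.pi_ne_zero
    have := Complex.I_ne_zero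
    push_cast
    field_simp

lemma norm_symInvXYY (ζ : Plane) : ‖symInvXYY ζ‖ = 2 * Real.pi * |(ζ 1) ^ 2 / ζ 0| := by
  rw [symInvXYY_eq, norm_mul, Complex.norm_real, Real.norm_eq_abs]
  simp [abs_of_pos Real.pi_pos]

@[fun_prop]
lemma measurable_symX : Measurable symX := by unfold symX; fun_prop
@[fun_prop]
lemma measurable_symY : Measurable symY := by unfold symY; fun_prop
@[fun_prop]
lemma measurable_symInvXYY : Measurable symInvXYY := by unfold symInvXYY; fun_prop
@[fun_prop]
lemma measurable_lam : Measurable lam := by unfold lam; fun_prop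
@[fun_prop]
lemma measurable_sig : Measurable sig := by unfold sig; fun_prop

lemma norm_lam_le (ζ : Plane) :
    ‖lam ζ‖ ≤ (8 * Real.pi ^ 3 + 10 * Real.pi) * wt (ζ 0) (ζ 1) := by
  have h1 : ‖lam ζ‖ ≤ ‖symX ζ‖ ^ 3 + ‖symX ζ‖ + ‖symInvXYY ζ‖ := by
    unfold lam
    refine (norm_add_le _ _).trans ?_
    gcongr
    refine (norm_sub_le _ _).trans ?_
    rw [norm_neg, norm_pow]
  rw [norm_symX, norm_symInvXYY] at h1
  have h2 := abs_cube_le_wt (ζ 0) (ζ 1)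
  have h3 := (abs_le_br_left (ζ 0) (ζ 1)).trans (br_le_wt (ζ 0) (ζ 1))
  have h4 := abs_div_le_wt (ζ 0) (ζ 1)
  have hpi := Real.pi_pos
  calc _ ≤ _ := h1
    _ = 8 * Real.pi ^ 3 * |ζ 0| ^ 3 + 2 * Real.pi * |ζ 0| + 2 * Real.pi * |(ζ 1) ^ 2 / ζ 0| := by
      ring
    _ ≤ 8 * Real.pi ^ 3 * wt (ζ 0) (ζ 1) + 2 * Real.pi * (4 * wt (ζ 0) (ζ 1)) +
        2 * Real.pi * wt (ζ 0) (ζ 1) := by gcongr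
    _ = _ := by ring

lemma norm_sig (ζ : Plane) : ‖sig ζ‖ = Real.pi * |ζ 0| := by
  simp [sig, abs_of_pos Real.pi_pos]

lemma locBdd_lam : LocBdd lam := locBdd_of_le_wt measurable_lam norm_lam_le

lemma locBdd_sig : LocBdd sig :=
  locBdd_of_le_wt measurable_sig (C := Real.pi * 4) fun ζ => by
    rw [norm_sig, mul_assoc]
    have := Real.pi_pos
    gcongr
    exact (abs_le_br_left _ _).trans (br_le_wt _ _)

lemma locBdd_wtC (N : ℕ) : LocBdd (wtC N) := by
  have hb : LocBdd fun ζ : Plane => ((br (ζ 0) (ζ 1) ^ N : ℝ) : ℂ) := by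
    refine ⟨Complex.measurable_ofReal.comp (measurable_br_plane.pow_const N),
      fun n => ⟨(n + 1 : ℝ) ^ N, fun ζ hζ => ?_⟩⟩
    rw [Complex.norm_real, Real.norm_eq_abs, abs_of_nonneg (pow_nonneg (br_pos _ _).le _)]
    exact pow_le_pow_left₀ (br_pos _ _).le hζ.2 N
  have hw : LocBdd fun ζ : Plane => ((wt (ζ 0) (ζ 1) : ℝ) : ℂ) :=
    locBdd_of_le_wt (C := 1) (Complex.measurable_ofReal.comp measurable_wt_plane) fun ζ => by
      rw [Complex.norm_real, Real.norm_eq_abs, abs_of_nonneg (wt_pos _ _).le, one_mul]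
  have := hb.mul hw
  have e : wtC N = fun ζ : Plane =>
      ((br (ζ 0) (ζ 1) ^ N : ℝ) : ℂ) * ((wt (ζ 0) (ζ 1) : ℝ) : ℂ) := by
    ext ζ; simp [wtC, wtN]
  rwa [e]

lemma symX_neg (ζ : Plane) : symX (-ζ) = conj (symX ζ) := by simp [symX, Complex.conj_ofReal, map_ofNat]

lemma symInvXYY_neg (ζ : Plane) : symInvXYY (-ζ) = conj (symInvXYY ζ) := by
  simp only [symInvXYY_eq, PiLp.neg_apply, neg_sq, div_neg, Complex.ofReal_neg, map_mul,
    Complex.conj_ofReal, Complex.conj_I, map_ofNat]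
  ring

/-- The dispersive part is skew-adjoint: being purely imaginary, it contributes nothing to any
weighted energy. -/
lemma conj_lam (ζ : Plane) : conj (lam ζ) = - lam ζ := by
  have hx : conj (symX ζ) = - symX ζ := by simp [symX, Complex.conj_ofReal, map_ofNat]
  have hi : conj (symInvXYY ζ) = - symInvXYY ζ := by
    simp only [symInvXYY_eq, map_mul, Complex.conj_ofReal, Complex.conj_I, map_ofNat]
    ring
  unfold lam
  rw [map_add, map_sub, map_neg, map_pow, hx, hi]
  ring

lemma lam_neg (ζ : Plane) : lam (-ζ) = conj (lam ζ) := by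
  unfold lam
  rw [map_add, map_sub, map_neg, map_pow, ← symX_neg, ← symInvXYY_neg]

lemma sig_neg (ζ : Plane) : sig (-ζ) = conj (sig ζ) := by simp [sig, Complex.conj_ofReal]

lemma sig_neg' (ζ : Plane) : sig (-ζ) = Real.pi * Complex.I * (ζ 0 : ℝ) := by simp [sig]

lemma wtN_neg (N : ℕ) (a b : ℝ) : wtN N (-a) (-b) = wtN N a b := by
  simp [wtN, br_neg, wt, wtSq, Even.neg_pow (show Even 6 by decide),
    Even.neg_pow (show Even 4 by decide), div_neg]

lemma wtC_neg (N : ℕ) (ζ : Plane) : wtC N (-ζ) = wtC N ζ := by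
  simp [wtC, wtN_neg]

/-! ### The truncated evolution -/

/-- The truncated Fourier multiplier. -/
noncomputable def truncOp (n : ℕ) {m : Plane → ℂ} (h : LocBdd m) : Spec →L[ℂ] Spec :=
  mulOp (fun ζ => chi n ζ * m ζ) (h.bddMeas n)

lemma truncOp_coe (n : ℕ) {m : Plane → ℂ} (h : LocBdd m) (f : Spec) :
    ∀ᵐ ζ, truncOp n h f ζ = chi n ζ * m ζ * f ζ := mulOp_coe _ _ f

/-- The truncated nonlinearity. -/
noncomputable def nonlin (n : ℕ) : Spec →L[ℂ] Spec →L[ℂ] Spec :=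
  convOp (fun ζ => chi n ζ * sig ζ) (locBdd_sig.memLp n)

/-- The vector field of the truncated equation. -/
noncomputable def field (n : ℕ) (f : Spec) : Spec := truncOp n locBdd_lam f + nonlin n f f

/-- Real-valuedness in physical space, and frequency support in the truncated region. -/
structure Adm (n : ℕ) (f : Spec) : Prop where
  herm : Herm f
  supp : ∀ᵐ ζ, ζ ∉ freqSet n → f ζ = 0

/-- The projection onto the admissible functions. -/
noncomputable def proj (n : ℕ) : Spec →L[ℝ] Spec :=
  (2⁻¹ : ℝ) • ((ContinuousLinearMap.id ℝ Spec + refl).comp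
    ((truncOp n locBdd_one).restrictScalars ℝ))

lemma proj_apply (n : ℕ) (f : Spec) :
    proj n f = (2⁻¹ : ℝ) • (truncOp n locBdd_one f + refl (truncOp n locBdd_one f)) := rfl

lemma refl_truncOp (n : ℕ) {m : Plane → ℂ} (h : LocBdd m) (hm : ∀ ζ, m (-ζ) = conj (m ζ))
    (f : Spec) : refl (truncOp n h f) = truncOp n h (refl f) :=
  refl_mulOp _ (fun x => by rw [map_mul, conj_chi, chi_neg, hm]) f

lemma truncOp_one_eq_iff (n : ℕ) (f : Spec) :
    truncOp n locBdd_one f = f ↔ ∀ᵐ ζ, ζ ∉ freqSet n → f ζ = 0 := by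
  constructor
  · intro h
    filter_upwards [truncOp_coe n locBdd_one f] with ζ hζ hn
    rwa [h, chi_of_notMem hn, zero_mul, zero_mul] at hζ
  · intro h
    refine Lp.ext ?_
    filter_upwards [truncOp_coe n locBdd_one f, h] with ζ hζ h
    rw [hζ]
    by_cases hn : ζ ∈ freqSet n
    · rw [chi_of_mem hn, one_mul, one_mul]
    · rw [h hn, mul_zero]

lemma supp_truncOp (n : ℕ) {m : Plane → ℂ} (h : LocBdd m) (f : Spec) :
    ∀ᵐ ζ, ζ ∉ freqSet n → truncOp n h f ζ = 0 := by
  filter_upwards [truncOp_coe n h f] with ζ hζ hn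
  rw [hζ, chi_of_notMem hn, zero_mul, zero_mul]

lemma supp_add {n : ℕ} {f g : Spec} (hf : ∀ᵐ ζ, ζ ∉ freqSet n → f ζ = 0)
    (hg : ∀ᵐ ζ, ζ ∉ freqSet n → g ζ = 0) : ∀ᵐ ζ, ζ ∉ freqSet n → (f + g : Spec) ζ = 0 := by
  filter_upwards [hf, hg, Lp.coeFn_add f g] with ζ h1 h2 h3 hn
  rw [h3, Pi.add_apply, h1 hn, h2 hn, add_zero]

lemma nonlin_coe (n : ℕ) (f g : Spec) :
    ∀ᵐ ζ, nonlin n f g ζ = chi n ζ * sig ζ * conv f g ζ := convOp_coe _ f g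

lemma supp_field (n : ℕ) (f : Spec) : ∀ᵐ ζ, ζ ∉ freqSet n → field n f ζ = 0 := by
  refine supp_add (supp_truncOp n _ f) ?_
  filter_upwards [nonlin_coe n f f] with ζ hζ hn
  rw [hζ, chi_of_notMem hn, zero_mul, zero_mul]

lemma refl_field (n : ℕ) (f : Spec) : refl (field n f) = field n (refl f) := by
  unfold field nonlin
  rw [map_add, refl_truncOp n locBdd_lam lam_neg, refl_convOp]
  intro x
  rw [map_mul, conj_chi, chi_neg, sig_neg]

lemma adm_iff (n : ℕ) (f : Spec) : Adm n f ↔ refl f = f ∧ truncOp n locBdd_one f = f := by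
  rw [refl_eq_iff, truncOp_one_eq_iff]
  exact ⟨fun h => ⟨h.1, h.2⟩, fun h => ⟨h.1, h.2⟩⟩

lemma adm_proj (n : ℕ) (f : Spec) : Adm n (proj n f) := by
  rw [adm_iff]
  have h1 : truncOp n locBdd_one (truncOp n locBdd_one f) = truncOp n locBdd_one f :=
    (truncOp_one_eq_iff n _).2 (supp_truncOp n _ f)
  have h2 := refl_truncOp n locBdd_one (by simp) (truncOp n locBdd_one f)
  rw [h1] at h2
  rw [proj_apply]
  constructor
  · rw [map_smul, map_add, refl_refl, add_comm]
  · have : truncOp n locBdd_one ((2⁻¹ : ℝ) • (truncOp n locBdd_one f + refl (truncOp n locBdd_one f)))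
        = (2⁻¹ : ℝ) • truncOp n locBdd_one (truncOp n locBdd_one f + refl (truncOp n locBdd_one f)) :=
      map_smul ((truncOp n locBdd_one).restrictScalars ℝ) _ _
    rw [this, map_add, h1, ← h2]

lemma proj_eq_iff (n : ℕ) (f : Spec) : proj n f = f ↔ Adm n f := by
  constructor
  · intro h; rw [← h]; exact adm_proj n f
  · intro h
    obtain ⟨h1, h2⟩ := (adm_iff n f).1 h
    rw [proj_apply, h2, h1, ← two_smul ℝ f, smul_smul]
    norm_num

lemma Adm.field {n : ℕ} {f : Spec} (h : Adm n f) : Adm n (field n f) := by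
  refine ⟨?_, supp_field n f⟩
  rw [← refl_eq_iff, refl_field, (refl_eq_iff f).2 h.herm]

/-! ### The energy inequality for the truncated equation -/

section Energy

variable {n : ℕ} {f : Spec}

lemma ae_supp_neg_add (h : ∀ᵐ ζ, ζ ∉ freqSet n → f ζ = 0) (x : Plane) :
    ∀ᵐ y, -(x + y) ∉ freqSet n → f (-(x + y)) = 0 :=
  ((Measure.measurePreserving_neg volume).comp
    (measurePreserving_add_left volume x)).quasiMeasurePreserving.ae h

/-- The support condition confines the integral to triples inside the truncated region. There all
three ξ are nonzero, as the symbol estimate requires. -/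
lemma lintegral_supp_le (h : ∀ᵐ ζ, ζ ∉ freqSet n → f ζ = 0) {τ : Plane → Plane → ℂ}
    {b : Plane → Plane → ℝ≥0∞}
    (hb : ∀ x y, x ∈ freqSet n → y ∈ freqSet n → -(x + y) ∈ freqSet n → ‖τ x y‖ₑ ≤ b x y) :
    ∫⁻ x, ∫⁻ y, ‖τ x y * (f x * (f y * f (-(x + y))))‖ₑ ≤
      ∫⁻ x, ∫⁻ y, b x y * (‖f x‖ₑ * (‖f y‖ₑ * ‖f (-(x + y))‖ₑ)) := by
  refine lintegral_mono_ae ?_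
  filter_upwards [h] with x hx
  refine lintegral_mono_ae ?_
  filter_upwards [h, ae_supp_neg_add h x] with y hy hz
  rw [enorm_mul, enorm_mul, enorm_mul]
  by_cases h1 : x ∈ freqSet n
  · by_cases h2 : y ∈ freqSet n
    · by_cases h3 : -(x + y) ∈ freqSet n
      · gcongr
        exact hb x y h1 h2 h3
      · rw [hz h3]; simp
    · simp [hy h2]
  · simp [hx h1]

/-- The pairing of the weighted vector field with the weighted function, for a real even
weight `w`. -/
lemma inner_truncOp_field {w : Plane → ℂ} (hw : LocBdd w) (hc : ∀ ζ, conj (w ζ) = w ζ) :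
    |inner ℝ (truncOp n hw f) (truncOp n hw (field n f))| ≤
      ‖∫ z, conj (f z) * ((chi n z * (w z ^ 2 * sig z)) * conv f f z)‖ := by
  rw [real_inner_eq]
  have e : ∀ᵐ z, conj (truncOp n hw f z) * truncOp n hw (field n f) z =
      (chi n z * w z) ^ 2 * lam z * (conj (f z) * f z) +
      conj (f z) * ((chi n z * (w z ^ 2 * sig z)) * conv f f z) := by
    filter_upwards [truncOp_coe n hw f, truncOp_coe n hw (field n f),
      Lp.coeFn_add (truncOp n locBdd_lam f) (nonlin n f f), truncOp_coe n locBdd_lam f,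
      nonlin_coe n f f] with z h1 h2 h3 h4 h5
    rw [h1, h2, field, h3, Pi.add_apply, h4, h5, map_mul, map_mul, hc, conj_chi]
    by_cases hz : z ∈ freqSet n
    · rw [chi_of_mem hz]; ring
    · rw [chi_of_notMem hz]; ring
  have i2 : Integrable fun z => conj (f z) * ((chi n z * (w z ^ 2 * sig z)) * conv f f z) := by
    have hs : LocBdd fun z => w z ^ 2 * sig z := by
      simpa only [sq] using (hw.mul hw).mul locBdd_sig
    have := (L2.integrable_inner (𝕜 := ℂ) f (convOp _ (hs.memLp n) f f))
    refine this.congr ?_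
    filter_upwards [convOp_coe (hs.memLp n) f f] with z hz
    rw [hz]; simp only [RCLike.inner_apply]; ring
  have i0 : Integrable fun z => conj (truncOp n hw f z) * truncOp n hw (field n f) z := by
    refine (L2.integrable_inner (𝕜 := ℂ) (truncOp n hw f) (truncOp n hw (field n f))).congr ?_
    filter_upwards with z
    simp only [RCLike.inner_apply]; ring
  have i1 : Integrable fun z => (chi n z * w z) ^ 2 * lam z * (conj (f z) * f z) := by
    refine (i0.sub i2).congr ?_
    filter_upwards [e] with z hz
    simp only [Pi.sub_apply, hz]; ring
  rw [integral_congr_ae e, integral_add i1 i2, Complex.add_re]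
  -- The integral equals minus its conjugate because λ is purely imaginary and the weight is real.
  have e1 : (∫ z, (chi n z * w z) ^ 2 * lam z * (conj (f z) * f z)).re = 0 := by
    have hcj : conj (∫ z, (chi n z * w z) ^ 2 * lam z * (conj (f z) * f z)) =
        - ∫ z, (chi n z * w z) ^ 2 * lam z * (conj (f z) * f z) := by
      rw [← integral_conj, ← integral_neg]
      congr! 2 with z
      simp only [map_mul, map_pow, conj_chi, hc, conj_lam, Complex.conj_conj]
      ring
    have := congrArg Complex.re hcj
    rw [Complex.conj_re, Complex.neg_re] at this
    linarith
  rw [e1, zero_add]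
  exact Complex.abs_re_le_norm _

/-- The trilinear bound for the pairing. -/
lemma pairing_weight_le {w : Plane → ℂ} (hw : LocBdd w) (he : ∀ ζ, w (-ζ) = w ζ)
    (hf : Adm n f) {b : Plane → Plane → ℝ≥0∞}
    (hb : ∀ x y, x ∈ freqSet n → y ∈ freqSet n → -(x + y) ∈ freqSet n →
      ‖w x ^ 2 * (x 0 : ℝ) + w y ^ 2 * (y 0 : ℝ) + w (-(x + y)) ^ 2 * ((-(x + y)) 0 : ℝ)‖ₑ
        ≤ b x y) :
    3 * ‖∫ z, conj (f z) * ((chi n z * (w z ^ 2 * sig z)) * conv f f z)‖ₑ ≤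
      ENNReal.ofReal Real.pi *
        ∫⁻ x, ∫⁻ y, b x y * (‖f x‖ₑ * (‖f y‖ₑ * ‖f (-(x + y))‖ₑ)) := by
  have hs : LocBdd fun z => w z ^ 2 * sig z := by
    simpa only [sq] using (hw.mul hw).mul locBdd_sig
  refine (pairing_symm_le (hs.bddMeas n).1 (hs.memLp n) f hf.herm).trans ?_
  refine (lintegral_supp_le hf.supp (b := fun x y => ENNReal.ofReal Real.pi * b x y)
    fun x y hx hy hz => ?_).trans (le_of_eq ?_)
  · have hz' : x + y ∈ freqSet n := by rwa [← neg_mem_freqSet]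
    have e : chi n (-x) * (w (-x) ^ 2 * sig (-x)) + chi n (-y) * (w (-y) ^ 2 * sig (-y)) +
        chi n (x + y) * (w (x + y) ^ 2 * sig (x + y)) = Real.pi * Complex.I *
        (w x ^ 2 * (x 0 : ℝ) + w y ^ 2 * (y 0 : ℝ) +
          w (-(x + y)) ^ 2 * ((-(x + y)) 0 : ℝ)) := by
      rw [chi_neg, chi_neg, chi_of_mem hx, chi_of_mem hy, chi_of_mem hz', he, he, he, sig_neg',
        sig_neg', sig]
      push_cast [PiLp.neg_apply, PiLp.add_apply]
      ring
    rw [e, enorm_mul]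
    have hpi : ‖(Real.pi : ℂ) * Complex.I‖ₑ = ENNReal.ofReal Real.pi := by
      rw [← ofReal_norm]; simp [abs_of_pos Real.pi_pos]
    rw [hpi]
    gcongr
    exact hb x y hx hy hz
  · simp only [mul_assoc]
    rw [← lintegral_const_mul' _ _ ENNReal.ofReal_ne_top]
    congr! 2 with x
    rw [← lintegral_const_mul' _ _ ENNReal.ofReal_ne_top]

/-- With weight 1 the symmetrised symbol is the sum of the three ξ, which is zero. This is
conservation of the L² norm. -/
lemma inner_field_eq_zero (hf : Adm n f) : inner ℝ f (field n f) = 0 := by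
  have h1 := (truncOp_one_eq_iff n f).2 hf.supp
  have h2 := (truncOp_one_eq_iff n _).2 hf.field.supp
  have h3 := inner_truncOp_field (n := n) (f := f) locBdd_one (by simp)
  have h4 := pairing_weight_le locBdd_one (by simp) hf (b := fun _ _ => 0) (by
    intro x y _ _ _
    simp)
  rw [h1, h2] at h3
  simp only [zero_mul, lintegral_zero, mul_zero, nonpos_iff_eq_zero, mul_eq_zero,
    OfNat.ofNat_ne_zero, false_or, enorm_eq_zero] at h4
  rw [h4, norm_zero] at h3
  exact abs_nonpos_iff.1 h3

/-- The weighted norm of the truncated function. -/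
noncomputable def wnorm (n N : ℕ) (f : Spec) : ℝ := ‖truncOp n (locBdd_wtC N) f‖

lemma enorm_wtC (N : ℕ) (ζ : Plane) : ‖wtC N ζ‖ₑ = wtE N ζ := by
  rw [← ofReal_norm, wtC, Complex.norm_real, Real.norm_eq_abs, abs_of_pos (wtN_pos _ _ _), wtE]

lemma ofReal_wnorm_le (n N : ℕ) (f : Spec) :
    ENNReal.ofReal (wnorm n N f) ≤ l2 fun ζ => wtE N ζ * ‖f ζ‖ₑ := by
  rw [wnorm, ofReal_norm, ← l2_spec]
  refine l2_mono ?_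
  filter_upwards [truncOp_coe n (locBdd_wtC N) f] with ζ hζ
  rw [hζ, enorm_mul, enorm_mul, enorm_wtC]
  gcongr
  by_cases h : ζ ∈ freqSet n
  · simp [chi_of_mem h]
  · simp [chi_of_notMem h]

lemma ofReal_wnorm (N : ℕ) (hf : ∀ᵐ ζ, ζ ∉ freqSet n → f ζ = 0) :
    ENNReal.ofReal (wnorm n N f) = l2 fun ζ => wtE N ζ * ‖f ζ‖ₑ := by
  rw [wnorm, ofReal_norm, ← l2_spec]
  refine l2_congr ?_
  filter_upwards [truncOp_coe n (locBdd_wtC N) f, hf] with ζ hζ h0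
  rw [hζ, enorm_mul, enorm_mul, enorm_wtC]
  by_cases h : ζ ∈ freqSet n
  · simp [chi_of_mem h]
  · simp [h0 h]

lemma wnorm_nonneg (n N : ℕ) (f : Spec) : 0 ≤ wnorm n N f := norm_nonneg _

/-- The constant in the energy inequality. -/
noncomputable def energyConst (N : ℕ) : ℝ :=
  Real.pi * ((413 + 174 * N) * 2 ^ N) * ratioConst.toReal

lemma energyConst_nonneg (N : ℕ) : 0 ≤ energyConst N := by
  have := Real.pi_pos
  unfold energyConst
  positivity

lemma ofReal_triWeight (N : ℕ) (x y : Plane) :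
    ENNReal.ofReal (triWeight N (x 0) (x 1) (y 0) (y 1) ((-(x + y)) 0) ((-(x + y)) 1)) =
      brE (max N 1) x * (wtE N y * wtE N (-(x + y))) +
      wtE N x * (brE (max N 1) y * wtE N (-(x + y))) +
      wtE N x * (wtE N y * brE (max N 1) (-(x + y))) := by
  have p := fun z : Plane => (wtN_pos N (z 0) (z 1)).le
  simp only [wtE, brE, ← ENNReal.ofReal_mul (p _)]
  have q' : ∀ z : Plane, 0 ≤ br (z 0) (z 1) ^ max N 1 := fun z => (lowN_pos N (z 0) (z 1)).le
  have p1 := p x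
  have p2 := p y
  have p3 := p (-(x + y))
  have q1 := q' x
  have q2 := q' y
  have q3 := q' (-(x + y))
  rw [← ENNReal.ofReal_mul q1, ← ENNReal.ofReal_mul q2, ← ENNReal.ofReal_mul p1, ← ENNReal.ofReal_add (by positivity) (by positivity),
    ← ENNReal.ofReal_add (by positivity) (by positivity)]
  congr 1
  unfold triWeight lowN
  ring

/-- The trilinear form does not change when its arguments are permuted, so the three summands of the
weight contribute equally. The factor 3 cancels against the one from symmetrisation. -/
lemma lintegral_triWeight (N : ℕ) (f : Spec) :
    ∫⁻ x : Plane, ∫⁻ y : Plane, ENNReal.ofReal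
        (triWeight N (x 0) (x 1) (y 0) (y 1) ((-(x + y)) 0) ((-(x + y)) 1)) *
        (‖f x‖ₑ * (‖f y‖ₑ * ‖f (-(x + y))‖ₑ)) =
      3 * tri (fun ζ => brE (max N 1) ζ * ‖f ζ‖ₑ) (fun ζ => wtE N ζ * ‖f ζ‖ₑ)
        (fun ζ => wtE N ζ * ‖f ζ‖ₑ) := by
  set a := fun ζ => brE (max N 1) ζ * ‖f ζ‖ₑ with ha
  set c := fun ζ => wtE N ζ * ‖f ζ‖ₑ with hc
  have ma : Measurable a := by fun_prop
  have mc : Measurable c := by fun_prop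
  have e2 : tri c a c = tri a c c := tri_swap_left mc ma mc
  have e3 : tri c c a = tri a c c := by rw [tri_swap_right, e2]
  have e : 3 * tri a c c = tri a c c + tri c a c + tri c c a := by rw [e2, e3]; ring
  rw [e]
  unfold tri
  rw [← lintegral_add_left, ← lintegral_add_left]
  · congr! 2 with x
    rw [← lintegral_add_left (by fun_prop), ← lintegral_add_left (by fun_prop)]
    congr! 2 with y
    rw [ofReal_triWeight, ha, hc]
    ring
  · refine Measurable.add ?_ ?_ <;>
      exact Measurable.lintegral_prod_right (by unfold Function.uncurry; fun_prop)
  · exact Measurable.lintegral_prod_right (by unfold Function.uncurry; fun_prop)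

/-- Symmetrisation, the symbol estimate and an L¹–L²–L² bound, with the weakly weighted factor in
L¹. Since `0 - 1 = 0`, the case N = 0 is a cubic inequality in the base norm; for N ≥ 1 the growth
rate of the squared top norm involves only the norm one order lower. -/
theorem energy_estimate (N : ℕ) (hf : Adm n f) :
    |inner ℝ (truncOp n (locBdd_wtC N) f) (truncOp n (locBdd_wtC N) (field n f))| ≤
      energyConst N * wnorm n (N - 1) f * wnorm n N f ^ 2 := by
  refine (inner_truncOp_field (locBdd_wtC N) (fun ζ => Complex.conj_ofReal _)).trans ?_
  set C : ℝ := (413 + 174 * N) * 2 ^ N with hC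
  have hC0 : 0 ≤ C := by positivity
  have h1 := pairing_weight_le (locBdd_wtC N) (wtC_neg N) hf (b := fun x y => ENNReal.ofReal C *
    ENNReal.ofReal (triWeight N (x 0) (x 1) (y 0) (y 1) ((-(x + y)) 0) ((-(x + y)) 1))) (by
      intro x y hx hy hz
      have h := symbol_estimate N (x₁ := x 0) (x₂ := y 0) (x₃ := (-(x + y)) 0) (y₁ := x 1)
        (y₂ := y 1) (y₃ := (-(x + y)) 1) (by simp) (by simp) (ne_zero_of_mem_freqSet hx)
        (ne_zero_of_mem_freqSet hy) (ne_zero_of_mem_freqSet hz)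
      rw [← ENNReal.ofReal_mul hC0, ← ofReal_norm]
      refine ENNReal.ofReal_le_ofReal (le_trans (le_of_eq ?_) h)
      unfold wtC
      rw [← Real.norm_eq_abs, ← Complex.norm_real]
      push_cast
      rfl)
  simp only [mul_assoc (ENNReal.ofReal C)] at h1
  have h2 : ∫⁻ x : Plane, ∫⁻ y : Plane, ENNReal.ofReal C * (ENNReal.ofReal
        (triWeight N (x 0) (x 1) (y 0) (y 1) ((-(x + y)) 0) ((-(x + y)) 1)) *
        (‖f x‖ₑ * (‖f y‖ₑ * ‖f (-(x + y))‖ₑ))) =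
      ENNReal.ofReal C * (3 * tri (fun ζ => brE (max N 1) ζ * ‖f ζ‖ₑ) (fun ζ => wtE N ζ * ‖f ζ‖ₑ)
        (fun ζ => wtE N ζ * ‖f ζ‖ₑ)) := by
    rw [← lintegral_triWeight, ← lintegral_const_mul' _ _ ENNReal.ofReal_ne_top]
    congr! 2 with x
    rw [← lintegral_const_mul' _ _ ENNReal.ofReal_ne_top]
  rw [h2] at h1
  have h3 := tri_le (a := fun ζ => brE (max N 1) ζ * ‖f ζ‖ₑ) (b := fun ζ => wtE N ζ * ‖f ζ‖ₑ)
    (c := fun ζ => wtE N ζ * ‖f ζ‖ₑ) (by fun_prop) (by fun_prop) (by fun_prop)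
  have h4 := lintegral_low_le N (a := fun ζ => ‖f ζ‖ₑ) (by fun_prop)
  rw [← ofReal_wnorm (N - 1) hf.supp] at h4
  rw [← ofReal_wnorm N hf.supp] at h3
  have hr : ratioConst = ENNReal.ofReal ratioConst.toReal :=
    (ENNReal.ofReal_toReal ratioConst_lt_top.ne).symm
  have hpi := Real.pi_pos
  have hw := wnorm_nonneg n N f
  have hw' := wnorm_nonneg n (N - 1) f
  have h5 : ‖∫ z, conj (f z) * ((chi n z * (wtC N z ^ 2 * sig z)) * conv f f z)‖ₑ ≤
      ENNReal.ofReal (energyConst N * wnorm n (N - 1) f * wnorm n N f ^ 2) := by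
    have h6 : 3 * ‖∫ z, conj (f z) * ((chi n z * (wtC N z ^ 2 * sig z)) * conv f f z)‖ₑ ≤
        3 * ENNReal.ofReal (energyConst N * wnorm n (N - 1) f * wnorm n N f ^ 2) := by
      refine h1.trans ?_
      calc _ ≤ ENNReal.ofReal Real.pi * (ENNReal.ofReal C * (3 *
            ((ENNReal.ofReal ratioConst.toReal * ENNReal.ofReal (wnorm n (N - 1) f)) *
            (ENNReal.ofReal (wnorm n N f) * ENNReal.ofReal (wnorm n N f))))) := by
            gcongr
            refine h3.trans ?_
            gcongr
            rwa [← hr]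
        _ = 3 * (ENNReal.ofReal Real.pi * ENNReal.ofReal C * ENNReal.ofReal ratioConst.toReal *
            ENNReal.ofReal (wnorm n (N - 1) f) * (ENNReal.ofReal (wnorm n N f)) ^ 2) := by ring
        _ = _ := by
            rw [← ENNReal.ofReal_pow hw, ← ENNReal.ofReal_mul hpi.le,
              ← ENNReal.ofReal_mul (by positivity), ← ENNReal.ofReal_mul (by positivity),
              ← ENNReal.ofReal_mul (by positivity), energyConst]
    exact (ENNReal.mul_le_mul_iff_right (by norm_num) (by norm_num)).1 h6
  have h0 := energyConst_nonneg N
  rw [← ofReal_norm] at h5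
  exact (ENNReal.ofReal_le_ofReal_iff (by positivity)).1 h5

end Energy

/-! ### Solutions of the truncated equation and uniform bounds -/

/-- Gronwall's inequality. Taking K ≥ 1 absorbs the quotient ε/K of the sharp bound into ε. -/
lemma le_exp_of_deriv_le {T K ε : ℝ} {y y' : ℝ → ℝ}
    (hy : ∀ t ∈ Set.Icc 0 T, HasDerivWithinAt y (y' t) (Set.Icc 0 T) t) (hK : 1 ≤ K) (hε : 0 ≤ ε)
    (h0 : 0 ≤ y 0) (h : ∀ t ∈ Set.Icc 0 T, y' t ≤ K * y t + ε) {t : ℝ} (ht : t ∈ Set.Icc 0 T) :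
    y t ≤ (y 0 + ε) * Real.exp (K * T) := by
  have hr : ∀ t ∈ Set.Ico 0 T, HasDerivWithinAt y (y' t) (Set.Ici t) t := fun t ht =>
    (hy t ⟨ht.1, ht.2.le⟩).mono_of_mem_nhdsWithin (Icc_mem_nhdsGE_of_mem ht)
  have h1 := le_gronwallBound_of_liminf_deriv_right_le (f := y) (f' := y') (δ := y 0) (K := K)
    (ε := ε) (a := 0) (b := T) (fun t ht => (hy t ht).continuousWithinAt)
    (fun t ht r hr' => (hr t ht).liminf_right_slope_le hr') le_rfl
    (fun t ht => h t ⟨ht.1, ht.2.le⟩) t ht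
  refine h1.trans ?_
  have hK0 : 0 < K := by linarith
  rw [gronwallBound_of_K_ne_0 hK0.ne', sub_zero]
  have h2 : Real.exp (K * t) ≤ Real.exp (K * T) := Real.exp_le_exp.2 (by gcongr; exact ht.2)
  have h3 : ε / K ≤ ε := div_le_self hε hK
  have h4 : 0 ≤ Real.exp (K * t) - 1 := by
    have := Real.one_le_exp (mul_nonneg hK0.le ht.1)
    linarith
  have h5 : ε / K * (Real.exp (K * t) - 1) ≤ ε * Real.exp (K * t) :=
    mul_le_mul h3 (by linarith) h4 hε
  calc _ ≤ y 0 * Real.exp (K * t) + ε * Real.exp (K * t) := by linarith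
    _ = (y 0 + ε) * Real.exp (K * t) := by ring
    _ ≤ _ := by gcongr

lemma norm_field_sub_le (n : ℕ) (f g : Spec) :
    ‖field n f - field n g‖ ≤
      (‖truncOp n locBdd_lam‖ + ‖nonlin n‖ * ‖f‖ + ‖nonlin n‖ * ‖g‖) * ‖f - g‖ := by
  have e : field n f - field n g =
      truncOp n locBdd_lam (f - g) + nonlin n f (f - g) + nonlin n (f - g) g := by
    simp only [field, map_sub, sub_apply]
    abel
  rw [e]
  refine (norm_add₃_le).trans ?_
  have h1 := (truncOp n locBdd_lam).le_opNorm (f - g)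
  have h2 := (nonlin n).le_opNorm₂ f (f - g)
  have h3 := (nonlin n).le_opNorm₂ (f - g) g
  linarith

/-- A solution on `[0, T]` of the truncated equation with truncated initial value. -/
structure TruncSol (n : ℕ) (T : ℝ) (g : Spec) (f : ℝ → Spec) : Prop where
  init : f 0 = truncOp n locBdd_one g
  deriv : ∀ t ∈ Set.Icc 0 T, HasDerivWithinAt f (field n (f t)) (Set.Icc 0 T) t
  adm : ∀ t ∈ Set.Icc 0 T, Adm n (f t)

lemma adm_truncOp (n : ℕ) {g : Spec} (hg : Herm g) : Adm n (truncOp n locBdd_one g) := by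
  rw [adm_iff, refl_truncOp _ _ (by simp), (refl_eq_iff g).2 hg]
  exact ⟨rfl, (truncOp_one_eq_iff n _).2 (supp_truncOp n _ g)⟩

lemma exists_truncSol (n : ℕ) {T : ℝ} (hT : 0 ≤ T) {g : Spec} (hg : Herm g) :
    ∃ f, TruncSol n T g f := by
  obtain ⟨f, h0, hf⟩ := exists_conservative_solution (F := field n) (proj n)
    (fun R => ⟨‖truncOp n locBdd_lam‖ + ‖nonlin n‖ * |R| + ‖nonlin n‖ * |R|, by positivity,
      fun x y hx hy => (norm_field_sub_le n x y).trans (by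
        gcongr
        · exact hx.trans (le_abs_self R)
        · exact hy.trans (le_abs_self R))⟩)
    (fun x => (proj_eq_iff n _).2 (adm_proj n x).field)
    (fun x hx => inner_field_eq_zero ((proj_eq_iff n x).1 hx))
    ((proj_eq_iff n _).2 (adm_truncOp n hg)) hT
  exact ⟨f, h0, fun t ht => (hf t ht).1, fun t ht => (proj_eq_iff n _).1 (hf t ht).2⟩

lemma truncOp_one_enorm_le (n : ℕ) (g : Spec) :
    ∀ᵐ ζ, ‖truncOp n locBdd_one g ζ‖ₑ ≤ ‖g ζ‖ₑ := by
  filter_upwards [truncOp_coe n locBdd_one g] with ζ hζ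
  rw [hζ]
  by_cases h : ζ ∈ freqSet n
  · simp [chi_of_mem h]
  · simp [chi_of_notMem h]

lemma ofReal_wnorm_truncOp_le (n N : ℕ) (g : Spec) :
    ENNReal.ofReal (wnorm n N (truncOp n locBdd_one g)) ≤ l2 fun ζ => wtE N ζ * ‖g ζ‖ₑ := by
  refine (ofReal_wnorm_le n N _).trans (l2_mono ?_)
  filter_upwards [truncOp_one_enorm_le n g] with ζ hζ
  gcongr

section Bounds

variable {n : ℕ} {T : ℝ} {g : Spec} {f : ℝ → Spec}

lemma TruncSol.hasDerivWithinAt_wnorm (h : TruncSol n T g f) (N : ℕ) {t : ℝ}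
    (ht : t ∈ Set.Icc 0 T) :
    HasDerivWithinAt (fun t => wnorm n N (f t) ^ 2)
      (2 * inner ℝ (truncOp n (locBdd_wtC N) (f t)) (truncOp n (locBdd_wtC N) (field n (f t))))
      (Set.Icc 0 T) t :=
  ((((truncOp n (locBdd_wtC N)).restrictScalars ℝ).hasFDerivAt.comp_hasDerivWithinAt t
    (h.deriv t ht))).norm_sq

/-- The uniform bound in the base norm on a time interval depending on the base norm of the
initial value only. -/
lemma TruncSol.wnorm_zero_le (h : TruncSol n T g f) {k : ℝ} (hk : 0 < k) (hT0 : 0 < T)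
    (hT : 16 * (energyConst 0 + 1) * k * T ≤ 1)
    (hg : l2 (fun ζ => wtE 0 ζ * ‖g ζ‖ₑ) ≤ ENNReal.ofReal k) {t : ℝ} (ht : t ∈ Set.Icc 0 T) :
    wnorm n 0 (f t) ≤ 2 * k := by
  have hc := energyConst_nonneg 0
  have h0 : wnorm n 0 (f 0) ≤ k := by
    rw [h.init]
    exact (ENNReal.ofReal_le_ofReal_iff hk.le).1 ((ofReal_wnorm_truncOp_le n 0 g).trans hg)
  -- A linear barrier from k² to 4k² for the squared norm. At a contact point the norm is at most
  -- 2k, so the derivative is at most 16 `energyConst 0` k³, which the smallness of T keeps strictly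
  -- below the slope 3k²/T.
  have key := image_le_of_deriv_right_lt_deriv_boundary (a := 0) (b := T)
    (f := fun t => wnorm n 0 (f t) ^ 2)
    (f' := fun t => 2 * inner ℝ (truncOp n (locBdd_wtC 0) (f t))
      (truncOp n (locBdd_wtC 0) (field n (f t))))
    (B := fun t => k ^ 2 + 3 * k ^ 2 / T * t) (B' := fun _ => 3 * k ^ 2 / T)
    (fun t ht => (h.hasDerivWithinAt_wnorm 0 ht).continuousWithinAt)
    (fun t ht => (h.hasDerivWithinAt_wnorm 0 ⟨ht.1, ht.2.le⟩).mono_of_mem_nhdsWithin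
      (Icc_mem_nhdsGE_of_mem ht))
    (by
      have := wnorm_nonneg n 0 (f 0)
      simp only [mul_zero, add_zero]
      gcongr)
    (fun t => by simpa using ((hasDerivAt_id t).const_mul (3 * k ^ 2 / T)).const_add (k ^ 2))
    (by
      intro t ht hB
      have hw := wnorm_nonneg n 0 (f t)
      have h1 := energy_estimate 0 (h.adm t ⟨ht.1, ht.2.le⟩)
      have h2 : wnorm n 0 (f t) ^ 2 ≤ (2 * k) ^ 2 := by
        rw [hB]
        have : 3 * k ^ 2 / T * t ≤ 3 * k ^ 2 := by
          rw [div_mul_eq_mul_div, div_le_iff₀ hT0]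
          gcongr
          exact ht.2.le
        nlinarith
      have h3 : wnorm n 0 (f t) ≤ 2 * k := abs_le_of_sq_le_sq' h2 (by linarith) |>.2
      have h4 : inner ℝ (truncOp n (locBdd_wtC 0) (f t))
          (truncOp n (locBdd_wtC 0) (field n (f t))) ≤ energyConst 0 * (2 * k) * (2 * k) ^ 2 := by
        refine (le_abs_self _).trans (h1.trans ?_)
        gcongr
      rw [lt_div_iff₀ hT0]
      calc _ ≤ 2 * (energyConst 0 * (2 * k) * (2 * k) ^ 2) * T := by gcongr
        _ ≤ 16 * (energyConst 0 + 1) * k * T * k ^ 2 := by nlinarith [show 0 < k ^ 3 * T by positivity]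
        _ ≤ 1 * k ^ 2 := by gcongr
        _ < 3 * k ^ 2 := by nlinarith [show 0 < k ^ 2 by positivity]) ht
  refine (abs_le_of_sq_le_sq' (b := 2 * k) (key.trans ?_) (by linarith)).2
  have : 3 * k ^ 2 / T * t ≤ 3 * k ^ 2 := by
    rw [div_mul_eq_mul_div, div_le_iff₀ hT0]
    gcongr
    exact ht.2
  linarith

lemma wtE_mono (N : ℕ) (ζ : Plane) : wtE N ζ ≤ wtE (N + 1) ζ := by
  refine ENNReal.ofReal_le_ofReal ?_
  unfold wtN
  have := wt_pos (ζ 0) (ζ 1)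
  gcongr
  · exact one_le_br _ _
  · omega

/-- Persistence of higher regularity, uniformly in the truncation. -/
lemma exists_wnorm_bound {k : ℝ} (hk : 0 < k) (hT0 : 0 < T)
    (hT : 16 * (energyConst 0 + 1) * k * T ≤ 1)
    (hg : l2 (fun ζ => wtE 0 ζ * ‖g ζ‖ₑ) ≤ ENNReal.ofReal k) (N : ℕ)
    (hN : l2 (fun ζ => wtE N ζ * ‖g ζ‖ₑ) < ∞) :
    ∃ C, 0 ≤ C ∧ ∀ n f, TruncSol n T g f → ∀ t ∈ Set.Icc 0 T, wnorm n N (f t) ≤ C := by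
  induction N with
  | zero => exact ⟨2 * k, by linarith, fun n f h t ht => h.wnorm_zero_le hk hT0 hT hg ht⟩
  | succ N ih =>
    obtain ⟨C, hC0, hC⟩ := ih (lt_of_le_of_lt
      (l2_mono (Filter.Eventually.of_forall fun ζ => by gcongr; exact wtE_mono N ζ)) hN)
    set A := energyConst (N + 1) with hA
    have hA0 : 0 ≤ A := energyConst_nonneg _
    set q := (l2 fun ζ => wtE (N + 1) ζ * ‖g ζ‖ₑ).toReal with hq
    -- With the norm of order N already bounded by C on the same interval, the inequality for order
    -- N + 1 is linear. The +1 in the rate only serves the requirement K ≥ 1.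
    refine ⟨√(q ^ 2 * Real.exp ((2 * (A * C) + 1) * T)), Real.sqrt_nonneg _, fun n f h t ht => ?_⟩
    refine Real.le_sqrt_of_sq_le ?_
    have h0 : wnorm n (N + 1) (f 0) ≤ q := by
      rw [h.init]
      have := ENNReal.toReal_mono hN.ne (ofReal_wnorm_truncOp_le n (N + 1) g)
      rwa [ENNReal.toReal_ofReal (wnorm_nonneg _ _ _)] at this
    have := le_exp_of_deriv_le (T := T) (K := 2 * (A * C) + 1) (ε := 0)
      (fun t ht => h.hasDerivWithinAt_wnorm (N + 1) ht)
      (by nlinarith [mul_nonneg hA0 hC0]) le_rfl (by positivity)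
      (fun t ht => by
        have h1 := (le_abs_self _).trans (energy_estimate (N + 1) (h.adm t ht))
        rw [Nat.add_sub_cancel] at h1
        have h2 : A * wnorm n N (f t) * wnorm n (N + 1) (f t) ^ 2 ≤
            A * C * wnorm n (N + 1) (f t) ^ 2 := by
          gcongr
          exact hC n f h t ht
        nlinarith [sq_nonneg (wnorm n (N + 1) (f t))]) ht
    rw [add_zero] at this
    refine this.trans ?_
    have := wnorm_nonneg n (N + 1) (f 0)
    gcongr

end Bounds

/-! ### Comparison of truncated solutions -/

lemma ae_coord_ne_zero : ∀ᵐ ζ : Plane, ζ 0 ≠ 0 := by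
  set L : Plane →ₗ[ℝ] ℝ := (EuclideanSpace.proj (0 : Fin 2) : Plane →L[ℝ] ℝ).toLinearMap
  have h : volume (LinearMap.ker L : Set Plane) = 0 := by
    refine Measure.addHaar_submodule _ _ fun htop => ?_
    have : EuclideanSpace.single (0 : Fin 2) (1 : ℝ) ∈ LinearMap.ker L := by rw [htop]; trivial
    simp [L] at this
  refine measure_mono_null (fun ζ hζ => ?_) h
  simpa [L] using hζ

lemma eventually_mem_freqSet {ζ : Plane} (h : ζ 0 ≠ 0) : ∀ᶠ n in Filter.atTop, ζ ∈ freqSet n := by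
  have hx : 0 < |ζ 0| := abs_pos.2 h
  have h1 : ∀ᶠ n : ℕ in Filter.atTop, |ζ 0|⁻¹ ≤ n := tendsto_natCast_atTop_atTop.eventually_ge_atTop _
  have h2 : ∀ᶠ n : ℕ in Filter.atTop, br (ζ 0) (ζ 1) ≤ n :=
    tendsto_natCast_atTop_atTop.eventually_ge_atTop _
  filter_upwards [h1, h2] with n h1 h2
  refine ⟨?_, by linarith⟩
  calc 1 = |ζ 0|⁻¹ * |ζ 0| := by field_simp
    _ ≤ (n + 1) * |ζ 0| := by gcongr; linarith

/-- The truncations converge strongly to the identity. -/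
lemma tendsto_truncOp_one (f : Spec) :
    Filter.Tendsto (fun n => truncOp n locBdd_one f) Filter.atTop (nhds f) := by
  rw [tendsto_iff_edist_tendsto_0]
  have e : ∀ n, edist (truncOp n locBdd_one f) f =
      (∫⁻ ζ, (‖chi n ζ - 1‖ₑ * ‖f ζ‖ₑ) ^ (2 : ℝ)) ^ (1 / 2 : ℝ) := by
    intro n
    rw [edist_eq_enorm_sub, ← l2_spec]
    refine l2_congr ?_
    filter_upwards [truncOp_coe n locBdd_one f, Lp.coeFn_sub (truncOp n locBdd_one f) f]
      with ζ h1 h2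
    rw [h2, Pi.sub_apply, h1, ← enorm_mul]
    ring_nf
  simp_rw [e]
  have h0 : (0 : ℝ≥0∞) = 0 ^ (1 / 2 : ℝ) := by rw [ENNReal.zero_rpow_of_pos (by norm_num)]
  rw [h0]
  refine ((ENNReal.continuous_rpow_const).tendsto 0).comp ?_
  have := tendsto_lintegral_of_dominated_convergence (μ := volume)
    (F := fun n (ζ : Plane) => (‖chi n ζ - 1‖ₑ * ‖f ζ‖ₑ) ^ (2 : ℝ)) (f := fun _ => 0)
    (fun ζ => ‖f ζ‖ₑ ^ (2 : ℝ)) (fun n => by fun_prop)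
    (fun n => Filter.Eventually.of_forall fun ζ => by
      refine ENNReal.rpow_le_rpow ?_ (by norm_num)
      by_cases h : ζ ∈ freqSet n
      · simp [chi_of_mem h]
      · simp [chi_of_notMem h])
    (by
      have h2 : l2 (fun ζ => ‖f ζ‖ₑ) ^ 2 < ∞ := by rw [l2_spec]; finiteness
      rw [l2_sq] at h2
      simp only [ENNReal.rpow_two]
      exact h2.ne)
    (by
      filter_upwards [ae_coord_ne_zero] with ζ hζ
      refine tendsto_const_nhds.congr' ?_
      filter_upwards [eventually_mem_freqSet hζ] with n hn
      simp [chi_of_mem hn])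
  simpa using this

lemma inner_truncOp_lam (n : ℕ) (f : Spec) : inner ℝ f (truncOp n locBdd_lam f) = 0 := by
  rw [real_inner_eq]
  have hcj : conj (∫ z, conj (f z) * truncOp n locBdd_lam f z) =
      - ∫ z, conj (f z) * truncOp n locBdd_lam f z := by
    rw [← integral_conj, ← integral_neg]
    refine integral_congr_ae ?_
    filter_upwards [truncOp_coe n locBdd_lam f] with z hz
    simp only [hz, map_mul, conj_chi, conj_lam, Complex.conj_conj]
    ring
  have := congrArg Complex.re hcj
  rw [Complex.conj_re, Complex.neg_re] at this
  linarith

/-- Fourier form of ∫ d (s d)_x = ½ ∫ s_x d²: exchanging the two copies of d leaves ξ at the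
frequency of s alone. The derivative of s is measured by the L¹ norm of its weighted transform, and
d needs no derivative. -/
lemma enorm_inner_nonlin_le {n : ℕ} {d s : Spec} (hd : Adm n d) :
    2 * ‖inner ℝ d (nonlin n s d)‖ₑ ≤
      ENNReal.ofReal Real.pi * ((∫⁻ ζ, brE 1 ζ * ‖s ζ‖ₑ) * (‖d‖ₑ * ‖d‖ₑ)) := by
  have h1 : ‖inner ℝ d (nonlin n s d)‖ₑ ≤
      ‖∫ z, conj (d z) * ((chi n z * sig z) * conv s d z)‖ₑ := by
    rw [real_inner_eq, ← ofReal_norm, ← ofReal_norm, Real.norm_eq_abs]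
    refine ENNReal.ofReal_le_ofReal ((Complex.abs_re_le_norm _).trans (le_of_eq ?_))
    congr 1
    refine integral_congr_ae ?_
    filter_upwards [nonlin_coe n s d] with z hz
    rw [hz]
  have h2 := pairing_antisymm_le (locBdd_sig.bddMeas n).1 (locBdd_sig.memLp n) d s hd.herm
  refine (mul_le_mul_right h1 2).trans (h2.trans ?_)
  have h3 := tri_le (a := fun ζ => brE 1 ζ * ‖s ζ‖ₑ) (b := fun ζ => ‖d ζ‖ₑ)
    (c := fun ζ => ‖d ζ‖ₑ) (by fun_prop) (by fun_prop) (by fun_prop)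
  rw [tri_swap_left (by fun_prop) (by fun_prop) (by fun_prop), l2_spec] at h3
  refine le_trans ?_ (mul_le_mul_right h3 _)
  unfold tri
  rw [← lintegral_const_mul' _ _ ENNReal.ofReal_ne_top]
  refine lintegral_mono_ae ?_
  filter_upwards [hd.supp] with x hx
  rw [← lintegral_const_mul' _ _ ENNReal.ofReal_ne_top]
  refine lintegral_mono_ae ?_
  filter_upwards [ae_supp_neg_add hd.supp x] with y hz
  rw [enorm_mul, enorm_mul, enorm_mul]
  by_cases h1 : x ∈ freqSet n
  · by_cases h3 : -(x + y) ∈ freqSet n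
    · have h3' : x + y ∈ freqSet n := by rwa [← neg_mem_freqSet]
      have e : chi n (-x) * sig (-x) + chi n (x + y) * sig (x + y) =
          -(Real.pi * Complex.I * (y 0 : ℝ)) := by
        rw [chi_neg, chi_of_mem h1, chi_of_mem h3', sig_neg', sig]
        push_cast [PiLp.add_apply]
        ring
      have e2 : ‖chi n (-x) * sig (-x) + chi n (x + y) * sig (x + y)‖ₑ ≤
          ENNReal.ofReal Real.pi * brE 1 y := by
        have hpi := Real.pi_pos
        rw [e, ← ofReal_norm, brE, ← ENNReal.ofReal_mul hpi.le]
        refine ENNReal.ofReal_le_ofReal ?_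
        simp only [norm_neg, norm_mul, Complex.norm_real, Complex.norm_I, Real.norm_eq_abs,
          abs_of_pos hpi, mul_one, pow_one]
        gcongr
        exact abs_le_br_left _ _
      calc _ ≤ (ENNReal.ofReal Real.pi * brE 1 y) * (‖d x‖ₑ * (‖s y‖ₑ * ‖d (-(x + y))‖ₑ)) := by
            gcongr
        _ = _ := by ring
    · rw [hz h3]; simp
  · simp [hx h1]

lemma brSq_add_le (x₁ y₁ x₂ y₂ : ℝ) :
    brSq (x₁ + x₂) (y₁ + y₂) ≤ 2 * brSq x₁ y₁ + 2 * brSq x₂ y₂ := by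
  unfold brSq
  nlinarith [sq_nonneg (x₁ - x₂), sq_nonneg (y₁ - y₂)]

lemma brE_two_le (z y : Plane) : brE 2 z ≤ 2 * brE 2 y + 2 * brE 2 (z - y) := by
  have h : ∀ a b c : ℝ, 0 ≤ b → 0 ≤ c → a ≤ 2 * b + 2 * c →
      ENNReal.ofReal a ≤ 2 * ENNReal.ofReal b + 2 * ENNReal.ofReal c := by
    intro a b c hb hc h
    refine (ENNReal.ofReal_le_ofReal h).trans_eq ?_
    rw [ENNReal.ofReal_add (by positivity) (by positivity), ENNReal.ofReal_mul zero_le_two,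
      ENNReal.ofReal_mul zero_le_two, ENNReal.ofReal_ofNat]
  refine h _ _ _ (by positivity) (by positivity) ?_
  have := brSq_add_le (y 0) (y 1) ((z - y) 0) ((z - y) 1)
  simpa [br_sq] using this

lemma brE_two_le_wtE (ζ : Plane) : brE 2 ζ ≤ 4 * wtE 0 ζ := by
  unfold brE wtE
  rw [show (4 : ℝ≥0∞) = ENNReal.ofReal 4 by norm_num, ← ENNReal.ofReal_mul (by norm_num)]
  refine ENNReal.ofReal_le_ofReal ?_
  simpa [br_sq, wtN] using brSq_le_wt (ζ 0) (ζ 1)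

lemma one_le_brE (ζ : Plane) (N : ℕ) : 1 ≤ brE N ζ := by
  unfold brE
  rw [← ENNReal.ofReal_one]
  exact ENNReal.ofReal_le_ofReal (one_le_pow₀ (one_le_br _ _))

lemma one_le_wtE (ζ : Plane) (N : ℕ) : 1 ≤ wtE N ζ := by
  unfold wtE
  rw [← ENNReal.ofReal_one]
  exact ENNReal.ofReal_le_ofReal
    (one_le_mul_of_one_le_of_one_le (one_le_pow₀ (one_le_br _ _)) (one_le_wt _ _))

lemma lintegral_enorm_le (f : Spec) :
    ∫⁻ ζ, ‖f ζ‖ₑ ≤ ratioConst * l2 fun ζ => wtE 0 ζ * ‖f ζ‖ₑ := by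
  refine le_trans (lintegral_mono fun ζ => ?_) (lintegral_low_le 0 (a := fun ζ => ‖f ζ‖ₑ)
    (by fun_prop))
  exact le_mul_of_one_le_left' (one_le_brE _ _)

/-- The convolution of functions with finite base norm has two derivatives. -/
lemma l2_brE_conv_le (f : Spec) :
    l2 (fun z => brE 2 z * ∫⁻ y, ‖f y‖ₑ * ‖f (z - y)‖ₑ) ≤
      16 * ratioConst * (l2 fun ζ => wtE 0 ζ * ‖f ζ‖ₑ) ^ 2 := by
  set a : Plane → ℝ≥0∞ := fun ζ => ‖f ζ‖ₑ with ha
  set c : Plane → ℝ≥0∞ := fun ζ => brE 2 ζ * ‖f ζ‖ₑ with hc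
  have ma : Measurable a := by fun_prop
  have mc : Measurable c := by fun_prop
  set Q := l2 fun ζ => wtE 0 ζ * ‖f ζ‖ₑ with hQ
  have hsymm : ∀ z, ∫⁻ y, c y * a (z - y) = ∫⁻ y, a y * c (z - y) := by
    intro z
    rw [← lintegral_sub_left_eq_self (fun y => c y * a (z - y)) z]
    congr! 2 with y
    rw [sub_sub_cancel, mul_comm]
  -- The two derivatives are distributed onto one factor or the other, and the two resulting
  -- integrals agree by symmetry.
  have h1 : ∀ z, brE 2 z * ∫⁻ y, a y * a (z - y) ≤ 4 * ∫⁻ y, a y * c (z - y) := by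
    intro z
    rw [← lintegral_const_mul _ (by fun_prop)]
    calc _ ≤ ∫⁻ y, (2 * (c y * a (z - y)) + 2 * (a y * c (z - y))) := by
          refine lintegral_mono fun y => ?_
          calc _ ≤ (2 * brE 2 y + 2 * brE 2 (z - y)) * (a y * a (z - y)) := by
                gcongr; exact brE_two_le z y
            _ = _ := by simp only [ha, hc]; ring
      _ = _ := by
          rw [lintegral_add_left (by fun_prop), lintegral_const_mul _ (by fun_prop),
            lintegral_const_mul _ (by fun_prop), hsymm, ← add_mul]
          norm_num
  have h2 : l2 c ≤ 4 * Q := by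
    rw [hQ, ← l2_const_mul 4 (by norm_num)]
    refine l2_mono (Filter.Eventually.of_forall fun ζ => ?_)
    rw [← mul_assoc]
    exact mul_le_mul_left (brE_two_le_wtE ζ) _
  calc _ ≤ l2 (fun z => 4 * ∫⁻ y, a y * c (z - y)) :=
        l2_mono (Filter.Eventually.of_forall h1)
    _ = 4 * l2 (fun z => ∫⁻ y, a y * c (z - y)) := l2_const_mul 4 (by norm_num) _
    _ ≤ 4 * ((ratioConst * Q) * (4 * Q)) := by
        gcongr
        refine (l2_conv_le ma mc).trans ?_
        gcongr
        exact lintegral_enorm_le f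
    _ = _ := by ring

/-- Outside the region either |ξ| < 1/(n+1) or the bracket exceeds n+1, and in both cases two
brackets buy the rate 1/(n+1). Those two derivatives are available on f * f by `l2_brE_conv_le`. -/
lemma abs_mul_le_of_notMem {n : ℕ} {ζ : Plane} (h : ζ ∉ freqSet n) :
    (n + 1) * |ζ 0| ≤ br (ζ 0) (ζ 1) ^ 2 := by
  have h1 := one_le_br (ζ 0) (ζ 1)
  by_cases h2 : 1 ≤ (n + 1) * |ζ 0|
  · have h3 : (n + 1 : ℝ) < br (ζ 0) (ζ 1) := by
      by_contra h4
      exact h ⟨h2, not_lt.1 h4⟩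
    have := abs_le_br_left (ζ 0) (ζ 1)
    rw [sq]
    gcongr
  · nlinarith

/-- The truncation error of the nonlinearity. -/
lemma norm_nonlin_sub_le {n m : ℕ} (hnm : n ≤ m) (f : Spec) :
    ENNReal.ofReal (n + 1) * ‖nonlin n f f - nonlin m f f‖ₑ ≤
      ENNReal.ofReal Real.pi * (16 * ratioConst * (l2 fun ζ => wtE 0 ζ * ‖f ζ‖ₑ) ^ 2) := by
  refine le_trans ?_ (mul_le_mul_right (l2_brE_conv_le f) _)
  rw [← l2_spec, ← l2_const_mul _ ENNReal.ofReal_ne_top, ← l2_const_mul _ ENNReal.ofReal_ne_top]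
  refine l2_mono ?_
  have hpi := Real.pi_pos
  filter_upwards [Lp.coeFn_sub (nonlin n f f) (nonlin m f f), nonlin_coe n f f, nonlin_coe m f f]
    with z h1 h2 h3
  rw [h1, Pi.sub_apply, h2, h3, ← sub_mul, enorm_mul, ← mul_assoc, ← mul_assoc]
  refine mul_le_mul' ?_ (enorm_conv_le_lintegral f f z)
  by_cases hz : z ∈ freqSet n
  · rw [chi_of_mem hz, chi_of_mem (freqSet_mono hnm hz)]; simp
  · have hs : ‖chi n z * sig z - chi m z * sig z‖ ≤ Real.pi * |z 0| := by
      rw [chi_of_notMem hz, zero_mul, zero_sub, norm_neg, norm_mul, norm_sig]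
      by_cases hz' : z ∈ freqSet m
      · rw [chi_of_mem hz']; simp
      · rw [chi_of_notMem hz', norm_zero, zero_mul]; positivity
    rw [← ofReal_norm, brE, ← ENNReal.ofReal_mul (by positivity), ← ENNReal.ofReal_mul hpi.le]
    refine ENNReal.ofReal_le_ofReal ?_
    calc _ ≤ (n + 1) * (Real.pi * |z 0|) := by gcongr
      _ = Real.pi * ((n + 1) * |z 0|) := by ring
      _ ≤ _ := by gcongr; exact abs_mul_le_of_notMem hz

lemma nonlin_comm (n : ℕ) (f g : Spec) : nonlin n f g = nonlin n g f := by
  refine Lp.ext ?_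
  filter_upwards [nonlin_coe n f g, nonlin_coe n g f] with z h1 h2
  rw [h1, h2, conv_comm]

lemma Adm.mono {n m : ℕ} (hnm : n ≤ m) {f : Spec} (h : Adm n f) : Adm m f :=
  ⟨h.herm, h.supp.mono fun _ hζ hn => hζ fun hm => hn (freqSet_mono hnm hm)⟩

lemma Adm.sub {n : ℕ} {f g : Spec} (hf : Adm n f) (hg : Adm n g) : Adm n (f - g) := by
  rw [adm_iff] at *
  rw [map_sub, map_sub, hf.1, hf.2, hg.1, hg.2]
  exact ⟨rfl, rfl⟩

lemma truncOp_eq_of_le {n m : ℕ} (hnm : n ≤ m) {f : Spec} (hf : Adm n f) {s : Plane → ℂ}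
    (hs : LocBdd s) : truncOp n hs f = truncOp m hs f := by
  refine Lp.ext ?_
  filter_upwards [truncOp_coe n hs f, truncOp_coe m hs f, hf.supp] with ζ h1 h2 h3
  rw [h1, h2]
  by_cases h : ζ ∈ freqSet n
  · rw [chi_of_mem h, chi_of_mem (freqSet_mono hnm h)]
  · rw [h3 h, mul_zero, mul_zero]

lemma norm_le_wnorm {n : ℕ} {f : Spec} (hf : Adm n f) (N : ℕ) : ‖f‖ ≤ wnorm n N f := by
  refine (ENNReal.ofReal_le_ofReal_iff (wnorm_nonneg _ _ _)).1 ?_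
  rw [ofReal_wnorm N hf.supp, ofReal_norm, ← l2_spec]
  exact l2_mono (Filter.Eventually.of_forall fun ζ => le_mul_of_one_le_left' (one_le_wtE _ _))

lemma bilin_add_sub {E : Type*} [NormedAddCommGroup E] [NormedSpace ℂ E] (L : E →L[ℂ] E →L[ℂ] E)
    {f g : E} (h : L g f = L f g) : L (f + g) (f - g) = L f f - L g g := by
  simp only [map_add, map_sub, add_apply]
  rw [h]
  abel

lemma add_sub_add_eq {E : Type*} [AddCommGroup E] (a b x y z : E) :
    a + x - (b + z) = a - b + (y - z) + (x - y) := by abel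

/-- Symmetry of the bilinear part gives N(f,f) - N(g,g) = N(f+g, f-g). The difference thus obeys a
linear equation at the larger truncation m, up to the truncation error at f. -/
lemma field_sub_field {n m : ℕ} (hnm : n ≤ m) {f : Spec} (g : Spec) (hf : Adm n f) :
    field n f - field m g = truncOp m locBdd_lam (f - g) + nonlin m (f + g) (f - g) +
      (nonlin n f f - nonlin m f f) := by
  have h1 : nonlin m (f + g) (f - g) = nonlin m f f - nonlin m g g :=
    bilin_add_sub (E := Spec) (nonlin m) (nonlin_comm m g f)
  have h2 : truncOp m locBdd_lam (f - g) = truncOp n locBdd_lam f - truncOp m locBdd_lam g := by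
    rw [truncOp_eq_of_le hnm hf]
    exact map_sub (truncOp m locBdd_lam) f g
  refine Eq.trans ?_ (congrArg₂ (fun a b => a + b + (nonlin n f f - nonlin m f f)) h2.symm h1.symm)
  exact add_sub_add_eq (E := Spec) _ _ _ _ _

lemma two_mul_le_of_enorm {x b : ℝ} (hb : 0 ≤ b) (h : 2 * ‖x‖ₑ ≤ ENNReal.ofReal b) :
    2 * x ≤ b := by
  rw [← ofReal_norm, ← ENNReal.ofReal_ofNat, ← ENNReal.ofReal_mul zero_le_two,
    ENNReal.ofReal_le_ofReal_iff hb] at h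
  linarith [Real.le_norm_self x]

lemma l2_add_spec_le {f g : Spec} {B : ℝ}
    (hf : l2 (fun ζ => wtE 0 ζ * ‖f ζ‖ₑ) ≤ ENNReal.ofReal B)
    (hg : l2 (fun ζ => wtE 0 ζ * ‖g ζ‖ₑ) ≤ ENNReal.ofReal B) :
    l2 (fun ζ => wtE 0 ζ * ‖(f + g : Spec) ζ‖ₑ) ≤ ENNReal.ofReal B + ENNReal.ofReal B := by
  refine le_trans (l2_mono (b := fun ζ => wtE 0 ζ * ‖f ζ‖ₑ + wtE 0 ζ * ‖g ζ‖ₑ) ?_)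
    ((l2_add_le (by fun_prop) (by fun_prop)).trans (add_le_add hf hg))
  filter_upwards [Lp.coeFn_add f g] with ζ hζ
  rw [hζ, Pi.add_apply, ← mul_add]
  gcongr
  exact enorm_add_le _ _

lemma inner_nonlin_sub_le {m : ℕ} {f s : Spec} (hd : Adm m f) {B : ℝ} (hB : 0 ≤ B)
    (hs : l2 (fun ζ => wtE 0 ζ * ‖s ζ‖ₑ) ≤ ENNReal.ofReal B + ENNReal.ofReal B) :
    inner ℝ f (nonlin m s f) ≤ Real.pi * ratioConst.toReal * B * ‖f‖ ^ 2 := by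
  have hpi := Real.pi_pos
  have hr : ratioConst = ENNReal.ofReal ratioConst.toReal :=
    (ENNReal.ofReal_toReal ratioConst_lt_top.ne).symm
  have hs' : ∫⁻ ζ, brE 1 ζ * ‖s ζ‖ₑ ≤ ENNReal.ofReal (ratioConst.toReal * (2 * B)) := by
    calc _ ≤ ratioConst * l2 (fun ζ => wtE 0 ζ * ‖s ζ‖ₑ) := lintegral_low_le 0 (by fun_prop)
      _ ≤ ratioConst * (ENNReal.ofReal B + ENNReal.ofReal B) := by gcongr
      _ = _ := by
          rw [ENNReal.ofReal_mul ENNReal.toReal_nonneg, ← hr, two_mul, ENNReal.ofReal_add hB hB]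
  have h := two_mul_le_of_enorm
    (b := Real.pi * (ratioConst.toReal * (2 * B) * (‖f‖ * ‖f‖))) (by positivity)
    ((enorm_inner_nonlin_le (s := s) hd).trans (by
      rw [ENNReal.ofReal_mul hpi.le, ENNReal.ofReal_mul (by positivity),
        ENNReal.ofReal_mul (norm_nonneg _), ofReal_norm]
      gcongr))
  nlinarith

lemma norm_nonlin_sub_le_div {n m : ℕ} (hnm : n ≤ m) {f : Spec} {B : ℝ} (hB : 0 ≤ B)
    (hf : l2 (fun ζ => wtE 0 ζ * ‖f ζ‖ₑ) ≤ ENNReal.ofReal B) :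
    ‖nonlin n f f - nonlin m f f‖ ≤ 16 * Real.pi * ratioConst.toReal * B ^ 2 / (n + 1) := by
  have hpi := Real.pi_pos
  have hr : ratioConst = ENNReal.ofReal ratioConst.toReal :=
    (ENNReal.ofReal_toReal ratioConst_lt_top.ne).symm
  have h := (norm_nonlin_sub_le hnm f).trans
    (b := ENNReal.ofReal Real.pi * (16 * ratioConst * l2 (fun ζ => wtE 0 ζ * ‖f ζ‖ₑ) ^ 2))
    (c := ENNReal.ofReal (Real.pi * (16 * ratioConst.toReal * B ^ 2))) (by
      rw [ENNReal.ofReal_mul hpi.le, ENNReal.ofReal_mul (by positivity),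
        ENNReal.ofReal_mul (by norm_num), ENNReal.ofReal_pow hB, ← hr, ENNReal.ofReal_ofNat]
      gcongr)
  rw [← ofReal_norm, ← ENNReal.ofReal_mul (by positivity),
    ENNReal.ofReal_le_ofReal_iff (by positivity)] at h
  rw [le_div_iff₀ (by positivity)]
  linarith

/-- The linear part is skew, the bilinear part is controlled after integration by parts, and the
truncation error is paired with ‖f - g‖ ≤ 2B, whence 32 = 2 · 16. -/
lemma inner_field_sub_le {n m : ℕ} (hnm : n ≤ m) {f g : Spec} (hf : Adm n f) (hg : Adm m g)
    {B : ℝ} (hfB : wnorm n 0 f ≤ B) (hgB : wnorm m 0 g ≤ B) :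
    inner ℝ (f - g) (field n f - field m g) ≤
      Real.pi * ratioConst.toReal * B * ‖f - g‖ ^ 2 +
        32 * Real.pi * ratioConst.toReal * B ^ 3 / (n + 1) := by
  have hd : Adm m (f - g) := (hf.mono hnm).sub hg
  have hB : 0 ≤ B := (wnorm_nonneg _ _ _).trans hfB
  have hfl : l2 (fun ζ => wtE 0 ζ * ‖f ζ‖ₑ) ≤ ENNReal.ofReal B := by
    rw [← ofReal_wnorm 0 hf.supp]; exact ENNReal.ofReal_le_ofReal hfB
  have hgl : l2 (fun ζ => wtE 0 ζ * ‖g ζ‖ₑ) ≤ ENNReal.ofReal B := by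
    rw [← ofReal_wnorm 0 hg.supp]; exact ENNReal.ofReal_le_ofReal hgB
  have h1 := inner_nonlin_sub_le hd hB (l2_add_spec_le hfl hgl)
  have h2 : inner ℝ (f - g) (nonlin n f f - nonlin m f f) ≤
      32 * Real.pi * ratioConst.toReal * B ^ 3 / (n + 1) := by
    have hnorm : ‖f - g‖ ≤ 2 * B := by
      have := norm_sub_le f g
      linarith [norm_le_wnorm hf 0, norm_le_wnorm hg 0]
    calc _ ≤ ‖f - g‖ * ‖nonlin n f f - nonlin m f f‖ := real_inner_le_norm _ _
      _ ≤ (2 * B) * (16 * Real.pi * ratioConst.toReal * B ^ 2 / (n + 1)) :=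
          mul_le_mul hnorm (norm_nonlin_sub_le_div hnm hB hfl) (norm_nonneg _) (by positivity)
      _ = _ := by ring
  rw [field_sub_field hnm g hf, inner_add_right, inner_add_right, inner_truncOp_lam, zero_add]
  exact add_le_add h1 h2

/-- Two truncated solutions with the same initial value are close. -/
lemma TruncSol.norm_sub_sq_le {n m : ℕ} (hnm : n ≤ m) {T B : ℝ} {g : Spec} {f f' : ℝ → Spec}
    (h : TruncSol n T g f) (h' : TruncSol m T g f')
    (hB : ∀ t ∈ Set.Icc 0 T, wnorm n 0 (f t) ≤ B) (hB' : ∀ t ∈ Set.Icc 0 T, wnorm m 0 (f' t) ≤ B)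
    {t : ℝ} (ht : t ∈ Set.Icc 0 T) :
    ‖f t - f' t‖ ^ 2 ≤ (‖truncOp n locBdd_one g - truncOp m locBdd_one g‖ ^ 2 +
      2 * (32 * Real.pi * ratioConst.toReal * B ^ 3 / (n + 1))) *
        Real.exp ((2 * (Real.pi * ratioConst.toReal * B) + 1) * T) := by
  have hB0 : 0 ≤ B := (wnorm_nonneg _ _ _).trans (hB t ht)
  have hpi := Real.pi_pos
  have := le_exp_of_deriv_le (T := T) (K := 2 * (Real.pi * ratioConst.toReal * B) + 1)
    (ε := 2 * (32 * Real.pi * ratioConst.toReal * B ^ 3 / (n + 1)))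
    (y := fun t => ‖f t - f' t‖ ^ 2)
    (fun t ht => ((h.deriv t ht).sub (h'.deriv t ht)).norm_sq)
    (by have : 0 ≤ Real.pi * ratioConst.toReal * B := by positivity
        linarith) (by positivity) (by positivity)
    (fun t ht => by
      have := inner_field_sub_le hnm (h.adm t ht) (h'.adm t ht) (hB t ht) (hB' t ht)
      have h0 := sq_nonneg ‖f t - f' t‖
      change 2 * inner ℝ (f t - f' t) (field n (f t) - field m (f' t)) ≤
        (2 * (Real.pi * ratioConst.toReal * B) + 1) * ‖f t - f' t‖ ^ 2 + _
      nlinarith) ht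
  rwa [h.init, h'.init] at this

/-! ### The limit of the truncated solutions -/

/-- Weighted bounds pass to strong limits. -/
lemma l2_le_of_tendsto {F : ℕ → Spec} {f : Spec} (h : Filter.Tendsto F Filter.atTop (nhds f))
    (N : ℕ) {C : ℝ≥0∞} (hC : ∀ n, l2 (fun ζ => wtE N ζ * ‖F n ζ‖ₑ) ≤ C) :
    l2 (fun ζ => wtE N ζ * ‖f ζ‖ₑ) ≤ C := by
  -- Strong convergence gives almost everywhere convergence along a subsequence, and Fatou's lemma
  -- then applies to the weighted squares.
  obtain ⟨ns, -, hns⟩ := (tendstoInMeasure_of_tendsto_Lp h).exists_seq_tendsto_ae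
  have h1 : ∀ n, ∫⁻ ζ, (wtE N ζ * ‖F (ns n) ζ‖ₑ) ^ 2 ≤ C ^ 2 := fun n => by
    rw [← l2_sq]
    gcongr
    exact hC _
  have h2 : ∫⁻ ζ, (wtE N ζ * ‖f ζ‖ₑ) ^ 2 ≤ C ^ 2 := by
    calc _ = ∫⁻ ζ, Filter.liminf (fun n => (wtE N ζ * ‖F (ns n) ζ‖ₑ) ^ 2) Filter.atTop := by
          refine lintegral_congr_ae ?_
          filter_upwards [hns] with ζ hζ
          refine (Filter.Tendsto.liminf_eq ?_).symm
          exact ((ENNReal.continuous_pow 2).tendsto _).comp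
            (ENNReal.Tendsto.const_mul ((continuous_enorm.tendsto _).comp hζ)
              (Or.inr ENNReal.ofReal_ne_top))
      _ ≤ Filter.liminf (fun n => ∫⁻ ζ, (wtE N ζ * ‖F (ns n) ζ‖ₑ) ^ 2) Filter.atTop :=
          lintegral_liminf_le fun n => by fun_prop
      _ ≤ C ^ 2 := Filter.liminf_le_of_le (by isBoundedDefault) fun b hb => by
          obtain ⟨n, hn⟩ := hb.exists
          exact hn.trans (h1 n)
  rw [← l2_sq] at h2
  exact (ENNReal.pow_le_pow_left_iff two_ne_zero).1 h2

lemma norm_truncOp_one_sub_le {n m : ℕ} (hnm : n ≤ m) (g : Spec) :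
    ‖truncOp n locBdd_one g - truncOp m locBdd_one g‖ ≤ ‖truncOp n locBdd_one g - g‖ := by
  refine Lp.norm_le_norm_of_ae_le ?_
  filter_upwards [truncOp_coe n locBdd_one g, truncOp_coe m locBdd_one g,
    Lp.coeFn_sub (truncOp n locBdd_one g) g,
    Lp.coeFn_sub (truncOp n locBdd_one g) (truncOp m locBdd_one g)] with ζ h1 h2 h3 h4
  rw [h4, h3, Pi.sub_apply, Pi.sub_apply, h1, h2]
  by_cases hn : ζ ∈ freqSet n
  · rw [chi_of_mem hn, chi_of_mem (freqSet_mono hnm hn)]; simp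
  · rw [chi_of_notMem hn]
    by_cases hm : ζ ∈ freqSet m
    · simp [chi_of_mem hm]
    · simp [chi_of_notMem hm]

lemma norm_truncOp_one_le (n : ℕ) (g : Spec) : ‖truncOp n locBdd_one g‖ ≤ ‖g‖ := by
  refine Lp.norm_le_norm_of_ae_le ?_
  filter_upwards [truncOp_one_enorm_le n g] with ζ hζ
  exact enorm_le_iff_norm_le.1 hζ

lemma truncOp_one_truncOp {j n : ℕ} (h : j ≤ n) {m : Plane → ℂ} (hm : LocBdd m) (f : Spec) :
    truncOp j locBdd_one (truncOp n hm f) = truncOp j hm f := by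
  refine Lp.ext ?_
  filter_upwards [truncOp_coe j locBdd_one (truncOp n hm f), truncOp_coe n hm f,
    truncOp_coe j hm f] with ζ h1 h2 h3
  rw [h1, h2, h3]
  by_cases hj : ζ ∈ freqSet j
  · rw [chi_of_mem hj, chi_of_mem (freqSet_mono h hj)]; simp
  · simp [chi_of_notMem hj]

/-- Only the outer cutoff depends on n, so restricting the field to a smaller region gives the same
expression for all n ≥ j. This is what permits n → ∞ with j fixed. -/
lemma truncOp_one_field {j n : ℕ} (h : j ≤ n) (f : Spec) :
    truncOp j locBdd_one (field n f) = field j f := by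
  refine Lp.ext ?_
  filter_upwards [truncOp_coe j locBdd_one (field n f), truncOp_coe n locBdd_lam f,
    truncOp_coe j locBdd_lam f, nonlin_coe n f f, nonlin_coe j f f,
    Lp.coeFn_add (truncOp n locBdd_lam f) (nonlin n f f),
    Lp.coeFn_add (truncOp j locBdd_lam f) (nonlin j f f)] with ζ h1 h2 h3 h4 h5 h6 h7
  rw [h1, field, field, h6, h7, Pi.add_apply, Pi.add_apply, h2, h3, h4, h5]
  by_cases hj : ζ ∈ freqSet j
  · rw [chi_of_mem hj, chi_of_mem (freqSet_mono h hj)]; simp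
  · simp [chi_of_notMem hj]

lemma continuous_field (n : ℕ) : Continuous (field n) := by
  unfold field
  fun_prop

/-- The right-hand side of the equation on the frequency side. -/
noncomputable def rhsFun (f : Spec) (ζ : Plane) : ℂ := lam ζ * f ζ + sig ζ * conv f f ζ

lemma measurable_rhsFun (f : Spec) : Measurable (rhsFun f) := by
  have := measurable_conv (measurable_spec f) (measurable_spec f)
  unfold rhsFun
  fun_prop

open Classical in
/-- The right-hand side of the equation as a square integrable function. -/
noncomputable def rhs (f : Spec) : Spec :=
  -- The value 0 is a default: for f of finite base norm the first branch applies, by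
  -- `memLp_rhsFun`.
  if h : MemLp (rhsFun f) 2 volume then h.toLp else 0

/-- The bound for the right-hand side on the ball of radius `B`. -/
noncomputable def rhsConst (B : ℝ≥0∞) : ℝ≥0∞ :=
  ENNReal.ofReal (8 * Real.pi ^ 3 + 10 * Real.pi) * B +
    ENNReal.ofReal Real.pi * (16 * ratioConst * B ^ 2)

lemma rhsConst_lt_top {B : ℝ≥0∞} (hB : B < ∞) : rhsConst B < ∞ := by
  have := ratioConst_lt_top
  unfold rhsConst
  exact ENNReal.add_lt_top.2 ⟨ENNReal.mul_lt_top ENNReal.ofReal_lt_top hB,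
    ENNReal.mul_lt_top ENNReal.ofReal_lt_top (ENNReal.mul_lt_top
      (ENNReal.mul_lt_top (by simp) this) (ENNReal.pow_lt_top hB))⟩

lemma l2_abs_mul_conv_le (f : Spec) :
    l2 (fun ζ => ENNReal.ofReal |ζ 0| * ‖conv f f ζ‖ₑ) ≤
      16 * ratioConst * (l2 fun ζ => wtE 0 ζ * ‖f ζ‖ₑ) ^ 2 := by
  refine le_trans (l2_mono (Filter.Eventually.of_forall fun ζ => ?_)) (l2_brE_conv_le f)
  refine mul_le_mul' (ENNReal.ofReal_le_ofReal ?_) (enorm_conv_le_lintegral f f ζ)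
  exact (abs_le_br_left _ _).trans (le_self_pow₀ (one_le_br _ _) two_ne_zero)

lemma l2_rhsFun_le (f : Spec) :
    l2 (fun ζ => ‖rhsFun f ζ‖ₑ) ≤ rhsConst (l2 fun ζ => wtE 0 ζ * ‖f ζ‖ₑ) := by
  have mc := measurable_conv (measurable_spec f) (measurable_spec f)
  have hpi := Real.pi_pos
  calc l2 (fun ζ => ‖rhsFun f ζ‖ₑ)
      ≤ l2 (fun ζ => ENNReal.ofReal (8 * Real.pi ^ 3 + 10 * Real.pi) * (wtE 0 ζ * ‖f ζ‖ₑ) +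
        ENNReal.ofReal Real.pi * (ENNReal.ofReal |ζ 0| * ‖conv f f ζ‖ₑ)) := by
        refine l2_mono (Filter.Eventually.of_forall fun ζ => (enorm_add_le _ _).trans ?_)
        rw [enorm_mul, enorm_mul, ← mul_assoc, ← mul_assoc]
        gcongr
        · rw [← ofReal_norm, wtE, ← ENNReal.ofReal_mul (by positivity)]
          refine ENNReal.ofReal_le_ofReal ?_
          simpa [wtN] using norm_lam_le ζ
        · rw [← ofReal_norm, ← ENNReal.ofReal_mul hpi.le, norm_sig]
    _ ≤ _ := by
        refine (l2_add_le (by fun_prop) (by fun_prop)).trans ?_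
        rw [l2_const_mul _ ENNReal.ofReal_ne_top, l2_const_mul _ ENNReal.ofReal_ne_top, rhsConst]
        gcongr
        exact l2_abs_mul_conv_le f

section FiniteNorm

/-! ### The right-hand side at functions of finite base norm. -/

variable {f : Spec}

lemma memLp_rhsFun (hf : l2 (fun ζ => wtE 0 ζ * ‖f ζ‖ₑ) < ∞) : MemLp (rhsFun f) 2 volume := by
  refine ⟨(measurable_rhsFun f).aestronglyMeasurable, ?_⟩
  rw [← l2_enorm_eq]
  exact (l2_rhsFun_le f).trans_lt (rhsConst_lt_top hf)

lemma rhs_coe (hf : l2 (fun ζ => wtE 0 ζ * ‖f ζ‖ₑ) < ∞) : ∀ᵐ ζ, rhs f ζ = rhsFun f ζ := by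
  rw [rhs, dif_pos (memLp_rhsFun hf)]
  exact (memLp_rhsFun hf).coeFn_toLp

lemma norm_rhs_le {B : ℝ≥0∞} (hB : B < ∞) (hf : l2 (fun ζ => wtE 0 ζ * ‖f ζ‖ₑ) ≤ B) :
    ‖rhs f‖ ≤ (rhsConst B).toReal := by
  have h : ‖rhs f‖ₑ ≤ rhsConst B := by
    rw [← l2_spec, l2_congr (b := fun ζ => ‖rhsFun f ζ‖ₑ)]
    · refine (l2_rhsFun_le f).trans ?_
      unfold rhsConst
      gcongr
    · filter_upwards [rhs_coe (hf.trans_lt hB)] with ζ hζ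
      rw [hζ]
  rw [← toReal_enorm]
  exact ENNReal.toReal_mono (rhsConst_lt_top hB).ne h

lemma truncOp_one_rhs (n : ℕ) (hf : l2 (fun ζ => wtE 0 ζ * ‖f ζ‖ₑ) < ∞) :
    truncOp n locBdd_one (rhs f) = field n f := by
  refine Lp.ext ?_
  filter_upwards [truncOp_coe n locBdd_one (rhs f), rhs_coe hf, truncOp_coe n locBdd_lam f,
    nonlin_coe n f f, Lp.coeFn_add (truncOp n locBdd_lam f) (nonlin n f f)] with ζ h1 h2 h3 h4 h5
  rw [h1, h2, field, h5, Pi.add_apply, h3, h4, rhsFun]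
  ring

end FiniteNorm

/-! ### Convergence of the truncated solutions and the integrated equation. -/

section Limit

variable {k T : ℝ} {g : Spec}

lemma exists_limit (hk : 0 < k) (hT0 : 0 < T) (hT : 16 * (energyConst 0 + 1) * k * T ≤ 1)
    (hg : Herm g) (hgk : l2 (fun ζ => wtE 0 ζ * ‖g ζ‖ₑ) ≤ ENNReal.ofReal k) :
    ∃ (F : ℕ → ℝ → Spec) (f : ℝ → Spec), (∀ n, TruncSol n T g (F n)) ∧
      ∀ t ∈ Set.Icc 0 T, Filter.Tendsto (fun n => F n t) Filter.atTop (nhds (f t)) := by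
  choose F hF using fun n => exists_truncSol n hT0.le hg
  have hpi := Real.pi_pos
  have hcauchy : ∀ t ∈ Set.Icc 0 T, CauchySeq fun n => F n t := by
    intro t ht
    set A := 2 * (32 * Real.pi * ratioConst.toReal * (2 * k) ^ 3) with hA
    set E := Real.exp ((2 * (Real.pi * ratioConst.toReal * (2 * k)) + 1) * T) with hE
    -- The bound must not depend on m: the distance between the two truncated initial values is
    -- replaced by the distance from the n-th one to g, which tends to 0.
    refine cauchySeq_of_le_tendsto_0' (fun n : ℕ =>
      √((‖truncOp n locBdd_one g - g‖ ^ 2 + A * (1 / ((n : ℝ) + 1))) * E)) (fun n m hnm => ?_) ?_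
    · rw [dist_eq_norm]
      refine Real.le_sqrt_of_sq_le ?_
      refine ((hF n).norm_sub_sq_le hnm (hF m) (fun t ht => (hF n).wnorm_zero_le hk hT0 hT hgk ht)
        (fun t ht => (hF m).wnorm_zero_le hk hT0 hT hgk ht) ht).trans ?_
      have h1 := norm_truncOp_one_sub_le hnm g
      refine mul_le_mul_of_nonneg_right (add_le_add (pow_le_pow_left₀ (norm_nonneg _) h1 2)
        (le_of_eq ?_)) (Real.exp_pos _).le
      rw [hA]
      ring
    · have h1 : Filter.Tendsto (fun n => ‖truncOp n locBdd_one g - g‖) Filter.atTop (nhds 0) :=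
        tendsto_iff_norm_sub_tendsto_zero.1 (tendsto_truncOp_one g)
      have h2 := (((h1.pow 2).add
        (tendsto_one_div_add_atTop_nhds_zero_nat (𝕜 := ℝ).const_mul A)).mul_const E).sqrt
      simpa using h2
  choose! f hf using fun t ht => cauchySeq_tendsto_of_complete (hcauchy t ht)
  exact ⟨F, f, hF, hf⟩

/-- The equation for the low frequencies of a truncated solution, in integrated form. -/
lemma TruncSol.truncOp_one_eq {n j : ℕ} (hjn : j ≤ n) {f : ℝ → Spec} (h : TruncSol n T g f)
    {t : ℝ} (ht : t ∈ Set.Icc 0 T) :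
    truncOp j locBdd_one (f t) = truncOp j locBdd_one g + ∫ s in 0..t, field j (f s) := by
  have hd : ∀ s ∈ Set.Icc 0 T, HasDerivWithinAt (fun s => truncOp j locBdd_one (f s))
      (field j (f s)) (Set.Icc 0 T) s := fun s hs => by
    rw [← truncOp_one_field hjn (f s)]
    exact ((truncOp j locBdd_one).restrictScalars ℝ).hasFDerivAt.comp_hasDerivWithinAt s
      (h.deriv s hs)
  have hc : ContinuousOn f (Set.Icc 0 t) := fun s hs =>
    ((h.deriv s ⟨hs.1, hs.2.trans ht.2⟩).continuousWithinAt).mono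
      (Set.Icc_subset_Icc_right ht.2)
  have := intervalIntegral.integral_eq_sub_of_hasDeriv_right_of_le (a := 0) (b := t) ht.1
    (f := fun s => truncOp j locBdd_one (f s)) (f' := fun s => field j (f s))
    ((truncOp j locBdd_one).continuous.comp_continuousOn hc)
    (fun s hs => (hd s ⟨hs.1.le, hs.2.le.trans ht.2⟩).mono_of_mem_nhdsWithin
      (Icc_mem_nhdsGT_of_mem ⟨hs.1.le, hs.2.trans_le ht.2⟩))
    (((continuous_field j).comp_continuousOn hc).intervalIntegrable_of_Icc ht.1)
  rw [this, h.init, truncOp_one_truncOp hjn]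
  exact (add_sub_cancel _ _).symm

end Limit

section Limit

variable {k T : ℝ} {g : Spec} {F : ℕ → ℝ → Spec} {f : ℝ → Spec}

lemma TruncSol.continuousOn {n : ℕ} {h : ℝ → Spec} (hh : TruncSol n T g h) :
    ContinuousOn h (Set.Icc 0 T) := fun s hs => (hh.deriv s hs).continuousWithinAt

lemma TruncSol.l2_wtE_le {n N : ℕ} {h : ℝ → Spec} (hh : TruncSol n T g h) {C : ℝ} {t : ℝ}
    (ht : t ∈ Set.Icc 0 T) (hC : wnorm n N (h t) ≤ C) :
    l2 (fun ζ => wtE N ζ * ‖h t ζ‖ₑ) ≤ ENNReal.ofReal C := by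
  rw [← ofReal_wnorm N (hh.adm t ht).supp]
  exact ENNReal.ofReal_le_ofReal hC

lemma aestronglyMeasurable_limit (hF : ∀ n, TruncSol n T g (F n))
    (hf : ∀ t ∈ Set.Icc 0 T, Filter.Tendsto (fun n => F n t) Filter.atTop (nhds (f t))) :
    AEStronglyMeasurable f (volume.restrict (Set.Icc 0 T)) :=
  aestronglyMeasurable_of_tendsto_ae Filter.atTop
    (fun n => (hF n).continuousOn.aestronglyMeasurable measurableSet_Icc)
    ((ae_restrict_iff' measurableSet_Icc).2 (Filter.Eventually.of_forall hf))

lemma norm_field_le (n : ℕ) {h : Spec} {B : ℝ} (hh : ‖h‖ ≤ B) :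
    ‖field n h‖ ≤ ‖truncOp n locBdd_lam‖ * B + ‖nonlin n‖ * B * B := by
  have hB : 0 ≤ B := (norm_nonneg _).trans hh
  refine (norm_add_le _ _).trans (add_le_add ?_ ?_)
  · exact ((truncOp n locBdd_lam).le_opNorm h).trans (by gcongr)
  · exact ((nonlin n).le_opNorm₂ h h).trans (by gcongr)

lemma norm_le_of_l2_le (h : Spec) {B : ℝ} (hB : 0 ≤ B) {N : ℕ}
    (hh : l2 (fun ζ => wtE N ζ * ‖h ζ‖ₑ) ≤ ENNReal.ofReal B) : ‖h‖ ≤ B := by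
  refine (ENNReal.ofReal_le_ofReal_iff hB).1 (le_trans ?_ hh)
  rw [ofReal_norm, ← l2_spec]
  exact l2_mono (Filter.Eventually.of_forall fun ζ => le_mul_of_one_le_left' (one_le_wtE _ _))

lemma uIoc_subset {t : ℝ} (ht : t ∈ Set.Icc 0 T) : Set.uIoc 0 t ⊆ Set.Icc 0 T := by
  rw [Set.uIoc_of_le ht.1]
  exact fun s hs => ⟨hs.1.le, hs.2.trans ht.2⟩

/-- The equation for the low frequencies of the limit, in integrated form. -/
lemma limit_truncOp_one_eq {B : ℝ} (hB : 0 ≤ B) (hF : ∀ n, TruncSol n T g (F n))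
    (hf : ∀ t ∈ Set.Icc 0 T, Filter.Tendsto (fun n => F n t) Filter.atTop (nhds (f t)))
    (hFB : ∀ n, ∀ t ∈ Set.Icc 0 T, l2 (fun ζ => wtE 0 ζ * ‖F n t ζ‖ₑ) ≤ ENNReal.ofReal B)
    (j : ℕ) {t : ℝ} (ht : t ∈ Set.Icc 0 T) :
    truncOp j locBdd_one (f t) = truncOp j locBdd_one g + ∫ s in 0..t, field j (f s) := by
  have hsub := uIoc_subset ht
  have h1 : Filter.Tendsto (fun n => ∫ s in 0..t, field j (F n s)) Filter.atTop
      (nhds (∫ s in 0..t, field j (f s))) := by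
    refine intervalIntegral.tendsto_integral_filter_of_dominated_convergence
      (fun _ => ‖truncOp j locBdd_lam‖ * B + ‖nonlin j‖ * B * B)
      (Filter.Eventually.of_forall fun n => ?_) (Filter.Eventually.of_forall fun n => ?_)
      intervalIntegrable_const ?_
    · exact ((continuous_field j).comp_continuousOn
        ((hF n).continuousOn.mono hsub)).aestronglyMeasurable measurableSet_uIoc
    · exact Filter.Eventually.of_forall fun s hs =>
        norm_field_le j (norm_le_of_l2_le _ hB (hFB n s (hsub hs)))
    · exact Filter.Eventually.of_forall fun s hs =>
        ((continuous_field j).tendsto _).comp (hf s (hsub hs))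
  refine tendsto_nhds_unique (((truncOp j locBdd_one).continuous.tendsto _).comp (hf t ht))
    ((h1.const_add (truncOp j locBdd_one g)).congr' ?_)
  -- The j-th low-frequency equation holds for the n-th solution only once n ≥ j.
  filter_upwards [Filter.eventually_ge_atTop j] with n hn
  exact ((hF n).truncOp_one_eq hn ht).symm

/-- `rhs` involves unbounded symbols, so its continuity on L² is not available. Along f it is the
pointwise limit of the continuous fields `field j`. -/
lemma aestronglyMeasurable_rhs (hfm : AEStronglyMeasurable f (volume.restrict (Set.Icc 0 T)))
    (hfB : ∀ t ∈ Set.Icc 0 T, l2 (fun ζ => wtE 0 ζ * ‖f t ζ‖ₑ) < ∞) :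
    AEStronglyMeasurable (fun s => rhs (f s)) (volume.restrict (Set.Icc 0 T)) := by
  refine aestronglyMeasurable_of_tendsto_ae Filter.atTop (f := fun j s => field j (f s))
    (fun j => (continuous_field j).comp_aestronglyMeasurable hfm) ?_
  refine (ae_restrict_iff' measurableSet_Icc).2 (Filter.Eventually.of_forall fun s hs => ?_)
  refine (tendsto_truncOp_one (rhs (f s))).congr fun j => ?_
  exact truncOp_one_rhs j (hfB s hs)

/-- The integrated equation. -/
lemma eq_add_integral_rhs {B : ℝ≥0∞} (hBt : B < ∞)
    (hfm : AEStronglyMeasurable f (volume.restrict (Set.Icc 0 T)))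
    (hfB : ∀ t ∈ Set.Icc 0 T, l2 (fun ζ => wtE 0 ζ * ‖f t ζ‖ₑ) ≤ B)
    (hj : ∀ j, ∀ t ∈ Set.Icc 0 T,
      truncOp j locBdd_one (f t) = truncOp j locBdd_one g + ∫ s in 0..t, field j (f s))
    {t : ℝ} (ht : t ∈ Set.Icc 0 T) :
    f t = g + ∫ s in 0..t, rhs (f s) := by
  have hsub := uIoc_subset ht
  -- Dominated convergence in j: truncation does not increase the norm, so the bound for the full
  -- right-hand side dominates every `field j`.
  have h1 : Filter.Tendsto (fun j => ∫ s in 0..t, field j (f s)) Filter.atTop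
      (nhds (∫ s in 0..t, rhs (f s))) := by
    refine intervalIntegral.tendsto_integral_filter_of_dominated_convergence
      (fun _ => (rhsConst B).toReal)
      (Filter.Eventually.of_forall fun n => ?_) (Filter.Eventually.of_forall fun n => ?_)
      intervalIntegrable_const ?_
    · exact ((continuous_field n).comp_aestronglyMeasurable hfm).mono_measure
        (Measure.restrict_mono hsub le_rfl)
    · refine Filter.Eventually.of_forall fun s hs => ?_
      rw [← truncOp_one_rhs n ((hfB s (hsub hs)).trans_lt hBt)]
      exact (norm_truncOp_one_le _ _).trans (norm_rhs_le hBt (hfB s (hsub hs)))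
    · refine Filter.Eventually.of_forall fun s hs => ?_
      refine (tendsto_truncOp_one (rhs (f s))).congr fun j => ?_
      exact truncOp_one_rhs j ((hfB s (hsub hs)).trans_lt hBt)
  refine tendsto_nhds_unique (tendsto_truncOp_one (f t))
    (((tendsto_truncOp_one g).add h1).congr fun j => ?_)
  exact (hj j t ht).symm

/-- Integrated equations with a bounded right-hand side. -/
lemma lipschitz_and_ae_hasDerivAt {E : Type*} [NormedAddCommGroup E] [NormedSpace ℝ E]
    [CompleteSpace E] {f r : ℝ → E} {g : E} (hT : 0 ≤ T)
    (hr : AEStronglyMeasurable r (volume.restrict (Set.Icc 0 T))) {C : ℝ≥0}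
    (hC : ∀ t ∈ Set.Icc 0 T, ‖r t‖ ≤ C) (h : ∀ t ∈ Set.Icc 0 T, f t = g + ∫ s in 0..t, r s) :
    LipschitzOnWith C f (Set.Icc 0 T) ∧ ∀ᵐ t, t ∈ Set.Ioo 0 T → HasDerivAt f (r t) t := by
  have hint : IntegrableOn r (Set.Icc 0 T) :=
    Integrable.of_bound hr C
      ((ae_restrict_iff' measurableSet_Icc).2 (Filter.Eventually.of_forall hC))
  have hii : ∀ a ∈ Set.Icc 0 T, ∀ b ∈ Set.Icc 0 T, IntervalIntegrable r volume a b := by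
    intro a ha b hb
    refine (hint.mono_set ?_).intervalIntegrable
    exact Set.uIcc_subset_Icc ha hb
  have h0 : (0 : ℝ) ∈ Set.Icc 0 T := ⟨le_rfl, hT⟩
  constructor
  · refine LipschitzOnWith.of_dist_le_mul fun a ha b hb => ?_
    rw [dist_eq_norm, h a ha, h b hb, add_sub_add_left_eq_sub,
      intervalIntegral.integral_interval_sub_left (hii 0 h0 a ha) (hii 0 h0 b hb), Real.dist_eq]
    refine intervalIntegral.norm_integral_le_of_norm_le_const fun x hx => hC x ?_
    exact Set.uIcc_subset_Icc hb ha (Set.uIoc_subset_uIcc hx)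
  · filter_upwards [(hii 0 h0 T ⟨hT, le_rfl⟩).ae_hasDerivAt_integral] with t ht htT
    have h1 := (ht (by rw [Set.uIcc_of_le hT]; exact ⟨htT.1.le, htT.2.le⟩) 0
      Set.left_mem_uIcc).const_add g
    refine h1.congr_of_eventuallyEq ?_
    filter_upwards [Ioo_mem_nhds htT.1 htT.2] with s hs
    exact h s ⟨hs.1.le, hs.2.le⟩

/-- Existence for the equation on the frequency side. -/
theorem exists_spec_solution (hk : 0 < k) (hT0 : 0 < T)
    (hT : 16 * (energyConst 0 + 1) * k * T ≤ 1)
    (hg : Herm g) (hgk : l2 (fun ζ => wtE 0 ζ * ‖g ζ‖ₑ) ≤ ENNReal.ofReal k) :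
    ∃ f : ℝ → Spec, f 0 = g ∧ (∀ t ∈ Set.Icc 0 T, Herm (f t)) ∧
      (∀ N, l2 (fun ζ => wtE N ζ * ‖g ζ‖ₑ) < ∞ →
        ∃ C < ∞, ∀ t ∈ Set.Icc 0 T, l2 (fun ζ => wtE N ζ * ‖f t ζ‖ₑ) ≤ C) ∧
      (∃ K : ℝ≥0, LipschitzOnWith K f (Set.Icc 0 T)) ∧
      ∀ᵐ t, t ∈ Set.Ioo 0 T → HasDerivAt f (rhs (f t)) t := by
  obtain ⟨F, f, hF, hf⟩ := exists_limit hk hT0 hT hg hgk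
  have h0 : (0 : ℝ) ∈ Set.Icc 0 T := ⟨le_rfl, hT0.le⟩
  have hFB : ∀ n, ∀ t ∈ Set.Icc 0 T,
      l2 (fun ζ => wtE 0 ζ * ‖F n t ζ‖ₑ) ≤ ENNReal.ofReal (2 * k) := fun n t ht =>
    (hF n).l2_wtE_le ht ((hF n).wnorm_zero_le hk hT0 hT hgk ht)
  have hfB : ∀ t ∈ Set.Icc 0 T, l2 (fun ζ => wtE 0 ζ * ‖f t ζ‖ₑ) ≤ ENNReal.ofReal (2 * k) :=
    fun t ht => l2_le_of_tendsto (hf t ht) 0 fun n => hFB n t ht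
  have hfm := aestronglyMeasurable_limit hF hf
  have heq : ∀ t ∈ Set.Icc 0 T, f t = g + ∫ s in 0..t, rhs (f s) := fun t ht =>
    eq_add_integral_rhs ENNReal.ofReal_lt_top hfm hfB
      (fun j t ht => limit_truncOp_one_eq (by positivity) hF hf hFB j ht) ht
  have hLD := lipschitz_and_ae_hasDerivAt hT0.le
    (aestronglyMeasurable_rhs hfm fun t ht => (hfB t ht).trans_lt ENNReal.ofReal_lt_top)
    (C := (rhsConst (ENNReal.ofReal (2 * k))).toNNReal)
    (fun t ht => norm_rhs_le ENNReal.ofReal_lt_top (hfB t ht)) heq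
  refine ⟨f, ?_, fun t ht => ?_, fun N hN => ?_, ⟨_, hLD.1⟩, hLD.2⟩
  · rw [heq 0 h0, intervalIntegral.integral_same, add_zero]
  · rw [← refl_eq_iff]
    refine tendsto_nhds_unique ((refl.continuous.tendsto _).comp (hf t ht))
      ((hf t ht).congr fun n => ?_)
    exact ((refl_eq_iff _).2 ((hF n).adm t ht).herm).symm
  · obtain ⟨C, -, hC⟩ := exists_wnorm_bound hk hT0 hT hgk N hN
    exact ⟨ENNReal.ofReal C, ENNReal.ofReal_lt_top, fun t ht =>
      l2_le_of_tendsto (hf t ht) N fun n => (hF n).l2_wtE_le ht (hC n _ (hF n) t ht)⟩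

end Limit

/-! ### Return to physical space -/

/-- Fubini, with a kernel symmetric in its two variables. It is used to identify the L² inverse
transform of an integrable function by duality. -/
lemma integral_fourierInv_mul (g f : Plane → ℂ) (hg : Integrable g) (hf : Integrable f) :
    ∫ x, 𝓕⁻ g x * f x = ∫ x, g x * 𝓕⁻ f x := by
  have h := VectorFourier.integral_fourierIntegral_smul_eq_flip (L := -innerₗ Plane)
    (μ := volume) (ν := volume) Real.continuous_fourierChar
    (continuous_inner (𝕜 := ℝ) (E := Plane)).neg hg hf
  have hflip : (-innerₗ Plane).flip = -innerₗ Plane := by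
    ext x y
    simp [real_inner_comm]
  rw [hflip] at h
  exact h

lemma continuous_fourierInv {f : Plane → ℂ} (hf : Integrable f) : Continuous (𝓕⁻ f) :=
  VectorFourier.fourierIntegral_continuous Real.continuous_fourierChar
    (continuous_inner (𝕜 := ℝ) (E := Plane)).neg hf

/-- The inverse Plancherel transform of an integrable function is its inverse Fourier integral. -/
lemma fourierInv_coe {f : Spec} (hf : Integrable f) :
    ∀ᵐ x, (𝓕⁻ f : Spec) x = 𝓕⁻ (f : Plane → ℂ) x := by
  refine ae_eq_of_integral_contDiff_smul_eq
    ((Lp.memLp (𝓕⁻ f : Spec)).locallyIntegrable one_le_two)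
    (continuous_fourierInv hf).locallyIntegrable fun g hg hgc => ?_
  have hgc' : HasCompactSupport fun x => (g x : ℂ) := hgc.comp_left Complex.ofReal_zero
  set G : SchwartzMap Plane ℂ := hgc'.toSchwartzMap (Complex.ofRealCLM.contDiff.comp hg) with hG
  have hGx : ∀ x, G x = g x := fun x => rfl
  have h1 := congrArg (fun τ => τ G) (Lp.fourierInv_toTemperedDistribution_eq f)
  simp only [TemperedDistribution.fourierInv_apply, Lp.toTemperedDistribution_apply,
    SchwartzMap.fourierInv_coe, smul_eq_mul] at h1
  rw [integral_fourierInv_mul _ _ G.integrable hf] at h1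
  simp only [hGx] at h1
  simpa only [Complex.real_smul] using h1.symm

/-- Complex conjugation on square integrable functions. -/
noncomputable def conjL : Spec →L[ℝ] Spec := (Complex.conjCLE : ℂ →L[ℝ] ℂ).compLpL 2 volume

lemma conjL_coe (f : Spec) : ∀ᵐ x, conjL f x = conj (f x) :=
  ContinuousLinearMap.coeFn_compLp _ f

lemma integrable_truncOp {n : ℕ} {m : Plane → ℂ} (h : LocBdd m) (f : Spec) :
    Integrable (truncOp n h f) := by
  refine Integrable.congr ?_ (Filter.EventuallyEq.symm (truncOp_coe n h f))
  exact (h.memLp n).integrable_mul (Lp.memLp f)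

lemma conj_fourierInv (f : Plane → ℂ) (x : Plane) :
    conj (𝓕⁻ f x) = 𝓕⁻ (fun ζ => conj (f (-ζ))) x := by
  rw [Real.fourierInv_eq', Real.fourierInv_eq', ← integral_conj,
    ← integral_neg_eq_self (fun v => conj (Complex.exp _ • f v))]
  refine integral_congr_ae (Filter.Eventually.of_forall fun v => ?_)
  simp only [smul_eq_mul, map_mul, ← Complex.exp_conj, inner_neg_left, Complex.conj_ofReal,
    Complex.conj_I]
  congr 2
  push_cast
  ring

lemma conjL_fourierInv_of_integrable {f : Spec} (hf : Integrable f) :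
    conjL (𝓕⁻ f) = 𝓕⁻ (refl f) := by
  have hr : Integrable (refl f) := by
    refine Integrable.congr ?_ (Filter.EventuallyEq.symm (refl_coe f))
    exact (Complex.conjCLE : ℂ →L[ℝ] ℂ).integrable_comp hf.comp_neg
  refine Lp.ext ?_
  filter_upwards [conjL_coe (𝓕⁻ f), fourierInv_coe hf, fourierInv_coe hr] with x h1 h2 h3
  rw [h1, h2, h3, conj_fourierInv]
  refine integral_congr_ae ?_
  filter_upwards [refl_coe f] with ζ hζ
  rw [hζ]

/-- Both sides are continuous in f, and the truncations of f are integrable and converge to f, so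
the integral formula suffices. -/
lemma conjL_fourierInv (f : Spec) : conjL (𝓕⁻ f) = 𝓕⁻ (refl f) := by
  have h := tendsto_truncOp_one f
  have hc : Continuous fun f : Spec => (𝓕⁻ f : Spec) :=
    (FourierTransform.fourierInvCLM ℂ Spec).continuous
  refine tendsto_nhds_unique ((conjL.continuous.comp hc).continuousAt.tendsto.comp h)
    (((hc.comp refl.continuous).continuousAt.tendsto.comp h).congr fun n => ?_)
  exact (conjL_fourierInv_of_integrable (integrable_truncOp locBdd_one f)).symm

/-- The real part of the inverse Fourier transform. -/
noncomputable def physical : Spec →L[ℝ] L2 :=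
  (Complex.reCLM.compLpL 2 volume).comp
    ((FourierTransform.fourierInvCLM ℂ Spec).restrictScalars ℝ)

lemma physical_coe (f : Spec) : ∀ᵐ x, physical f x = ((𝓕⁻ f : Spec) x).re :=
  ContinuousLinearMap.coeFn_compLp Complex.reCLM (𝓕⁻ f : Spec)

/-- Hermitian symmetry says that the inverse transform equals its own conjugate, so taking the real
part loses nothing. -/
lemma ofReal_physical {f : Spec} (hf : Herm f) :
    Complex.ofRealCLM.compLp (physical f) = (𝓕⁻ f : Spec) := by
  have h : conjL (𝓕⁻ f) = 𝓕⁻ f := by rw [conjL_fourierInv, (refl_eq_iff f).2 hf]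
  refine Lp.ext ?_
  filter_upwards [ContinuousLinearMap.coeFn_compLp Complex.ofRealCLM (physical f), physical_coe f,
    conjL_coe (𝓕⁻ f)] with x h1 h2 h3
  rw [h] at h3
  rw [h1, h2]
  exact (Complex.conj_eq_iff_re.1 h3.symm)

lemma fourierL2_physical {f : Spec} (hf : Herm f) : fourierL2 (physical f) = f := by
  rw [fourierL2, ofReal_physical hf]
  exact FourierTransform.fourier_fourierInv_eq f

lemma fourierInv_fourierL2 (u : L2) : (𝓕⁻ (fourierL2 u) : Spec) = Complex.ofRealCLM.compLp u :=
  FourierTransform.fourierInv_fourier_eq _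

lemma herm_fourierL2 (u : L2) : Herm (fourierL2 u) := by
  rw [← refl_eq_iff]
  have h : conjL (𝓕⁻ (fourierL2 u)) = 𝓕⁻ (fourierL2 u) := by
    rw [fourierInv_fourierL2]
    refine Lp.ext ?_
    filter_upwards [conjL_coe (Complex.ofRealCLM.compLp u),
      ContinuousLinearMap.coeFn_compLp Complex.ofRealCLM u] with x h1 h2
    rw [h1, h2]
    exact Complex.conj_ofReal _
  rw [conjL_fourierInv] at h
  have h2 := congrArg (fun f : Spec => (𝓕 f : Spec)) h
  simpa only [FourierTransform.fourier_fourierInv_eq] using h2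

lemma physical_fourierL2 (u : L2) : physical (fourierL2 u) = u := by
  refine Lp.ext ?_
  filter_upwards [physical_coe (fourierL2 u),
    ContinuousLinearMap.coeFn_compLp Complex.ofRealCLM u] with x h1 h2
  rw [h1, fourierInv_fourierL2, h2]
  exact Complex.ofReal_re _

/-- Hermitian Fourier multipliers act on real functions. -/
lemma isMultiplier_physical {m : Plane → ℂ} (hm : ∀ ζ, m (-ζ) = conj (m ζ)) {f h : Spec}
    (hf : Herm f) (hh : ∀ᵐ ζ, h ζ = m ζ * f ζ) :
    Herm h ∧ IsMultiplier m (physical f) (physical h) := by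
  have h1 : Herm h := by
    filter_upwards [hh, ae_neg hh, hf] with ζ h2 h3 h4
    rw [h3, h2, h4, hm, map_mul]
  refine ⟨h1, ?_⟩
  rw [IsMultiplier, fourierL2_physical hf, fourierL2_physical h1]
  exact hh

/-- The product rule behind the nonlinearity. -/
lemma sig_mul_conv {f p : Spec} (hp : ∀ᵐ ζ, p ζ = symX ζ * f ζ) (z : Plane) :
    sig z * conv f f z = - conv f p z := by
  -- The symbol of ∂_x is additive: z = y + (z - y) puts the derivative on one factor or the other,
  -- and by commutativity the two contributions agree.
  have h1 : symX z * conv f f z = conv p f z + conv f p z := by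
    unfold conv
    rw [← integral_add (integrable_conv p f z) (integrable_conv f p z), ← integral_const_mul]
    refine integral_congr_ae ?_
    filter_upwards [hp, (Measure.measurePreserving_sub_left volume z).quasiMeasurePreserving.ae hp] with y h2 h3
    rw [h2, h3]
    simp only [symX, PiLp.sub_apply]
    push_cast
    ring
  rw [conv_comm p f] at h1
  have h2 : sig z = -(symX z / 2) := by unfold sig symX; ring
  rw [h2]
  linear_combination -(1 / 2 : ℂ) * h1

lemma fourierInv_conv {f p : Plane → ℂ} (hf : Integrable f) (hp : Integrable p) (x : Plane) :
    𝓕⁻ (conv f p) x = 𝓕⁻ f x * 𝓕⁻ p x := by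
  rw [Real.fourierInv_eq_fourier_neg, Real.fourierInv_eq_fourier_neg,
    Real.fourierInv_eq_fourier_neg]
  exact Real.fourier_mul_convolution_eq hf hp (-x)

lemma integrable_conv_of_integrable {f p : Plane → ℂ} (hf : Integrable f) (hp : Integrable p) :
    Integrable (conv f p) :=
  hf.integrable_convolution (ContinuousLinearMap.mul ℂ ℂ) hp

/-- The nonlinearity in physical space. -/
lemma physical_nonlinearity {f p q : Spec} (hf : Herm f) (hpH : Herm p)
    (hp : ∀ᵐ ζ, p ζ = symX ζ * f ζ) (hfi : Integrable f) (hpi : Integrable p)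
    (hq : ∀ᵐ ζ, q ζ = sig ζ * conv f f ζ) :
    ∀ᵐ x, physical q x = -(physical f x * physical p x) := by
  have hq' : ∀ᵐ ζ, q ζ = -conv f p ζ := by
    filter_upwards [hq] with ζ h
    rw [h, sig_mul_conv hp]
  have hqi : Integrable q :=
    (integrable_conv_of_integrable hfi hpi).neg.congr (Filter.EventuallyEq.symm hq')
  have ef := ContinuousLinearMap.coeFn_compLp Complex.ofRealCLM (physical f)
  have ep := ContinuousLinearMap.coeFn_compLp Complex.ofRealCLM (physical p)
  rw [ofReal_physical hf] at ef
  rw [ofReal_physical hpH] at ep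
  filter_upwards [physical_coe q, fourierInv_coe hqi, fourierInv_coe hfi, fourierInv_coe hpi,
    ef, ep] with x h1 h2 h3 h4 h5 h6
  have h7 : 𝓕⁻ (q : Plane → ℂ) x = -(𝓕⁻ (f : Plane → ℂ) x * 𝓕⁻ (p : Plane → ℂ) x) := by
    rw [← fourierInv_conv hfi hpi, Real.fourierInv_eq, Real.fourierInv_eq, ← integral_neg]
    refine integral_congr_ae ?_
    filter_upwards [hq'] with ζ h
    rw [h, smul_neg]
  rw [h1, h2, h7, ← h3, ← h4, h5, h6]
  simp

/-! ### The spaces `Y^N` and the weights -/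

lemma sqNorm_eq (m : Plane → ℂ) (u : L2) :
    sqNorm m u = l2 (fun ζ => ‖m ζ * fourierL2 u ζ‖ₑ) ^ 2 := (l2_sq _).symm

lemma l2_eq_rpow (a : Plane → ℝ≥0∞) : l2 a = (∫⁻ ζ, a ζ ^ 2) ^ (1 / 2 : ℝ) := by
  unfold l2; simp

lemma two_pi_ge_one : 1 ≤ 2 * Real.pi := by linarith [Real.pi_gt_three]

/-- Dropping the factors 2π ≥ 1 only decreases the weight, so no constant is lost when the base
weight is compared with the norm of Y⁰. -/
lemma wtSq_le_norm (ζ : Plane) :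
    wtSq (ζ 0) (ζ 1) ≤ 1 + (‖symX ζ ^ 3‖ ^ 2 + ‖symInvXYY ζ‖ ^ 2 + ‖symY ζ ^ 2‖ ^ 2) := by
  rw [norm_pow, norm_pow, norm_symX, norm_symY, norm_symInvXYY]
  have h := two_pi_ge_one
  have h1 : |ζ 0| ≤ 2 * Real.pi * |ζ 0| := le_mul_of_one_le_left (abs_nonneg _) h
  have h2 : |ζ 1| ≤ 2 * Real.pi * |ζ 1| := le_mul_of_one_le_left (abs_nonneg _) h
  have h3 : |(ζ 1) ^ 2 / ζ 0| ≤ 2 * Real.pi * |(ζ 1) ^ 2 / ζ 0| :=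
    le_mul_of_one_le_left (abs_nonneg _) h
  have e1 : (ζ 0) ^ 6 ≤ ((2 * Real.pi * |ζ 0|) ^ 3) ^ 2 := by
    rw [← pow_mul, ← Even.pow_abs (by decide)]; gcongr
  have e2 : (ζ 1) ^ 4 ≤ ((2 * Real.pi * |ζ 1|) ^ 2) ^ 2 := by
    rw [← pow_mul, ← Even.pow_abs (by decide)]; gcongr
  have e3 : ((ζ 1) ^ 2 / ζ 0) ^ 2 ≤ (2 * Real.pi * |(ζ 1) ^ 2 / ζ 0|) ^ 2 := by
    rw [← sq_abs]; gcongr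
  unfold wtSq
  linarith

lemma ofReal_norm_sq (z : ℂ) : ENNReal.ofReal (‖z‖ ^ 2) = ‖z‖ₑ ^ 2 := by
  rw [ENNReal.ofReal_pow (norm_nonneg _), ofReal_norm]

lemma wtE_sq (N : ℕ) (ζ : Plane) :
    wtE N ζ ^ 2 = ENNReal.ofReal (brSq (ζ 0) (ζ 1) ^ N * wtSq (ζ 0) (ζ 1)) := by
  rw [wtE, ← ENNReal.ofReal_pow (wtN_pos _ _ _).le, wtN_sq]

lemma wtE_zero_sq_le (ζ : Plane) :
    wtE 0 ζ ^ 2 ≤ 1 + (‖symX ζ ^ 3‖ₑ ^ 2 + ‖symInvXYY ζ‖ₑ ^ 2 + ‖symY ζ ^ 2‖ₑ ^ 2) := by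
  rw [wtE_sq, pow_zero, one_mul, ← ofReal_norm_sq, ← ofReal_norm_sq, ← ofReal_norm_sq,
    ← ENNReal.ofReal_add (by positivity) (by positivity),
    ← ENNReal.ofReal_add (by positivity) (by positivity), ← ENNReal.ofReal_one,
    ← ENNReal.ofReal_add (by positivity) (by positivity)]
  exact ENNReal.ofReal_le_ofReal (wtSq_le_norm ζ)

/-- The base norm controls the base weight. -/
lemma l2_wtE_zero_le_normY (u : L2) :
    l2 (fun ζ => wtE 0 ζ * ‖fourierL2 u ζ‖ₑ) ≤ normY 0 u := by
  have mf : Measurable (fourierL2 u) := measurable_spec _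
  rw [l2_eq_rpow, normY]
  gcongr
  simp only [zero_add, Finset.range_one, Finset.sum_singleton,
    Finset.Nat.antidiagonal_zero, pow_zero, one_mul, sqNorm]
  rw [← lintegral_add_left (by fun_prop), ← lintegral_add_left (by fun_prop),
    ← lintegral_add_left (by fun_prop)]
  refine lintegral_mono fun ζ => ?_
  simp only [enorm_mul, mul_pow]
  rw [← add_mul, ← add_mul, ← one_add_mul]
  gcongr
  simpa only [enorm_pow] using wtE_zero_sq_le ζ

lemma brSq_pow_le (N : ℕ) (ζ : Plane) :
    brSq (ζ 0) (ζ 1) ^ N ≤ 3 ^ N * (1 + ‖symX ζ ^ N‖ ^ 2 + ‖symY ζ ^ N‖ ^ 2) := by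
  rw [norm_pow, norm_pow, norm_symX, norm_symY]
  have h := two_pi_ge_one
  have hx : (ζ 0) ^ 2 ≤ (2 * Real.pi * |ζ 0|) ^ 2 := by
    rw [← sq_abs]
    exact pow_le_pow_left₀ (abs_nonneg _) (le_mul_of_one_le_left (abs_nonneg _) h) 2
  have hy : (ζ 1) ^ 2 ≤ (2 * Real.pi * |ζ 1|) ^ 2 := by
    rw [← sq_abs]
    exact pow_le_pow_left₀ (abs_nonneg _) (le_mul_of_one_le_left (abs_nonneg _) h) 2
  set p := (2 * Real.pi * |ζ 0|) ^ 2 with hp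
  set q := (2 * Real.pi * |ζ 1|) ^ 2 with hq
  have hp0 : 0 ≤ p := sq_nonneg _
  have hq0 : 0 ≤ q := sq_nonneg _
  rw [← pow_mul, ← pow_mul, mul_comm N 2, pow_mul, pow_mul, ← hp, ← hq]
  -- M stands for the largest of 1, p and q. The N-th power of a maximum is the maximum of the N-th
  -- powers, so no mixed derivatives appear.
  have key : ∀ M : ℝ, 0 ≤ M → 1 ≤ M → p ≤ M → q ≤ M → brSq (ζ 0) (ζ 1) ^ N ≤ 3 ^ N * M ^ N := by
    intro M h0 h1 h2 h3
    rw [← mul_pow]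
    refine pow_le_pow_left₀ (by linarith [one_le_brSq (ζ 0) (ζ 1)]) ?_ N
    unfold brSq
    linarith
  have hpN := pow_nonneg hp0 N
  have hqN := pow_nonneg hq0 N
  rcases le_total p q with h1 | h1
  · rcases le_total 1 q with h2 | h2
    · exact (key q hq0 h2 h1 le_rfl).trans (by gcongr; linarith)
    · exact (key 1 zero_le_one le_rfl (h1.trans h2) h2).trans (by gcongr; rw [one_pow]; linarith)
  · rcases le_total 1 p with h2 | h2
    · exact (key p hp0 h2 le_rfl h1).trans (by gcongr; linarith)
    · exact (key 1 zero_le_one le_rfl h2 (h1.trans h2)).trans (by gcongr; rw [one_pow]; linarith)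

lemma brE_sq_le (N : ℕ) (ζ : Plane) :
    ENNReal.ofReal (brSq (ζ 0) (ζ 1) ^ N) ≤ 3 ^ N * (1 + ‖symX ζ ^ N‖ₑ ^ 2 + ‖symY ζ ^ N‖ₑ ^ 2) := by
  refine (ENNReal.ofReal_le_ofReal (brSq_pow_le N ζ)).trans_eq ?_
  rw [ENNReal.ofReal_mul (by positivity), ENNReal.ofReal_add (by positivity) (by positivity),
    ENNReal.ofReal_add (by positivity) (by positivity), ofReal_norm_sq, ofReal_norm_sq,
    ENNReal.ofReal_one, ENNReal.ofReal_pow (by norm_num), ENNReal.ofReal_ofNat]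

/-- Only the function itself and its pure derivatives of order N in x and in y are needed, by
`brE_sq_le`. -/
lemma lintegral_brSq_lt_top {N : ℕ} {m : Plane → ℂ} (hm : Measurable m) {u : L2}
    (h : InSobolev N m u) :
    ∫⁻ ζ, ENNReal.ofReal (brSq (ζ 0) (ζ 1) ^ N) * (‖m ζ‖ₑ ^ 2 * ‖fourierL2 u ζ‖ₑ ^ 2) < ∞ := by
  have mf : Measurable (fourierL2 u) := measurable_spec _
  have h0 := h 0 0 (by omega)
  have h1 := h N 0 (by omega)
  have h2 := h 0 N (by omega)
  simp only [pow_zero, one_mul, mul_one, sqNorm, enorm_mul, mul_pow] at h0 h1 h2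
  calc _ ≤ ∫⁻ ζ, 3 ^ N * (‖m ζ‖ₑ ^ 2 * ‖fourierL2 u ζ‖ₑ ^ 2 +
          ‖symX ζ ^ N‖ₑ ^ 2 * ‖m ζ‖ₑ ^ 2 * ‖fourierL2 u ζ‖ₑ ^ 2 +
          ‖symY ζ ^ N‖ₑ ^ 2 * ‖m ζ‖ₑ ^ 2 * ‖fourierL2 u ζ‖ₑ ^ 2) := by
        refine lintegral_mono fun ζ => ?_
        refine (mul_le_mul_left (brE_sq_le N ζ) _).trans (le_of_eq ?_)
        ring
    _ < ∞ := by
        rw [lintegral_const_mul _ (by fun_prop), lintegral_add_left (by fun_prop),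
          lintegral_add_left (by fun_prop)]
        exact ENNReal.mul_lt_top (by finiteness)
          (ENNReal.add_lt_top.2 ⟨ENNReal.add_lt_top.2 ⟨h0, h1⟩, h2⟩)

/-- Membership in `Y^N` gives finiteness of the weighted norm. -/
lemma l2_wtE_lt_top {N : ℕ} {u : L2} (h : MemY N u) :
    l2 (fun ζ => wtE N ζ * ‖fourierL2 u ζ‖ₑ) < ∞ := by
  have mf : Measurable (fourierL2 u) := measurable_spec _
  obtain ⟨h1, h2, h3, h4⟩ := h
  have i1 := lintegral_brSq_lt_top measurable_const h1
  have i2 := lintegral_brSq_lt_top (by fun_prop) h2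
  have i3 := lintegral_brSq_lt_top (by fun_prop) h3
  have i4 := lintegral_brSq_lt_top measurable_symInvXYY h4
  have mb : Measurable fun ζ : Plane => ENNReal.ofReal (brSq (ζ 0) (ζ 1) ^ N) := by
    unfold brSq; fun_prop
  rw [l2_eq_rpow]
  refine ENNReal.rpow_lt_top_of_nonneg (by norm_num) (ne_of_lt ?_)
  refine lt_of_le_of_lt ?_ (ENNReal.add_lt_top.2 ⟨i1, ENNReal.add_lt_top.2
    ⟨ENNReal.add_lt_top.2 ⟨i2, i4⟩, i3⟩⟩)
  rw [← lintegral_add_left (by fun_prop), ← lintegral_add_left (by fun_prop),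
    ← lintegral_add_left (by fun_prop)]
  refine lintegral_mono fun ζ => ?_
  rw [← mul_add, ← mul_add, ← mul_add, ← add_mul, ← add_mul, ← add_mul, mul_pow, wtE_sq,
    ENNReal.ofReal_mul (pow_nonneg (by linarith [one_le_brSq (ζ 0) (ζ 1)]) N), mul_assoc]
  gcongr
  have := wtE_zero_sq_le ζ
  rw [wtE_sq, pow_zero, one_mul] at this
  simpa only [enorm_one, one_pow] using this

/-- The symbols whose multipliers are controlled by the base weight. -/
def WtBdd (m : Plane → ℂ) : Prop := ∀ ζ, ‖m ζ‖ ≤ (2 * Real.pi) ^ 3 * wt (ζ 0) (ζ 1)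

lemma wtBdd_one : WtBdd fun _ => 1 := fun ζ => by
  rw [norm_one]
  exact one_le_mul_of_one_le_of_one_le (one_le_pow₀ two_pi_ge_one) (one_le_wt _ _)

lemma wtBdd_symX_cube : WtBdd fun ζ => symX ζ ^ 3 := fun ζ => by
  rw [norm_pow, norm_symX, mul_pow]
  gcongr
  exact abs_cube_le_wt _ _

lemma wtBdd_symY_sq : WtBdd fun ζ => symY ζ ^ 2 := fun ζ => by
  rw [norm_pow, norm_symY, mul_pow, sq_abs]
  gcongr
  · exact two_pi_ge_one
  · norm_num
  · exact sq_le_wt _ _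

lemma wtBdd_symInvXYY : WtBdd symInvXYY := fun ζ => by
  rw [norm_symInvXYY]
  gcongr
  · exact le_self_pow₀ two_pi_ge_one (by norm_num)
  · exact abs_div_le_wt _ _

/-- The constant in the comparison of the Sobolev norms with the weighted norm. -/
noncomputable def symConst (N : ℕ) : ℝ := (2 * Real.pi) ^ N * (2 * Real.pi) ^ 3

lemma norm_symbol_le {N a b : ℕ} (hab : a + b ≤ N) {m : Plane → ℂ} (hm : WtBdd m) (ζ : Plane) :
    ‖symX ζ ^ a * symY ζ ^ b * m ζ‖ ≤ symConst N * wtN N (ζ 0) (ζ 1) := by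
  have hpi := two_pi_ge_one
  have hb := one_le_br (ζ 0) (ζ 1)
  rw [norm_mul, norm_mul, norm_pow, norm_pow, norm_symX, norm_symY,
    mul_pow (2 * Real.pi), mul_pow (2 * Real.pi)]
  calc _ ≤ ((2 * Real.pi) ^ a * br (ζ 0) (ζ 1) ^ a * ((2 * Real.pi) ^ b * br (ζ 0) (ζ 1) ^ b)) *
        ((2 * Real.pi) ^ 3 * wt (ζ 0) (ζ 1)) := by
        gcongr
        · exact abs_le_br_left _ _
        · exact abs_le_br_right _ _
        · exact hm ζ
    _ = ((2 * Real.pi) ^ (a + b) * br (ζ 0) (ζ 1) ^ (a + b)) *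
        ((2 * Real.pi) ^ 3 * wt (ζ 0) (ζ 1)) := by rw [pow_add, pow_add]; ring
    _ ≤ ((2 * Real.pi) ^ N * br (ζ 0) (ζ 1) ^ N) * ((2 * Real.pi) ^ 3 * wt (ζ 0) (ζ 1)) := by
        have := wt_pos (ζ 0) (ζ 1)
        gcongr
    _ = _ := by unfold symConst wtN; ring

lemma sqNorm_le {N a b : ℕ} (hab : a + b ≤ N) {m : Plane → ℂ} (hm : WtBdd m) {u : L2} {C : ℝ≥0∞}
    (hu : l2 (fun ζ => wtE N ζ * ‖fourierL2 u ζ‖ₑ) ≤ C) :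
    sqNorm (fun ζ => symX ζ ^ a * symY ζ ^ b * m ζ) u ≤ (ENNReal.ofReal (symConst N) * C) ^ 2 := by
  rw [sqNorm_eq]
  gcongr
  have hs : 0 ≤ symConst N := by have := Real.pi_pos; unfold symConst; positivity
  refine le_trans ?_ (mul_le_mul_right hu _)
  rw [← l2_const_mul _ ENNReal.ofReal_ne_top]
  refine l2_mono (Filter.Eventually.of_forall fun ζ => ?_)
  rw [enorm_mul, ← mul_assoc]
  gcongr
  rw [← ofReal_norm, wtE, ← ENNReal.ofReal_mul hs]
  exact ENNReal.ofReal_le_ofReal (norm_symbol_le hab hm ζ)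

lemma inSobolev_of_l2 {N : ℕ} {m : Plane → ℂ} (hm : WtBdd m) {u : L2}
    (hu : l2 (fun ζ => wtE N ζ * ‖fourierL2 u ζ‖ₑ) < ∞) : InSobolev N m u := fun _ _ hab =>
  (sqNorm_le hab hm le_rfl).trans_lt
    (ENNReal.pow_lt_top (ENNReal.mul_lt_top ENNReal.ofReal_lt_top hu))

lemma memY_of_l2 {N : ℕ} {u : L2} (hu : l2 (fun ζ => wtE N ζ * ‖fourierL2 u ζ‖ₑ) < ∞) :
    MemY N u :=
  ⟨inSobolev_of_l2 wtBdd_one hu, inSobolev_of_l2 wtBdd_symX_cube hu,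
    inSobolev_of_l2 wtBdd_symY_sq hu, inSobolev_of_l2 wtBdd_symInvXYY hu⟩

lemma exists_normY_bound (N : ℕ) {C : ℝ≥0∞} (hC : C < ∞) :
    ∃ D < ∞, ∀ u : L2, l2 (fun ζ => wtE N ζ * ‖fourierL2 u ζ‖ₑ) ≤ C → normY N u ≤ D := by
  set K := (ENNReal.ofReal (symConst N) * C) ^ 2 with hK
  have hKt : K < ∞ := ENNReal.pow_lt_top (ENNReal.mul_lt_top ENNReal.ofReal_lt_top hC)
  refine ⟨(K + ∑ k ∈ Finset.range (N + 1), ∑ _j ∈ Finset.HasAntidiagonal.antidiagonal k,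
    (K + K + K)) ^ (1 / 2 : ℝ), ?_, fun u hu => ?_⟩
  · refine ENNReal.rpow_lt_top_of_nonneg (by norm_num) (ne_of_lt ?_)
    exact ENNReal.add_lt_top.2 ⟨hKt, ENNReal.sum_lt_top.2 fun k _ => ENNReal.sum_lt_top.2
      fun j _ => ENNReal.add_lt_top.2 ⟨ENNReal.add_lt_top.2 ⟨hKt, hKt⟩, hKt⟩⟩
  · unfold normY
    gcongr with k hk j hj
    · have := sqNorm_le (N := N) (a := 0) (b := 0) (by omega) wtBdd_one hu
      simpa only [pow_zero, one_mul] using this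
    all_goals
      have hjk : j.1 + j.2 ≤ N := by
        have := Finset.HasAntidiagonal.mem_antidiagonal.1 hj
        have := Finset.mem_range.1 hk
        omega
    · exact sqNorm_le hjk wtBdd_symX_cube hu
    · exact sqNorm_le hjk wtBdd_symInvXYY hu
    · exact sqNorm_le hjk wtBdd_symY_sq hu

/-! ### The equation in physical space -/

lemma exists_mul_spec {m : Plane → ℂ} (hm : Measurable m) {C : ℝ} (hC : 0 ≤ C)
    (h : ∀ ζ, ‖m ζ‖ ≤ C * wt (ζ 0) (ζ 1)) {f : Spec} (hf : l2 (fun ζ => wtE 0 ζ * ‖f ζ‖ₑ) < ∞) :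
    ∃ p : Spec, ∀ᵐ ζ, p ζ = m ζ * f ζ := by
  have hp : MemLp (fun ζ => m ζ * f ζ) 2 volume := by
    refine ⟨by fun_prop, ?_⟩
    rw [← l2_enorm_eq]
    refine lt_of_le_of_lt ?_ (ENNReal.mul_lt_top (ENNReal.ofReal_lt_top (r := C)) hf)
    rw [← l2_const_mul _ ENNReal.ofReal_ne_top]
    refine l2_mono (Filter.Eventually.of_forall fun ζ => ?_)
    rw [enorm_mul, ← mul_assoc]
    gcongr
    rw [← ofReal_norm, wtE, ← ENNReal.ofReal_mul hC]
    refine ENNReal.ofReal_le_ofReal ?_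
    simpa [wtN] using h ζ
  exact ⟨hp.toLp, hp.coeFn_toLp⟩

lemma norm_symX_le_wt (ζ : Plane) : ‖symX ζ‖ ≤ 8 * Real.pi * wt (ζ 0) (ζ 1) := by
  have h := (abs_le_br_left (ζ 0) (ζ 1)).trans (br_le_wt (ζ 0) (ζ 1))
  have hpi := Real.pi_pos
  rw [norm_symX]
  calc _ ≤ 2 * Real.pi * (4 * wt (ζ 0) (ζ 1)) := by gcongr
    _ = _ := by ring

lemma integrable_of_l2 {f : Spec} (hf : l2 (fun ζ => wtE 0 ζ * ‖f ζ‖ₑ) < ∞) : Integrable f :=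
  ⟨(measurable_spec f).aestronglyMeasurable, (lintegral_enorm_le f).trans_lt
    (ENNReal.mul_lt_top ratioConst_lt_top hf)⟩

/-- The L¹ bound on f already includes one bracket, which covers one derivative in x. -/
lemma integrable_symX_mul {f p : Spec} (hf : l2 (fun ζ => wtE 0 ζ * ‖f ζ‖ₑ) < ∞)
    (hp : ∀ᵐ ζ, p ζ = symX ζ * f ζ) : Integrable p := by
  refine ⟨(measurable_spec p).aestronglyMeasurable, ?_⟩
  have h := lintegral_low_le 0 (a := fun ζ => ‖f ζ‖ₑ) (by fun_prop)
  refine lt_of_le_of_lt ?_ (ENNReal.mul_lt_top (ENNReal.ofReal_lt_top (r := 2 * Real.pi))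
    (h.trans_lt (ENNReal.mul_lt_top ratioConst_lt_top hf)))
  rw [← lintegral_const_mul _ (by fun_prop)]
  refine lintegral_mono_ae ?_
  have hpi := Real.pi_pos
  filter_upwards [hp] with ζ hζ
  rw [hζ, enorm_mul, ← mul_assoc]
  gcongr
  rw [← ofReal_norm, brE, ← ENNReal.ofReal_mul (by positivity), norm_symX]
  refine ENNReal.ofReal_le_ofReal ?_
  gcongr
  simpa using abs_le_br_left (ζ 0) (ζ 1)

/-- The equation on the frequency side translates into the equation in physical space. -/
lemma equation_physical {f : Spec} (hf : Herm f) (hfw : l2 (fun ζ => wtE 0 ζ * ‖f ζ‖ₑ) < ∞) :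
    ∃ ux uxxx w : L2,
      IsMultiplier symX (physical f) ux ∧
      IsMultiplier (fun ζ => symX ζ ^ 3) (physical f) uxxx ∧
      IsMultiplier symInvXYY (physical f) w ∧
      ∀ᵐ z : Plane, physical (rhs f) z + uxxx z + ux z + physical f z * ux z - w z = 0 := by
  have hpi := Real.pi_pos
  obtain ⟨p, hp⟩ := exists_mul_spec measurable_symX (by positivity) norm_symX_le_wt hfw
  obtain ⟨p3, hp3⟩ := exists_mul_spec (m := fun ζ => symX ζ ^ 3) (by fun_prop) (by positivity)
    wtBdd_symX_cube hfw
  obtain ⟨r, hr⟩ := exists_mul_spec measurable_symInvXYY (by positivity) wtBdd_symInvXYY hfw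
  have mp := isMultiplier_physical symX_neg hf hp
  have mp3 := isMultiplier_physical (m := fun ζ => symX ζ ^ 3)
    (fun ζ => by rw [symX_neg, map_pow]) hf hp3
  have mr := isMultiplier_physical symInvXYY_neg hf hr
  refine ⟨physical p, physical p3, physical r, mp.2, mp3.2, mr.2, ?_⟩
  -- Removing the linear terms from the right-hand side leaves the convolution term alone. It is the
  -- only one that needs the product formula in physical space.
  have hq : ∀ᵐ ζ, (rhs f + p3 + p - r : Spec) ζ = sig ζ * conv f f ζ := by
    filter_upwards [rhs_coe hfw, hp, hp3, hr, Lp.coeFn_sub (rhs f + p3 + p) r,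
      Lp.coeFn_add (rhs f + p3) p, Lp.coeFn_add (rhs f) p3] with ζ h1 h2 h3 h4 h5 h6 h7
    rw [h5, Pi.sub_apply, h6, Pi.add_apply, h7, Pi.add_apply, h1, h2, h3, h4, rhsFun, lam]
    ring
  have hn := physical_nonlinearity hf mp.1 hp (integrable_of_l2 hfw)
    (integrable_symX_mul hfw hp) hq
  rw [map_sub, map_add, map_add] at hn
  filter_upwards [hn, Lp.coeFn_sub (physical (rhs f) + physical p3 + physical p) (physical r),
    Lp.coeFn_add (physical (rhs f) + physical p3) (physical p),
    Lp.coeFn_add (physical (rhs f)) (physical p3)] with z h1 h2 h3 h4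
  rw [h2, Pi.sub_apply, h3, Pi.add_apply, h4, Pi.add_apply] at h1
  linarith

/-- `physical` is a bounded real-linear map that inverts `fourierL2` on Hermitian functions, so the
Lipschitz bound, the time derivatives and the weighted bounds all carry over from the frequency
side. -/
lemma exists_solution {k T : ℝ} (hk : 0 < k) (hT0 : 0 < T)
    (hT : 16 * (energyConst 0 + 1) * k * T ≤ 1) {N : ℕ} {φ : L2} (hφ : MemY N φ)
    (hφk : normY 0 φ ≤ ENNReal.ofReal k) :
    ∃ u : ℝ → L2, MemLinftyY N T u ∧ IsSolution T u ∧ u 0 = φ := by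
  have hg0 := (l2_wtE_zero_le_normY φ).trans hφk
  obtain ⟨f, h0, hherm, hbd, ⟨K, hlip⟩, hder⟩ :=
    exists_spec_solution hk hT0 hT (herm_fourierL2 φ) hg0
  obtain ⟨C, hCt, hC⟩ := hbd N (l2_wtE_lt_top hφ)
  obtain ⟨C₀, hC₀t, hC₀⟩ := hbd 0 (hg0.trans_lt ENNReal.ofReal_lt_top)
  obtain ⟨D, hDt, hD⟩ := exists_normY_bound N hCt
  have hu : LipschitzOnWith (‖physical‖₊ * K) (fun t => physical (f t)) (Set.Icc 0 T) :=
    physical.lipschitz.comp_lipschitzOnWith hlip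
  have hCu : ∀ t ∈ Set.Icc 0 T, l2 (fun ζ => wtE N ζ * ‖fourierL2 (physical (f t)) ζ‖ₑ) ≤ C :=
    fun t ht => by rw [fourierL2_physical (hherm t ht)]; exact hC t ht
  refine ⟨fun t => physical (f t), ⟨?_, fun t ht => ?_, ?_⟩, ⟨⟨_, hu⟩, ?_⟩, ?_⟩
  · exact hu.continuousOn.aestronglyMeasurable measurableSet_Icc
  · exact memY_of_l2 ((hCu t ht).trans_lt hCt)
  · exact (iSup₂_le fun t ht => hD _ (hCu t ht)).trans_lt hDt
  · filter_upwards [hder] with t ht htT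
    have htI : t ∈ Set.Icc 0 T := ⟨htT.1.le, htT.2.le⟩
    obtain ⟨ux, uxxx, w, h1, h2, h3, h4⟩ :=
      equation_physical (hherm t htI) ((hC₀ t htI).trans_lt hC₀t)
    exact ⟨physical (rhs (f t)), ux, uxxx, w,
      physical.hasFDerivAt.comp_hasDerivAt t (ht htT), h1, h2, h3, h4⟩
  · change physical (f 0) = φ
    rw [h0, physical_fourierL2]

end KPI

theorem theorem4p2 (k₀ : ℝ) (hk₀ : 0 < k₀) :
    ∃ T : ℝ, 0 < T ∧
      ∀ (N : ℕ) (φ : KPI.L2), KPI.MemY N φ → KPI.normY 0 φ ≤ ENNReal.ofReal k₀ →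
        ∃ u : ℝ → KPI.L2,
          KPI.MemLinftyY N T u ∧ KPI.IsSolution T u ∧ u 0 = φ := by
  have hE := KPI.energyConst_nonneg 0
  -- Only the energy constant of order 0 enters, so T does not depend on N. The +1 keeps the
  -- denominator positive.
  refine ⟨1 / (16 * (KPI.energyConst 0 + 1) * k₀), by positivity, fun N φ hφ hφk =>
    KPI.exists_solution hk₀ (by positivity) (le_of_eq ?_) hφ hφk⟩
  field_simp
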